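/- Work in Minkowski space $\mathbb{R}^{1+3}$ with coordinates $(t,x)$, $x^0=t$, metric $g=\mathrm{diag}(-1,1,1,1)$ and the summation convention; Greek indices run over $0,\dots,3$, $\partial=(\partial_1,\partial_2,\partial_3)$ denotes spatial derivatives, and indices are raised and lowered with $g$. Let $\gamma>1$ and $$\Gamma(s)=\frac{(\gamma-1)^{(\gamma-1)/\gamma}}{\gamma\,e^{(\gamma-1)s/\gamma}},\qquad \Pi^{\alpha\beta}=g^{\alpha\beta}+u^\alpha u^\beta,\qquad G_{\alpha\beta}=g_{\alpha\beta}+2u_\alpha u_\beta,\qquad D_t=u^\mu\partial_\mu .$$ For $T>0$ and a function $r$ continuous on $[0,T]\times\mathbb{R}^3$ put $\Omega_t=\{x: r(t,x)>0\}$, $\Gamma_t=\partial\Omega_t$ and $\mathscr{D}=\bigcup_{0\le t\le T}\{t\}\times\Omega_t$. A *background* on $[0,T]$ is a triple $(s,r,u)$ that is $C^1$ on $\mathscr D$ up to the boundary (the restriction to $\mathscr D$ of a $C^1$ function on $\mathbb{R}^{1+3}$) and satisfies in $\mathscr{D}$ $$D_t s=0,\qquad D_t r+(\gamma-1)r\,\partial_\mu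 u^\mu=0,\qquad D_t u^\alpha+\frac{1}{\Gamma+r}\Pi^{\alpha\mu}\partial_\mu r=0,\qquad g_{\alpha\beta}u^\alpha u^\beta=-1,\quad u^0>0,$$ with $\Gamma=\Gamma(s)$. A *linearized solution* is a triple $(\tilde s,\tilde r,\tilde u)$, $C^1$ on $\mathscr D$ up to the boundary, satisfying in $\mathscr D$ $$D_t\tilde s=-\tilde u^\mu\partial_\mu s,\qquad D_t\tilde r+\tilde u^\mu\partial_\mu r+(\gamma-1)r\,\partial_\mu\tilde u^\mu=-(\gamma-1)\tilde r\,\partial_\mu u^\mu,$$ $$D_t\tilde u^\alpha+\frac{1}{\Gamma+r}\Pi^{\alpha\mu}\partial_\mu\tilde r=-\tilde u^\mu\partial_\mu u^\alpha-\frac{1}{\Gamma+r}(\tilde u^\alpha u^\mu+u^\alpha\tilde u^\mu)\partial_\mu r+\frac{\Gamma'}{(\Gamma+r)^2}\tilde s\,\Pi^{\alpha\mu}\partial_\mu r+\frac{1}{(\Gamma+r)^2}\tilde r\,\Pi^{\alpha\mu}\partial_\mu r,$$ and $\tilde u_\alpha u^\alpha=0$. Its energy is $$E^0[t]=\frac12\int_{\Omega_t}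 r^{\frac{2-\gamma}{\gamma-1}}\Big(\frac{1}{\gamma-1}\tilde r^2+(\Gamma+r)\,r\,G_{\alpha\beta}\tilde u^\alpha\tilde u^\beta+r\,\tilde s^2\Big)\,dx\in[0,\infty].$$ **Proposition (Basic Energy Inequality).** Let $\gamma>1$. There is a continuous function $\mathcal{C}:\mathbb{R}^6\to\mathbb{R}$ depending only on $\gamma$; for every $S$ there is a small constant $\hat\varepsilon\in(0,\tfrac12)$ depending only on $\gamma,S$; and for every $M$ there is a constant $D>0$ depending only on $\gamma,S,\hat\varepsilon,M$, such that the following holds. Let $T>0$ and let $(s,r,u)$ be a background on $[0,T]$ such that in $\mathscr D$ we have $|s|\le S$, $|u^\alpha|\le M$, $r\le\hat\varepsilon$, and $\partial s,\partial r,\partial u$ are bounded, and such that $r$ vanishes simply on the free boundary, that is, the spatial gradient of $r$ (extended continuously to the boundary) is nonzero at every point of $\Gamma_t$, $0\le t\le T$ (while $r=0$ there by continuity). Then for every linearized solution $(\tilde s,\tilde r,\tilde u)$ and every $t\in[0,T]$, the function $\tau\mapsto\mathcal C(N(\tau))$ is integrable on $[0,t]$ and $$E^0[t]\le D\,E^0[0]\,\exp\Big(\int_0^t\mathcal{C}(N(\tau))\,d\tau\Big),$$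 where $N(\tau)\in\mathbb{R}^6$ consists of the $L^\infty(\Omega_\tau)$ norms of $\partial s,\ \partial r,\ \partial u,\ s,\ r,\ u$. -/

import Mathlib

open MeasureTheory Set

namespace VacuumEuler

/-- Minkowski spacetime `ℝ^{1+3}` in Cartesian coordinates `(x⁰, x¹, x², x³)`, with `t = x⁰`. -/
abbrev Spacetime := Fin 4 → ℝ

/-- Space `ℝ³`; its `volume` is Lebesgue measure. -/
abbrev Space := Fin 3 → ℝ

/-- The spacetime point `(t, x)`. -/
def pt (t : ℝ) (x : Space) : Spacetime := Fin.cons t x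

/-- The slab `[0,T] × ℝ³`. -/
def slab (T : ℝ) : Set Spacetime := {p | p 0 ∈ Icc 0 T}

/-- The fluid region `Ω_t`, where `r(t, ·) > 0`. -/
def fluidRegion (r : Spacetime → ℝ) (t : ℝ) : Set Space := {x | 0 < r (pt t x)}

/-- The moving domain `𝒟`, the union of the `{t} × Ω_t` for `0 ≤ t ≤ T`. -/
def movingDomain (T : ℝ) (r : Spacetime → ℝ) : Set Spacetime := {p | p ∈ slab T ∧ 0 < r p}

/-- `f` is `C¹` on `𝒟` up to its boundary: it is on `𝒟` the restriction of a `C¹` function. -/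
def IsC1UpToBoundary (𝒟 : Set Spacetime) (f : Spacetime → ℝ) : Prop :=
  ∃ F : Spacetime → ℝ, ContDiff ℝ 1 F ∧ EqOn f F 𝒟

/-- The partial derivative `∂_μ f` on `𝒟` (one-sided in time at `t = 0` and `t = T`). -/
noncomputable def pd (𝒟 : Set Spacetime) (μ : Fin 4) (f : Spacetime → ℝ) (p : Spacetime) : ℝ :=
  fderivWithin ℝ f 𝒟 p (Pi.single μ 1)

/-- The Minkowski metric `diag(-1,1,1,1)`. The inverse metric has the same components. -/
def g (α β : Fin 4) : ℝ := if α = β then (if α = 0 then -1 else 1) else 0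

/-- Lowering an index, `v_α = g_{αβ} v^β`. -/
def lower (v : Fin 4 → ℝ) (α : Fin 4) : ℝ := ∑ β, g α β * v β

/-- The projection `Π^{αβ} = g^{αβ} + v^α v^β`. -/
def proj (v : Fin 4 → ℝ) (α β : Fin 4) : ℝ := g α β + v α * v β

/-- The squared length `G_{αβ} w^α w^β`, where `G_{αβ} = g_{αβ} + 2 v_α v_β`. -/
def normSqG (v w : Fin 4 → ℝ) : ℝ :=
  ∑ α, ∑ β, (g α β + 2 * lower v α * lower v β) * w α * w β

/-- `Γ(s) = (γ-1)^{(γ-1)/γ} / (γ e^{(γ-1)s/γ})`. -/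
noncomputable def Gam (γ s : ℝ) : ℝ :=
  (γ - 1) ^ ((γ - 1) / γ) / (γ * Real.exp ((γ - 1) / γ * s))

/-- The convective derivative `D_t f = u^μ ∂_μ f`. -/
noncomputable def Dt (𝒟 : Set Spacetime) (u : Spacetime → Fin 4 → ℝ) (f : Spacetime → ℝ)
    (p : Spacetime) : ℝ :=
  ∑ μ, u p μ * pd 𝒟 μ f p

/-- `(s, r, u)` is a classical solution, on the time interval `[0,T]`, of the relativistic Euler
equations in the moving domain `𝒟 = {r > 0}`, `C¹` up to the boundary of `𝒟`. Outside `𝒟` only the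
continuity of `r` is asked for, so that `r` vanishes on the free boundary. -/
structure IsEulerSolution (γ T : ℝ) (s r : Spacetime → ℝ) (u : Spacetime → Fin 4 → ℝ) : Prop where
  cont_r : ContinuousOn r (slab T)
  reg_s : IsC1UpToBoundary (movingDomain T r) s
  reg_r : IsC1UpToBoundary (movingDomain T r) r
  reg_u : ∀ α, IsC1UpToBoundary (movingDomain T r) (fun q => u q α)
  eq_s : ∀ p ∈ movingDomain T r, Dt (movingDomain T r) u s p = 0
  eq_r : ∀ p ∈ movingDomain T r,
    Dt (movingDomain T r) u r p
      + (γ - 1) * r p * ∑ μ, pd (movingDomain T r) μ (fun q => u q μ) p = 0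
  eq_u : ∀ p ∈ movingDomain T r, ∀ α,
    Dt (movingDomain T r) u (fun q => u q α) p
      + 1 / (Gam γ (s p) + r p) * ∑ μ, proj (u p) α μ * pd (movingDomain T r) μ r p = 0
  unit : ∀ p ∈ movingDomain T r, ∑ α, ∑ β, g α β * u p α * u p β = -1
  forward : ∀ p ∈ movingDomain T r, 0 < u p 0

/-- `r` vanishes simply on the free boundary `Γ_t = ∂Ω_t`, `0 ≤ t ≤ T`: the (continuous extension
to the boundary of the) spatial gradient of `r` does not vanish there. That `r = 0` on `Γ_t` follows
from the continuity of `r`. -/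
def VanishesSimply (T : ℝ) (r : Spacetime → ℝ) : Prop :=
  ∃ R : Spacetime → ℝ, ContDiff ℝ 1 R ∧ EqOn r R (movingDomain T r) ∧
    ∀ t ∈ Icc 0 T, ∀ x ∈ frontier (fluidRegion r t),
      ∃ i : Fin 3, fderiv ℝ R (pt t x) (Pi.single i.succ 1) ≠ 0

/-- `(s', r', u')` is a classical solution, `C¹` up to the boundary of the moving domain of
`(s, r, u)`, of the Euler equations linearized at `(s, r, u)`. -/
structure IsLinearizedSolution (γ T : ℝ) (s r : Spacetime → ℝ) (u : Spacetime → Fin 4 → ℝ)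
    (s' r' : Spacetime → ℝ) (u' : Spacetime → Fin 4 → ℝ) : Prop where
  reg_s : IsC1UpToBoundary (movingDomain T r) s'
  reg_r : IsC1UpToBoundary (movingDomain T r) r'
  reg_u : ∀ α, IsC1UpToBoundary (movingDomain T r) (fun q => u' q α)
  eq_s : ∀ p ∈ movingDomain T r,
    Dt (movingDomain T r) u s' p = -∑ μ, u' p μ * pd (movingDomain T r) μ s p
  eq_r : ∀ p ∈ movingDomain T r,
    Dt (movingDomain T r) u r' p
      + ∑ μ, u' p μ * pd (movingDomain T r) μ r p
      + (γ - 1) * r p * ∑ μ, pd (movingDomain T r) μ (fun q => u' q μ) p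
    = -(γ - 1) * r' p * ∑ μ, pd (movingDomain T r) μ (fun q => u q μ) p
  eq_u : ∀ p ∈ movingDomain T r, ∀ α,
    Dt (movingDomain T r) u (fun q => u' q α) p
      + 1 / (Gam γ (s p) + r p) * ∑ μ, proj (u p) α μ * pd (movingDomain T r) μ r' p
    = -∑ μ, u' p μ * pd (movingDomain T r) μ (fun q => u q α) p
      - 1 / (Gam γ (s p) + r p)
          * ∑ μ, (u' p α * u p μ + u p α * u' p μ) * pd (movingDomain T r) μ r p
      + deriv (Gam γ) (s p) / (Gam γ (s p) + r p) ^ 2 * s' p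
          * ∑ μ, proj (u p) α μ * pd (movingDomain T r) μ r p
      + 1 / (Gam γ (s p) + r p) ^ 2 * r' p
          * ∑ μ, proj (u p) α μ * pd (movingDomain T r) μ r p
  orth : ∀ p ∈ movingDomain T r, ∑ α, lower (u' p) α * u p α = 0

/-- The integrand of the energy. -/
noncomputable def energyDensity (γ : ℝ) (s r : Spacetime → ℝ) (u : Spacetime → Fin 4 → ℝ)
    (s' r' : Spacetime → ℝ) (u' : Spacetime → Fin 4 → ℝ) (p : Spacetime) : ℝ :=
  r p ^ ((2 - γ) / (γ - 1)) *
    (1 / (γ - 1) * r' p ^ 2 + (Gam γ (s p) + r p) * r p * normSqG (u p) (u' p) + r p * s' p ^ 2)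

/-- The energy `E⁰[t]`, one half of the integral over `Ω_t` of the nonnegative function
`energyDensity`, as an element of `[0,∞]`. -/
noncomputable def energy (γ : ℝ) (s r : Spacetime → ℝ) (u : Spacetime → Fin 4 → ℝ)
    (s' r' : Spacetime → ℝ) (u' : Spacetime → Fin 4 → ℝ) (t : ℝ) : ENNReal :=
  ∫⁻ x in fluidRegion r t, ENNReal.ofReal (1 / 2 * energyDensity γ s r u s' r' u' (pt t x))

/-- The `L^∞(Ω)` norm (essential supremum of the norm). -/
noncomputable def linf {V : Type*} [NormedAddCommGroup V] (Ω : Set Space) (f : Space → V) : ℝ :=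
  (eLpNorm f ⊤ (volume.restrict Ω)).toReal

/-- The `L^∞(Ω_t)` norms of `∂s, ∂r, ∂u, s, r, u`, where `∂ = (∂₁, ∂₂, ∂₃)`. -/
noncomputable def backgroundNorms (T : ℝ) (s r : Spacetime → ℝ) (u : Spacetime → Fin 4 → ℝ)
    (t : ℝ) : Fin 6 → ℝ :=
  ![linf (fluidRegion r t) (fun x (i : Fin 3) => pd (movingDomain T r) i.succ s (pt t x)),
    linf (fluidRegion r t) (fun x (i : Fin 3) => pd (movingDomain T r) i.succ r (pt t x)),
    linf (fluidRegion r t) (fun x (i : Fin 3) (α : Fin 4) =>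
      pd (movingDomain T r) i.succ (fun q => u q α) (pt t x)),
    linf (fluidRegion r t) (fun x => s (pt t x)),
    linf (fluidRegion r t) (fun x => r (pt t x)),
    linf (fluidRegion r t) (fun x => u (pt t x))]

/-- The first order spatial derivatives of `s, r, u` are bounded on `𝒟`. -/
def HasBoundedDerivatives (T : ℝ) (s r : Spacetime → ℝ) (u : Spacetime → Fin 4 → ℝ) : Prop :=
  ∃ K : ℝ, ∀ p ∈ movingDomain T r, ∀ i : Fin 3,
    |pd (movingDomain T r) i.succ s p| ≤ K ∧ |pd (movingDomain T r) i.succ r p| ≤ K ∧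
      ∀ α, |pd (movingDomain T r) i.succ (fun q => u q α) p| ≤ K

end VacuumEuler

open VacuumEuler

/-! # Basic energy inequality for the linearized relativistic Euler equations with vacuum

Write `e` for one half of `energyDensity`. By the background and the linearized equations, the
divergence of the energy current `V^μ = u^μ e + r^{1/(γ-1)} r' u'^μ` contains no derivative of the
linearized solution (`divergence_identity`), hence is at most a constant `c` times `e`, where `c`
depends only on bounds for the background (`energyCurrent_divergence`). Only spatial derivatives of
the background have to be bounded: the equations determine the time derivatives
(`abs_derivative_le`). The flux term of `V` is dominated by `e` when the sound speed is at most `1/2`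
(`abs_flux_le`), which is what the smallness of `r` provides; so `V⁰` is comparable to `e`, and
integrating the divergence and applying Gronwall's inequality gives the estimate, provided that no
boundary term appears.

The boundary terms are treated by cutoffs that decrease along the flow. At infinity this is
possible because `V` has finite speed (`sum_mul_pd_farCutoff_nonpos`). Near the free boundary, the
first term of `V` moves with the fluid, along which `r` grows or decays at most exponentially, so a
cutoff in `e^{-Kt} r` decreases along it. The second term leaves an error, carried by the thin shell
where the cutoff is not constant, and bounded there by a constant times `r^{(2-γ)/(γ-1)}`
(`sum_mul_pd_nearCutoff_le`, `energyCurrent_boundary`). It tends to zero with the width of the shell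
as soon as `r^{(2-γ)/(γ-1)}` is locally integrable on the moving domain. At time `0` this holds
because `r` vanishes simply and the exponent exceeds `-1` (`lintegral_rpow_lt_top`); it is propagated
by applying the same cutoff argument (`lintegral_farCutoff_mul_le`) to the current
`u^μ r^{(2-γ)/(γ-1)}`, for which the error at the free boundary is absent
(`exists_bound_lintegral_massCurrent`).

The norms `N(τ)` are in general not continuous in `τ`. They are lower semicontinuous as suprema of
continuous functions over slices of a relatively open set, hence measurable
(`measurable_indicator_linf`), and Gronwall's inequality is proved for integrable coefficients by
means of absolutely continuous functions (`gronwall_of_integral`). -/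

namespace VacuumEuler

/-! ### The domain and its partial derivatives -/

lemma continuous_pt : Continuous fun q : ℝ × Space => pt q.1 q.2 := by
  unfold pt
  refine continuous_pi fun i => ?_
  refine Fin.cases ?_ (fun j => ?_) i
  · simpa using continuous_fst
  · exact (continuous_apply j).comp continuous_snd

@[simp] lemma pt_zero (t : ℝ) (x : Space) : pt t x 0 = t := rfl

@[simp] lemma pt_succ (t : ℝ) (x : Space) (i : Fin 3) : pt t x i.succ = x i := rfl

lemma pt_eta (p : Spacetime) : pt (p 0) (fun i => p i.succ) = p := by
  funext i
  refine Fin.cases rfl (fun j => rfl) i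

lemma continuous_pt_right (t : ℝ) : Continuous (pt t) :=
  continuous_pt.comp (Continuous.prodMk_right t)

lemma continuous_pt_left (x : Space) : Continuous fun t => pt t x :=
  continuous_pt.comp (Continuous.prodMk_left x)

lemma measurePreserving_pt :
    MeasurePreserving (fun q : ℝ × Space => pt q.1 q.2) (volume.prod volume) volume := by
  have h := (volume_preserving_piFinSuccAbove (fun _ : Fin 4 => ℝ) 0).symm
  have e : (fun q : ℝ × Space => pt q.1 q.2) =
      (MeasurableEquiv.piFinSuccAbove (fun _ : Fin 4 => ℝ) 0).symm := by
    funext q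
    simp [pt, MeasurableEquiv.piFinSuccAbove, Fin.insertNthEquiv, Fin.insertNth_zero']
  rw [e]
  exact h

lemma measurableEmbedding_pt : MeasurableEmbedding fun q : ℝ × Space => pt q.1 q.2 := by
  have h := (MeasurableEquiv.piFinSuccAbove (fun _ : Fin 4 => ℝ) 0).symm.measurableEmbedding
  have e : (fun q : ℝ × Space => pt q.1 q.2) =
      (MeasurableEquiv.piFinSuccAbove (fun _ : Fin 4 => ℝ) 0).symm := by
    funext q
    simp [pt, MeasurableEquiv.piFinSuccAbove, Fin.insertNthEquiv, Fin.insertNth_zero']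
  rw [e]
  exact h

lemma isClosed_slab (T : ℝ) : IsClosed (slab T) :=
  isClosed_Icc.preimage (continuous_apply (0 : Fin 4))

lemma uniqueDiffOn_slab {T : ℝ} (hT : 0 < T) : UniqueDiffOn ℝ (slab T) := by
  refine uniqueDiffOn_convex ?_ ?_
  · exact (convex_Icc (0 : ℝ) T).is_linear_preimage (f := fun p : Spacetime => p 0)
      (IsLinearMap.mk (by simp) (by simp))
  · refine ⟨fun _ => T / 2, ?_⟩
    have ho : IsOpen {p : Spacetime | p 0 ∈ Ioo 0 T} :=
      isOpen_Ioo.preimage (continuous_apply (0 : Fin 4))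
    refine interior_maximal ?_ ho ?_
    · intro p hp
      exact Ioo_subset_Icc_self hp
    · simp only [mem_ofPred_eq, mem_Ioo]
      constructor <;> linarith

/-- The moving domain is relatively open in the slab. -/
lemma exists_isOpen_movingDomain {T : ℝ} {r : Spacetime → ℝ} (hr : ContinuousOn r (slab T)) :
    ∃ O : Set Spacetime, IsOpen O ∧ movingDomain T r = slab T ∩ O := by
  obtain ⟨O, hO, h⟩ := continuousOn_iff'.1 hr (Ioi 0) isOpen_Ioi
  refine ⟨O, hO, ?_⟩
  rw [inter_comm, ← h]
  ext p
  simp [movingDomain, and_comm]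

lemma uniqueDiffOn_movingDomain {T : ℝ} (hT : 0 < T) {r : Spacetime → ℝ}
    (hr : ContinuousOn r (slab T)) : UniqueDiffOn ℝ (movingDomain T r) := by
  obtain ⟨O, hO, h⟩ := exists_isOpen_movingDomain hr
  rw [h]
  exact (uniqueDiffOn_slab hT).inter hO

lemma measurableSet_movingDomain {T : ℝ} {r : Spacetime → ℝ} (hr : ContinuousOn r (slab T)) :
    MeasurableSet (movingDomain T r) := by
  obtain ⟨O, hO, h⟩ := exists_isOpen_movingDomain hr
  rw [h]
  exact (isClosed_slab T).measurableSet.inter hO.measurableSet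

lemma pt_mem_movingDomain {T : ℝ} {r : Spacetime → ℝ} {t : ℝ} {x : Space} (ht : t ∈ Icc 0 T) :
    pt t x ∈ movingDomain T r ↔ x ∈ fluidRegion r t := by
  simp only [movingDomain, slab, mem_ofPred_eq, pt_zero, fluidRegion]
  exact ⟨fun h => h.2, fun h => ⟨ht, h⟩⟩

lemma isOpen_fluidRegion {T : ℝ} {r : Spacetime → ℝ} (hr : ContinuousOn r (slab T)) {t : ℝ}
    (ht : t ∈ Icc 0 T) : IsOpen (fluidRegion r t) := by
  have : Continuous fun x => r (pt t x) :=
    hr.comp_continuous (continuous_pt_right t) (fun x => by simpa [slab] using ht)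
  exact isOpen_lt continuous_const this

lemma IsC1UpToBoundary.contDiffOn {𝒟 : Set Spacetime} {f : Spacetime → ℝ}
    (hf : IsC1UpToBoundary 𝒟 f) : ContDiffOn ℝ 1 f 𝒟 := by
  obtain ⟨F, hF, h⟩ := hf
  exact hF.contDiffOn.congr h

lemma IsC1UpToBoundary.exists_bound {𝒟 : Set Spacetime} {f : Spacetime → ℝ}
    (hf : IsC1UpToBoundary 𝒟 f) {K : Set Spacetime} (hK : IsCompact K) :
    ∃ B, ∀ p ∈ 𝒟 ∩ K, |f p| ≤ B := by
  obtain ⟨F, hF, h⟩ := hf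
  obtain ⟨B, hB⟩ := hK.exists_bound_of_continuousOn hF.continuous.continuousOn
  exact ⟨B, fun p hp => by simpa [h hp.1] using hB p hp.2⟩

section pd

variable {𝒟 : Set Spacetime} {f h : Spacetime → ℝ} {p : Spacetime} {μ : Fin 4}

lemma pd_add (hD : UniqueDiffWithinAt ℝ 𝒟 p) (hf : DifferentiableWithinAt ℝ f 𝒟 p)
    (hh : DifferentiableWithinAt ℝ h 𝒟 p) :
    pd 𝒟 μ (fun q => f q + h q) p = pd 𝒟 μ f p + pd 𝒟 μ h p := by
  simp [pd, fderivWithin_fun_add hD hf hh]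

lemma pd_mul (hD : UniqueDiffWithinAt ℝ 𝒟 p) (hf : DifferentiableWithinAt ℝ f 𝒟 p)
    (hh : DifferentiableWithinAt ℝ h 𝒟 p) :
    pd 𝒟 μ (fun q => f q * h q) p = pd 𝒟 μ f p * h p + f p * pd 𝒟 μ h p := by
  simp [pd, fderivWithin_fun_mul hD hf hh]
  ring

lemma pd_const_mul (hD : UniqueDiffWithinAt ℝ 𝒟 p) (hf : DifferentiableWithinAt ℝ f 𝒟 p)
    (c : ℝ) : pd 𝒟 μ (fun q => c * f q) p = c * pd 𝒟 μ f p := by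
  simp [pd, fderivWithin_const_mul hD hf]

lemma pd_comp (hD : UniqueDiffWithinAt ℝ 𝒟 p) (hf : DifferentiableWithinAt ℝ f 𝒟 p)
    {φ : ℝ → ℝ} {φ' : ℝ} (hφ : HasDerivAt φ φ' (f p)) :
    pd 𝒟 μ (fun q => φ (f q)) p = φ' * pd 𝒟 μ f p := by
  have := (hφ.comp_hasFDerivWithinAt p hf.hasFDerivWithinAt).fderivWithin hD
  simp only [pd]
  change fderivWithin ℝ (φ ∘ f) 𝒟 p _ = _
  rw [this]
  simp

lemma pd_coord (hD : UniqueDiffWithinAt ℝ 𝒟 p) (ν : Fin 4) :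
    pd 𝒟 μ (fun q => q ν) p = if μ = ν then 1 else 0 := by
  have : HasFDerivWithinAt (fun q : Spacetime => q ν)
      (ContinuousLinearMap.proj ν : Spacetime →L[ℝ] ℝ) 𝒟 p :=
    (ContinuousLinearMap.proj ν : Spacetime →L[ℝ] ℝ).hasFDerivWithinAt
  simp only [pd, this.fderivWithin hD]
  simp [Pi.single_apply, eq_comm]

lemma pd_congr {f h : Spacetime → ℝ} (H : EqOn f h 𝒟) (hp : p ∈ 𝒟) :
    pd 𝒟 μ f p = pd 𝒟 μ h p := by
  simp [pd, fderivWithin_congr H (H hp)]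

lemma continuousOn_pd (hD : UniqueDiffOn ℝ 𝒟) (hf : ContDiffOn ℝ 1 f 𝒟) :
    ContinuousOn (pd 𝒟 μ f) 𝒟 := by
  have := hf.continuousOn_fderivWithin hD le_rfl
  exact this.clm_apply continuousOn_const

end pd

/-! ### The divergence theorem for fields vanishing near the free boundary -/

/-- The part of the slab where `r` is bounded below by `δ` and the spatial coordinates are bounded
by `L`. For `δ > 0` it is a compact subset of the moving domain. -/
def core (T : ℝ) (r : Spacetime → ℝ) (δ L : ℝ) : Set Spacetime :=
  {p | p ∈ slab T ∧ δ ≤ r p ∧ ∀ i : Fin 3, |p i.succ| ≤ L}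

/-- The part of the slab with spatial coordinates bounded by `L`. -/
def slabBox (T L : ℝ) : Set Spacetime := {p | p ∈ slab T ∧ ∀ i : Fin 3, |p i.succ| ≤ L}

lemma isCompact_slabBox (T L : ℝ) : IsCompact (slabBox T L) := by
  have : slabBox T L = Icc (pt 0 fun _ => -L) (pt T fun _ => L) := by
    ext p
    simp only [slabBox, slab, mem_ofPred_eq, mem_Icc, Pi.le_def, Fin.forall_fin_succ (n := 3),
      pt_zero, pt_succ, abs_le]
    simp only [forall_and]
    tauto
  rw [this]
  exact isCompact_Icc

section

variable {T δ L : ℝ} {r : Spacetime → ℝ}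

lemma isCompact_core (hr : ContinuousOn r (slab T)) : IsCompact (core T r δ L) := by
  have h1 : core T r δ L = slabBox T L ∩ {p | p ∈ slab T ∧ r p ∈ Ici δ} := by
    ext p
    simp only [core, slabBox, mem_ofPred_eq, mem_inter_iff, mem_Ici]
    tauto
  rw [h1]
  exact (isCompact_slabBox T L).inter_right (hr.preimage_isClosed_of_isClosed (isClosed_slab T)
    isClosed_Ici)

lemma core_subset (hδ : 0 < δ) : core T r δ L ⊆ movingDomain T r :=
  fun _ hp => ⟨hp.1, hδ.trans_le hp.2.1⟩

lemma indicator_core_eq {f : Spacetime → ℝ} (hδ : 0 < δ)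
    (hf : ∀ p ∈ movingDomain T r, f p ≠ 0 → p ∈ core T r δ L) :
    (movingDomain T r).indicator f = (core T r δ L).indicator f := by
  funext p
  by_cases hp : p ∈ core T r δ L
  · rw [indicator_of_mem hp, indicator_of_mem (core_subset hδ hp)]
  · rw [indicator_of_notMem hp]
    by_cases hq : p ∈ movingDomain T r
    · rw [indicator_of_mem hq]
      by_contra h
      exact hp (hf p hq h)
    · rw [indicator_of_notMem hq]

lemma integrable_indicator_movingDomain {f : Spacetime → ℝ} (hr : ContinuousOn r (slab T))
    (hδ : 0 < δ) (hc : ContinuousOn f (movingDomain T r))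
    (hf : ∀ p ∈ movingDomain T r, f p ≠ 0 → p ∈ core T r δ L) :
    Integrable ((movingDomain T r).indicator f) := by
  rw [indicator_core_eq hδ hf, integrable_indicator_iff (isCompact_core hr).measurableSet]
  exact (hc.mono (core_subset hδ)).integrableOn_compact (isCompact_core hr)

lemma integrable_indicator_slice {f : Spacetime → ℝ} (hr : ContinuousOn r (slab T))
    (hδ : 0 < δ) (hc : ContinuousOn f (movingDomain T r))
    (hf : ∀ p ∈ movingDomain T r, f p ≠ 0 → p ∈ core T r δ L) (t : ℝ) :
    Integrable fun x => (movingDomain T r).indicator f (pt t x) := by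
  rw [indicator_core_eq hδ hf]
  have hK : IsCompact (pt t ⁻¹' core T r δ L) := by
    refine IsCompact.of_isClosed_subset (isCompact_Icc (a := fun _ : Fin 3 => -L)
      (b := fun _ => L)) ((isCompact_core hr).isClosed.preimage (continuous_pt_right t)) ?_
    intro x hx
    refine ⟨fun i => ?_, fun i => ?_⟩
    · exact (abs_le.1 (hx.2.2 i)).1
    · exact (abs_le.1 (hx.2.2 i)).2
  have : (fun x => (core T r δ L).indicator f (pt t x)) =
      (pt t ⁻¹' core T r δ L).indicator (fun x => f (pt t x)) := by
    funext x
    rfl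
  rw [this, integrable_indicator_iff hK.measurableSet]
  exact (hc.comp (continuous_pt_right t).continuousOn
    (fun x hx => core_subset hδ hx)).integrableOn_compact hK

lemma continuousOn_indicator_slab {f : Spacetime → ℝ} (hr : ContinuousOn r (slab T))
    (hδ : 0 < δ) (hc : ContinuousOn f (movingDomain T r))
    (hf : ∀ p ∈ movingDomain T r, f p ≠ 0 → p ∈ core T r δ L) :
    ContinuousOn ((movingDomain T r).indicator f) (slab T) := by
  intro p hp
  by_cases hD : p ∈ movingDomain T r
  · obtain ⟨O, hO, h⟩ := exists_isOpen_movingDomain hr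
    have h1 : ContinuousWithinAt ((movingDomain T r).indicator f) (movingDomain T r) p :=
      (hc p hD).congr (fun q hq => indicator_of_mem hq _) (indicator_of_mem hD _)
    have hpO : p ∈ O := by rw [h] at hD; exact hD.2
    nth_rewrite 2 [h] at h1
    exact (continuousWithinAt_inter (hO.mem_nhds hpO)).1 h1
  · have hK : p ∉ core T r δ L := fun h => hD (core_subset hδ h)
    rw [indicator_core_eq hδ hf]
    have : (core T r δ L).indicator f =ᶠ[nhds p] fun _ => 0 := by
      filter_upwards [(isCompact_core hr).isClosed.isOpen_compl.mem_nhds hK] with q hq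
      exact indicator_of_notMem hq _
    exact (continuousAt_const.congr this.symm).continuousWithinAt

lemma pd_eq_zero_of_notMem_core {f : Spacetime → ℝ} (hr : ContinuousOn r (slab T))
    (hf : ∀ p ∈ movingDomain T r, f p ≠ 0 → p ∈ core T r δ L) {p : Spacetime}
    (hp : p ∈ movingDomain T r) (hK : p ∉ core T r δ L) (μ : Fin 4) :
    pd (movingDomain T r) μ f p = 0 := by
  have h : f =ᶠ[nhdsWithin p (movingDomain T r)] fun _ => 0 := by
    have hK' := nhdsWithin_le_nhds (s := movingDomain T r)
      ((isCompact_core (δ := δ) (L := L) hr).isClosed.isOpen_compl.mem_nhds hK)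
    filter_upwards [self_mem_nhdsWithin, hK'] with q hq hqK
    by_contra hne
    exact hqK (hf q hq hne)
  rw [pd, h.fderivWithin_eq (h.self_of_nhdsWithin hp)]
  simp

/-- The divergence of `V`, extended by zero outside the moving domain. -/
noncomputable def div (T : ℝ) (r : Spacetime → ℝ) (V : Fin 4 → Spacetime → ℝ)
    (p : Spacetime) : ℝ :=
  (movingDomain T r).indicator (fun p => ∑ μ, pd (movingDomain T r) μ (V μ) p) p

variable {V : Fin 4 → Spacetime → ℝ}

lemma integrable_div (hT : 0 < T) (hr : ContinuousOn r (slab T)) (hδ : 0 < δ)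
    (hV : ∀ μ, ContDiffOn ℝ 1 (V μ) (movingDomain T r))
    (hsupp : ∀ μ, ∀ p ∈ movingDomain T r, V μ p ≠ 0 → p ∈ core T r δ L) :
    Integrable (div T r V) ∧ ∀ t, Integrable fun x => div T r V (pt t x) := by
  have hc : ContinuousOn (fun p => ∑ μ, pd (movingDomain T r) μ (V μ) p) (movingDomain T r) :=
    continuousOn_finsetSum _ fun μ _ => continuousOn_pd (uniqueDiffOn_movingDomain hT hr) (hV μ)
  have hs : ∀ p ∈ movingDomain T r, ∑ μ, pd (movingDomain T r) μ (V μ) p ≠ 0 →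
      p ∈ core T r δ L := by
    intro p hp hne
    by_contra hK
    exact hne (Finset.sum_eq_zero fun μ _ => pd_eq_zero_of_notMem_core hr (hsupp μ) hp hK μ)
  exact ⟨integrable_indicator_movingDomain hr hδ hc hs,
    integrable_indicator_slice hr hδ hc hs⟩

lemma hasFDerivAt_indicator {f : Spacetime → ℝ} (hr : ContinuousOn r (slab T)) (hδ : 0 < δ)
    (hf : ContDiffOn ℝ 1 f (movingDomain T r))
    (hsupp : ∀ p ∈ movingDomain T r, f p ≠ 0 → p ∈ core T r δ L) {p : Spacetime}
    (hp : p 0 ∈ Ioo 0 T) :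
    HasFDerivAt ((movingDomain T r).indicator f)
      ((movingDomain T r).indicator (fderivWithin ℝ f (movingDomain T r)) p) p := by
  by_cases hD : p ∈ movingDomain T r
  · rw [indicator_of_mem hD]
    have hmem : movingDomain T r ∈ nhds p := by
      obtain ⟨O, hO, h⟩ := exists_isOpen_movingDomain hr
      have hpO : p ∈ O := by rw [h] at hD; exact hD.2
      rw [h]
      refine Filter.inter_mem ?_ (hO.mem_nhds hpO)
      exact Filter.mem_of_superset
        ((isOpen_Ioo.preimage (continuous_apply (0 : Fin 4))).mem_nhds hp)
        fun q hq => Ioo_subset_Icc_self hq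
    have h1 := (hf.differentiableOn one_ne_zero p hD).hasFDerivWithinAt.hasFDerivAt hmem
    refine h1.congr_of_eventuallyEq ?_
    filter_upwards [hmem] with q hq
    exact indicator_of_mem hq _
  · rw [indicator_of_notMem hD, indicator_core_eq hδ hsupp]
    have hK : p ∉ core T r δ L := fun h => hD (core_subset hδ h)
    refine (hasFDerivAt_const (0 : ℝ) p).congr_of_eventuallyEq ?_
    filter_upwards [(isCompact_core hr).isClosed.isOpen_compl.mem_nhds hK] with q hq
    exact indicator_of_notMem hq _

/-- Divergence theorem on `𝒟 ∩ {t₀ ≤ t ≤ t₁}` for a field supported away from the free boundary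
and from spatial infinity. -/
theorem integral_slice_sub_integral_slice (hT : 0 < T) (hr : ContinuousOn r (slab T)) (hδ : 0 < δ)
    (hV : ∀ μ, ContDiffOn ℝ 1 (V μ) (movingDomain T r))
    (hsupp : ∀ μ, ∀ p ∈ movingDomain T r, V μ p ≠ 0 → p ∈ core T r δ L) {t₀ t₁ : ℝ}
    (h₀ : 0 ≤ t₀) (h : t₀ ≤ t₁) (h₁ : t₁ ≤ T) :
    (∫ x, (movingDomain T r).indicator (V 0) (pt t₁ x)) -
      (∫ x, (movingDomain T r).indicator (V 0) (pt t₀ x)) =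
    ∫ τ in t₀..t₁, ∫ x, div T r V (pt τ x) := by
  set L' : ℝ := |L| + 1
  have hL' : L < L' := by have := le_abs_self L; simp only [L']; linarith
  have hL0 : 0 ≤ L' := by positivity
  set a : Spacetime := pt t₀ fun _ => -L'
  set b : Spacetime := pt t₁ fun _ => L'
  have hab : a ≤ b := by
    intro i
    refine Fin.cases ?_ (fun j => ?_) i
    · exact h
    · change -L' ≤ L'
      linarith
  have hbox : Icc a b ⊆ slab T := by
    intro p hp
    exact ⟨h₀.trans (hp.1 0), (hp.2 0).trans h₁⟩
  have hzero : ∀ μ (p : Spacetime) (i : Fin 3), |p i.succ| = L' →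
      (movingDomain T r).indicator (V μ) p = 0 := by
    intro μ p i hp
    rw [indicator_core_eq hδ (hsupp μ)]
    refine indicator_of_notMem (fun hK => ?_) _
    have := hK.2.2 i
    linarith
  have hout : ∀ (f : Spacetime → ℝ) (t : ℝ), f.support ⊆ core T r δ L →
      ∀ x : Space, x ∉ Icc (fun _ : Fin 3 => -L') (fun _ => L') → f (pt t x) = 0 := by
    intro f t hf x hx
    by_contra hne
    have hK := hf hne
    refine hx ⟨fun i => ?_, fun i => ?_⟩
    · have := (abs_le.1 (hK.2.2 i)).1
      simp only [pt_succ] at this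
      change -L' ≤ x i
      linarith
    · have := (abs_le.1 (hK.2.2 i)).2
      simp only [pt_succ] at this
      change x i ≤ L'
      linarith
  have hdivsupp : (div T r V).support ⊆ core T r δ L := by
    intro p hp
    by_contra hK
    refine hp ?_
    unfold div
    by_cases hD : p ∈ movingDomain T r
    · rw [indicator_of_mem hD]
      exact Finset.sum_eq_zero fun μ _ => pd_eq_zero_of_notMem_core hr (hsupp μ) hD hK μ
    · rw [indicator_of_notMem hD]
  have hVsupp : ((movingDomain T r).indicator (V 0)).support ⊆ core T r δ L := by
    rw [indicator_core_eq hδ (hsupp 0)]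
    exact support_indicator_subset
  have hsum : ∀ p, ∑ i, (movingDomain T r).indicator
      (fderivWithin ℝ (V i) (movingDomain T r)) p (Pi.single i 1) = div T r V p := by
    intro p
    unfold div
    by_cases hD : p ∈ movingDomain T r
    · simp only [indicator_of_mem hD, pd]
    · simp only [indicator_of_notMem hD]
      simp
  obtain ⟨hint, -⟩ := integrable_div hT hr hδ hV hsupp
  have key := integral_divergence_of_hasFDerivAt_off_countable' a b hab
    (fun i => (movingDomain T r).indicator (V i))
    (fun i p => (movingDomain T r).indicator (fderivWithin ℝ (V i) (movingDomain T r)) p)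
    ∅ countable_empty
    (fun i => (continuousOn_indicator_slab hr hδ (hV i).continuousOn (hsupp i)).mono hbox)
    (fun p hp i => by
      refine hasFDerivAt_indicator hr hδ (hV i) (hsupp i) ?_
      have := hp.1 0 (mem_univ _)
      exact ⟨h₀.trans_lt this.1, this.2.trans_le h₁⟩)
    (by simp only [hsum]; exact hint.integrableOn)
  simp only [hsum] at key
  rw [Fin.sum_univ_succ] at key
  have hlat : ∑ i : Fin 3, ((∫ x in Icc (a ∘ i.succ.succAbove) (b ∘ i.succ.succAbove),
        (movingDomain T r).indicator (V i.succ) (i.succ.insertNth (b i.succ) x)) -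
      ∫ x in Icc (a ∘ i.succ.succAbove) (b ∘ i.succ.succAbove),
        (movingDomain T r).indicator (V i.succ) (i.succ.insertNth (a i.succ) x)) = 0 := by
    refine Finset.sum_eq_zero fun i _ => ?_
    rw [integral_eq_zero_of_ae, integral_eq_zero_of_ae, sub_zero]
    · refine Filter.Eventually.of_forall fun x => hzero _ _ i ?_
      simp [a, abs_of_nonneg hL0]
    · refine Filter.Eventually.of_forall fun x => hzero _ _ i ?_
      simp [b, abs_of_nonneg hL0]
  rw [hlat, add_zero] at key
  have hface : ∀ c : ℝ, (∫ x in Icc (a ∘ (0 : Fin 4).succAbove) (b ∘ (0 : Fin 4).succAbove),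
      (movingDomain T r).indicator (V 0) ((0 : Fin 4).insertNth c x)) =
      ∫ x, (movingDomain T r).indicator (V 0) (pt c x) := by
    intro c
    have hset : Icc (a ∘ (0 : Fin 4).succAbove) (b ∘ (0 : Fin 4).succAbove) =
      Icc (fun _ : Fin 3 => -L') (fun _ => L') := rfl
    rw [hset]
    simp only [Fin.insertNth_zero']
    exact setIntegral_eq_integral_of_forall_compl_eq_zero (hout _ c hVsupp)
  rw [hface, hface] at key
  refine key.symm.trans ?_
  rw [intervalIntegral.integral_of_le h, ← integral_Icc_eq_integral_Ioc,
    ← integral_indicator measurableSet_Icc, ← integral_indicator measurableSet_Icc,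
    ← measurePreserving_pt.integral_comp measurableEmbedding_pt, integral_prod]
  · refine integral_congr_ae (Filter.Eventually.of_forall fun τ => ?_)
    simp only
    by_cases hτ : τ ∈ Icc t₀ t₁
    · rw [indicator_of_mem hτ]
      refine integral_congr_ae (Filter.Eventually.of_forall fun x => ?_)
      simp only
      by_cases hx : pt τ x ∈ Icc a b
      · rw [indicator_of_mem hx]
      · rw [indicator_of_notMem hx]
        refine (hout _ τ hdivsupp x fun hx' => hx ?_).symm
        refine ⟨fun i => ?_, fun i => ?_⟩
        · exact Fin.cases hτ.1 (fun j => hx'.1 j) i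
        · exact Fin.cases hτ.2 (fun j => hx'.2 j) i
    · rw [indicator_of_notMem hτ]
      refine integral_eq_zero_of_ae (Filter.Eventually.of_forall fun x => ?_)
      refine indicator_of_notMem (fun hx => hτ ⟨hx.1 0, hx.2 0⟩) _
  · exact (measurePreserving_pt.integrable_comp_emb measurableEmbedding_pt).2
      (hint.indicator measurableSet_Icc)

end

/-! ### A Gronwall inequality with integrable coefficients -/

lemma absolutelyContinuousOnInterval_of_dist_le {f h : ℝ → ℝ} {a b : ℝ}
    (hf : AbsolutelyContinuousOnInterval f a b)
    (hle : ∀ x ∈ uIcc a b, ∀ y ∈ uIcc a b, dist (h x) (h y) ≤ dist (f x) (f y)) :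
    AbsolutelyContinuousOnInterval h a b := by
  rw [absolutelyContinuousOnInterval_iff] at hf ⊢
  intro ε hε
  obtain ⟨δ, hδ, H⟩ := hf ε hε
  refine ⟨δ, hδ, fun E hE hlt => (Finset.sum_le_sum fun i hi => ?_).trans_lt (H E hE hlt)⟩
  have := hE.1 i hi
  exact hle _ this.1 _ this.2

/-- Gronwall's inequality for an absolutely continuous function, where the coefficient `c` is only
integrable. -/
theorem gronwall_of_integral {y d c η : ℝ → ℝ} {t : ℝ} (ht : 0 ≤ t)
    (hy : ∀ τ ∈ Icc 0 t, y τ - y 0 = ∫ σ in (0 : ℝ)..τ, d σ)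
    (hd : IntervalIntegrable d volume 0 t) (hc : IntervalIntegrable c volume 0 t)
    (hη : IntervalIntegrable η volume 0 t) (hc0 : ∀ τ ∈ Icc 0 t, 0 ≤ c τ)
    (hη0 : ∀ τ ∈ Icc 0 t, 0 ≤ η τ)
    (hle : ∀ᵐ τ, τ ∈ Icc 0 t → d τ ≤ c τ * y τ + η τ) :
    y t ≤ Real.exp (∫ τ in (0 : ℝ)..t, c τ) * (y 0 + ∫ τ in (0 : ℝ)..t, η τ) := by
  set A : ℝ → ℝ := fun τ => ∫ σ in (0 : ℝ)..τ, c σ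
  set F : ℝ → ℝ := fun τ => y 0 + ∫ σ in (0 : ℝ)..τ, d σ
  have hFy : ∀ τ ∈ Icc 0 t, F τ = y τ := fun τ hτ => by
    have := hy τ hτ
    simp only [F]
    linarith
  have h0 : (0 : ℝ) ∈ uIcc 0 t := left_mem_uIcc
  have hI : uIcc 0 t = Icc 0 t := uIcc_of_le ht
  have hA := hc.absolutelyContinuousOnInterval_intervalIntegral h0
  have hF0 := hd.absolutelyContinuousOnInterval_intervalIntegral h0
  have hAnn : ∀ τ ∈ Icc 0 t, 0 ≤ A τ := fun τ hτ =>
    intervalIntegral.integral_nonneg hτ.1 fun σ hσ => hc0 σ ⟨hσ.1, hσ.2.trans hτ.2⟩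
  have hE : AbsolutelyContinuousOnInterval (fun τ => Real.exp (-A τ)) 0 t := by
    refine absolutelyContinuousOnInterval_of_dist_le hA ?_
    -- `x ↦ exp (-x)` is 1-Lipschitz on `[0, ∞)`
    have hlip : ∀ x y : ℝ, 0 ≤ x → x ≤ y → |Real.exp (-x) - Real.exp (-y)| ≤ |x - y| := by
      intro x y hx hxy
      rw [abs_of_nonneg (sub_nonneg.2 (Real.exp_le_exp.2 (by linarith))), abs_sub_comm,
        abs_of_nonneg (sub_nonneg.2 hxy)]
      have h1 : Real.exp (-y) = Real.exp (-x) * Real.exp (x - y) := by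
        rw [← Real.exp_add]; ring_nf
      have h2 := Real.add_one_le_exp (x - y)
      have h3 : Real.exp (-x) ≤ 1 := Real.exp_le_one_iff.2 (by linarith)
      have h4 := Real.exp_pos (-x)
      rw [h1]
      nlinarith
    intro x hx z hz
    rw [hI] at hx hz
    rw [Real.dist_eq, Real.dist_eq]
    rcases le_total (A x) (A z) with h | h
    · exact hlip _ _ (hAnn x hx) h
    · rw [abs_sub_comm]
      nth_rewrite 2 [abs_sub_comm]
      exact hlip _ _ (hAnn z hz) h
  have hF : AbsolutelyContinuousOnInterval F 0 t := by
    refine absolutelyContinuousOnInterval_of_dist_le hF0 fun x _ z _ => ?_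
    simp [F]
  have hEF := hE.fun_mul hF
  have hint := hEF.integral_deriv_eq_sub
  have hmono : ∫ τ in (0 : ℝ)..t, deriv (fun τ => Real.exp (-A τ) * F τ) τ ≤
      ∫ τ in (0 : ℝ)..t, η τ := by
    rw [intervalIntegral.integral_of_le ht, intervalIntegral.integral_of_le ht]
    refine integral_mono_ae hEF.intervalIntegrable_deriv.1 hη.1 ?_
    rw [Filter.EventuallyLE, ae_restrict_iff' measurableSet_Ioc]
    filter_upwards [hc.ae_hasDerivAt_integral, hd.ae_hasDerivAt_integral, hle] with τ h1 h2 hle' hτ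
    have hτ' : τ ∈ Icc 0 t := Ioc_subset_Icc_self hτ
    rw [← hI] at hτ'
    have hA' : HasDerivAt A (c τ) τ := h1 hτ' 0 h0
    have hF' : HasDerivAt F (d τ) τ := (h2 hτ' 0 h0).const_add _
    have hP := (hA'.neg.exp).mul hF'
    rw [hI] at hτ'
    have : deriv (fun τ => Real.exp (-A τ) * F τ) τ = Real.exp (-A τ) * (d τ - c τ * F τ) := by
      refine (HasDerivAt.deriv hP).trans ?_
      simp only [Pi.neg_apply]
      ring
    rw [this, hFy τ hτ']
    have h3 : Real.exp (-A τ) ≤ 1 := Real.exp_le_one_iff.2 (by linarith [hAnn τ hτ'])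
    have h4 := Real.exp_pos (-A τ)
    have h5 := hle' hτ'
    have h6 := hη0 τ hτ'
    nlinarith
  rw [hint, hFy t ⟨ht, le_rfl⟩, hFy 0 ⟨le_rfl, ht⟩] at hmono
  have hA0 : A 0 = 0 := by simp [A]
  rw [hA0] at hmono
  simp only [neg_zero, Real.exp_zero, one_mul] at hmono
  have h7 : Real.exp (-A t) * y t ≤ y 0 + ∫ τ in (0 : ℝ)..t, η τ := by linarith
  calc y t = Real.exp (A t) * (Real.exp (-A t) * y t) := by
        rw [← mul_assoc, ← Real.exp_add]; simp
    _ ≤ _ := mul_le_mul_of_nonneg_left h7 (Real.exp_pos _).le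

/-! ### Cutoffs that decrease along the flow -/

lemma exists_bound_deriv_smoothTransition :
    ∃ B : ℝ, 0 ≤ B ∧ ∀ z, 0 ≤ deriv Real.smoothTransition z ∧
      deriv Real.smoothTransition z ≤ B ∧ (1 < z → deriv Real.smoothTransition z = 0) := by
  have hc : Continuous (deriv Real.smoothTransition) :=
    (Real.smoothTransition.contDiff (n := 1)).continuous_deriv le_rfl
  obtain ⟨B, hB⟩ := (isCompact_Icc (a := (0 : ℝ)) (b := 1)).exists_bound_of_continuousOn
    hc.continuousOn
  have h1 : ∀ z, 1 < z → deriv Real.smoothTransition z = 0 := by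
    intro z hz
    have : Real.smoothTransition =ᶠ[nhds z] fun _ => 1 := by
      filter_upwards [lt_mem_nhds hz] with w hw
      exact Real.smoothTransition.one_of_one_le hw.le
    simpa using this.deriv_eq
  have h0 : ∀ z, z < 0 → deriv Real.smoothTransition z = 0 := by
    intro z hz
    have : Real.smoothTransition =ᶠ[nhds z] fun _ => 0 := by
      filter_upwards [gt_mem_nhds hz] with w hw
      exact Real.smoothTransition.zero_of_nonpos hw.le
    simpa using this.deriv_eq
  have hB0 : 0 ≤ B := (norm_nonneg _).trans (hB 0 ⟨le_rfl, zero_le_one⟩)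
  refine ⟨B, hB0, fun z => ⟨Real.smoothTransition.monotone.deriv_nonneg, ?_, h1 z⟩⟩
  by_cases hz0 : z < 0
  · rw [h0 z hz0]; exact hB0
  · by_cases hz1 : 1 < z
    · rw [h1 z hz1]; exact hB0
    · exact (le_abs_self _).trans (hB z ⟨not_lt.1 hz0, not_lt.1 hz1⟩)

/-- The exponentially growing radius function `e^{Λt} (1 + |x|²) / L`. -/
noncomputable def growingRadius (Λ L : ℝ) (p : Spacetime) : ℝ :=
  Real.exp (Λ * p 0) / L * ((1 + p 1 ^ 2) + (p 2 ^ 2 + p 3 ^ 2))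

/-- A cutoff at spatial infinity: `1` where `growingRadius` is at most `1`, and `0` where it is at
least `2`. -/
noncomputable def farCutoff (Λ L : ℝ) (p : Spacetime) : ℝ :=
  Real.smoothTransition (2 - growingRadius Λ L p)

/-- A cutoff near the free boundary: `0` where `k e^{-Kt} r ≤ 1`, and `1` where `k e^{-Kt} r ≥ 2`.
-/
noncomputable def nearCutoff (K k : ℝ) (r : Spacetime → ℝ) (p : Spacetime) : ℝ :=
  Real.smoothTransition (k * (Real.exp (-K * p 0) * r p) - 1)

lemma contDiff_coord (μ : Fin 4) : ContDiff ℝ 1 fun p : Spacetime => p μ := contDiff_apply ℝ ℝ μ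

lemma contDiff_growingRadius (Λ L : ℝ) : ContDiff ℝ 1 (growingRadius Λ L) := by
  unfold growingRadius
  have := contDiff_coord
  fun_prop

lemma contDiff_farCutoff (Λ L : ℝ) : ContDiff ℝ 1 (farCutoff Λ L) :=
  Real.smoothTransition.contDiff.comp (contDiff_const.sub (contDiff_growingRadius Λ L))

lemma farCutoff_nonneg (Λ L : ℝ) (p : Spacetime) : 0 ≤ farCutoff Λ L p :=
  Real.smoothTransition.nonneg _

lemma farCutoff_le_one (Λ L : ℝ) (p : Spacetime) : farCutoff Λ L p ≤ 1 :=
  Real.smoothTransition.le_one _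

lemma nearCutoff_nonneg (K k : ℝ) (r : Spacetime → ℝ) (p : Spacetime) : 0 ≤ nearCutoff K k r p :=
  Real.smoothTransition.nonneg _

lemma nearCutoff_le_one (K k : ℝ) (r : Spacetime → ℝ) (p : Spacetime) : nearCutoff K k r p ≤ 1 :=
  Real.smoothTransition.le_one _

lemma abs_le_of_farCutoff_ne_zero {Λ L : ℝ} (hΛ : 0 ≤ Λ) (hL : 0 < L) {p : Spacetime}
    (hp : 0 ≤ p 0) (h : farCutoff Λ L p ≠ 0) (i : Fin 3) : |p i.succ| ≤ 2 * L + 1 := by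
  have h1 : growingRadius Λ L p < 2 := by
    by_contra h2
    exact h (Real.smoothTransition.zero_of_nonpos (by linarith))
  unfold growingRadius at h1
  have h2 : 1 ≤ Real.exp (Λ * p 0) := Real.one_le_exp (mul_nonneg hΛ hp)
  have h3 : (1 + p 1 ^ 2) + (p 2 ^ 2 + p 3 ^ 2) < 2 * L := by
    rw [div_mul_eq_mul_div, div_lt_iff₀ hL] at h1
    have : 0 ≤ (1 + p 1 ^ 2) + (p 2 ^ 2 + p 3 ^ 2) := by positivity
    nlinarith
  have h4 : p i.succ ^ 2 ≤ 2 * L := by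
    have := sq_nonneg (p 1)
    have := sq_nonneg (p 2)
    have := sq_nonneg (p 3)
    fin_cases i
    · change p 1 ^ 2 ≤ _; linarith
    · change p 2 ^ 2 ≤ _; linarith
    · change p 3 ^ 2 ≤ _; linarith
  refine abs_le_of_sq_le_sq (h4.trans ?_) (by linarith)
  nlinarith

lemma lt_of_nearCutoff_ne_zero {K k : ℝ} (hK : 0 ≤ K) (hk : 0 < k) {r : Spacetime → ℝ}
    {p : Spacetime} (hp : 0 ≤ p 0) (hr : 0 < r p) (h : nearCutoff K k r p ≠ 0) : 1 / k ≤ r p := by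
  have h1 : 1 < k * (Real.exp (-K * p 0) * r p) := by
    by_contra h2
    exact h (Real.smoothTransition.zero_of_nonpos (by linarith))
  have h2 : Real.exp (-K * p 0) ≤ 1 := Real.exp_le_one_iff.2 (by nlinarith)
  rw [div_le_iff₀ hk]
  have h3 : Real.exp (-K * p 0) * r p ≤ r p := by nlinarith
  nlinarith

section

variable {𝒟 : Set Spacetime} {p : Spacetime}

lemma differentiableWithinAt_coord (μ : Fin 4) :
    DifferentiableWithinAt ℝ (fun p : Spacetime => p μ) 𝒟 p :=
  ((contDiff_coord μ).differentiable one_ne_zero p).differentiableWithinAt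

lemma pd_growingRadius (hD : UniqueDiffWithinAt ℝ 𝒟 p) (Λ L : ℝ) :
    pd 𝒟 0 (growingRadius Λ L) p = Λ * growingRadius Λ L p ∧
      ∀ i : Fin 3, pd 𝒟 i.succ (growingRadius Λ L) p =
        Real.exp (Λ * p 0) / L * (2 * p i.succ) := by
  have hE : ∀ μ, pd 𝒟 μ (fun p => Real.exp (Λ * p 0) / L) p =
      Λ * (Real.exp (Λ * p 0) / L) * (if μ = 0 then 1 else 0) := by
    intro μ
    rw [← pd_coord hD 0]
    refine pd_comp (φ := fun z => Real.exp (Λ * z) / L) hD (differentiableWithinAt_coord 0) ?_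
    refine ((((hasDerivAt_id (p 0)).const_mul Λ).exp).div_const L).congr_deriv ?_
    simp only [id_eq]
    ring
  have hS : ∀ μ ν, pd 𝒟 μ (fun p => p ν ^ 2) p = 2 * p ν * (if μ = ν then 1 else 0) := by
    intro μ ν
    rw [← pd_coord hD ν]
    refine pd_comp (φ := fun z => z ^ 2) hD (differentiableWithinAt_coord ν) ?_
    simpa using hasDerivAt_pow 2 (p ν)
  have hS1 : ∀ μ ν, pd 𝒟 μ (fun p => 1 + p ν ^ 2) p = 2 * p ν * (if μ = ν then 1 else 0) := by
    intro μ ν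
    rw [← pd_coord hD ν]
    refine pd_comp (φ := fun z => 1 + z ^ 2) hD (differentiableWithinAt_coord ν) ?_
    simpa using (hasDerivAt_pow 2 (p ν)).const_add 1
  have hall : ∀ μ, pd 𝒟 μ (growingRadius Λ L) p =
      (Λ * (Real.exp (Λ * p 0) / L) * (if μ = 0 then 1 else 0)) *
        ((1 + p 1 ^ 2) + (p 2 ^ 2 + p 3 ^ 2)) + Real.exp (Λ * p 0) / L *
        (2 * p 1 * (if μ = 1 then 1 else 0) +
          (2 * p 2 * (if μ = 2 then 1 else 0) + 2 * p 3 * (if μ = 3 then 1 else 0))) := by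
    intro μ
    have d := fun ν => differentiableWithinAt_coord (𝒟 := 𝒟) (p := p) ν
    have hX : DifferentiableWithinAt ℝ
        (fun p : Spacetime => (1 + p 1 ^ 2) + (p 2 ^ 2 + p 3 ^ 2)) 𝒟 p := by fun_prop
    unfold growingRadius
    rw [pd_mul hD (by fun_prop) hX, hE, pd_add hD (by fun_prop) (by fun_prop), hS1,
      pd_add hD (by fun_prop) (by fun_prop), hS, hS]
  refine ⟨?_, fun i => ?_⟩
  · rw [hall]
    simp [growingRadius]
    ring
  · rw [hall]
    fin_cases i <;> simp

/-- The far cutoff decreases along a field whose spatial part is dominated by `Λ` times its time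
component. -/
lemma sum_mul_pd_farCutoff_nonpos (hD : UniqueDiffWithinAt ℝ 𝒟 p) {Λ L : ℝ} (hL : 0 < L)
    {v : Fin 4 → ℝ} (hv : ∑ i : Fin 3, |v i.succ| ≤ Λ * v 0) :
    ∑ μ, v μ * pd 𝒟 μ (farCutoff Λ L) p ≤ 0 := by
  obtain ⟨B, -, hB⟩ := exists_bound_deriv_smoothTransition
  have hd : DifferentiableWithinAt ℝ (growingRadius Λ L) 𝒟 p :=
    ((contDiff_growingRadius Λ L).differentiable one_ne_zero p).differentiableWithinAt
  have h1 : ∀ μ, pd 𝒟 μ (farCutoff Λ L) p =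
      -deriv Real.smoothTransition (2 - growingRadius Λ L p) * pd 𝒟 μ (growingRadius Λ L) p := by
    intro μ
    refine pd_comp (φ := fun z => Real.smoothTransition (2 - z)) hD hd ?_
    have h := ((Real.smoothTransition.contDiff (n := 1)).differentiable one_ne_zero
      (2 - growingRadius Λ L p)).hasDerivAt
    simpa using h.comp_const_sub 2 (growingRadius Λ L p)
  obtain ⟨h0, hi⟩ := pd_growingRadius hD Λ L
  have h2 : ∑ μ, v μ * pd 𝒟 μ (farCutoff Λ L) p =
      -deriv Real.smoothTransition (2 - growingRadius Λ L p) *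
        ∑ μ, v μ * pd 𝒟 μ (growingRadius Λ L) p := by
    simp only [h1, Finset.mul_sum]
    exact Finset.sum_congr rfl fun μ _ => by ring
  rw [h2]
  have h3 : 0 ≤ ∑ μ, v μ * pd 𝒟 μ (growingRadius Λ L) p := by
    rw [Fin.sum_univ_succ, h0]
    simp only [hi]
    set E := Real.exp (Λ * p 0) / L
    have hE : 0 ≤ E := by positivity
    have hX : growingRadius Λ L p = E * ((1 + p 1 ^ 2) + (p 2 ^ 2 + p 3 ^ 2)) := rfl
    set X := (1 + p 1 ^ 2) + (p 2 ^ 2 + p 3 ^ 2)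
    have hXi : ∀ i : Fin 3, 2 * |p i.succ| ≤ X := by
      have := sq_nonneg (p 1)
      have := sq_nonneg (p 2)
      have := sq_nonneg (p 3)
      intro i
      have h5 : 2 * |p i.succ| ≤ 1 + p i.succ ^ 2 := by
        nlinarith [sq_nonneg (|p i.succ| - 1), sq_abs (p i.succ)]
      refine h5.trans ?_
      fin_cases i
      · change 1 + p 1 ^ 2 ≤ X; simp only [X]; linarith
      · change 1 + p 2 ^ 2 ≤ X; simp only [X]; linarith
      · change 1 + p 3 ^ 2 ≤ X; simp only [X]; linarith
    have h6 : -(E * X * ∑ i : Fin 3, |v i.succ|) ≤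
        ∑ i : Fin 3, v i.succ * (E * (2 * p i.succ)) := by
      rw [Finset.mul_sum, ← Finset.sum_neg_distrib]
      refine Finset.sum_le_sum fun i _ => ?_
      have h7 : |v i.succ * (E * (2 * p i.succ))| ≤ E * X * |v i.succ| := by
        rw [abs_mul, abs_mul, abs_mul, abs_of_nonneg hE, abs_of_nonneg (zero_le_two (α := ℝ))]
        have := mul_le_mul_of_nonneg_left (hXi i) (mul_nonneg hE (abs_nonneg (v i.succ)))
        linarith
      linarith [neg_abs_le (v i.succ * (E * (2 * p i.succ)))]
    have hEX : 0 ≤ E * X := mul_nonneg hE ((mul_nonneg zero_le_two (abs_nonneg _)).trans (hXi 0))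
    have := mul_le_mul_of_nonneg_left hv hEX
    rw [hX]
    linarith
  nlinarith [(hB (2 - growingRadius Λ L p)).1]

/-- Up to an error carried by the shell `k e^{-Kt} r ≤ 2`, the near cutoff decreases along a field
`v` along which `r` grows at a rate at most `K`. -/
lemma sum_mul_pd_nearCutoff_le (hD : UniqueDiffWithinAt ℝ 𝒟 p) {K k B f : ℝ} (hk : 0 < k)
    (hB : ∀ z, 0 ≤ deriv Real.smoothTransition z ∧
      deriv Real.smoothTransition z ≤ B ∧ (1 < z → deriv Real.smoothTransition z = 0))
    {r : Spacetime → ℝ} (hr : DifferentiableWithinAt ℝ r 𝒟 p) (hr0 : 0 < r p) (hf : 0 ≤ f)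
    {v : Fin 4 → ℝ} (hv : ∑ μ, v μ * pd 𝒟 μ r p ≤ K * r p * v 0 + r p * f) :
    ∑ μ, v μ * pd 𝒟 μ (nearCutoff K k r) p ≤
      if k * (Real.exp (-K * p 0) * r p) ≤ 2 then 2 * B * f else 0 := by
  set E := Real.exp (-K * p 0)
  have hE : 0 < E := Real.exp_pos _
  have d0 := differentiableWithinAt_coord (𝒟 := 𝒟) (p := p) 0
  have hexp : ∀ μ, pd 𝒟 μ (fun p => Real.exp (-K * p 0)) p =
      -K * E * (if μ = 0 then 1 else 0) := by
    intro μ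
    rw [← pd_coord hD 0]
    refine pd_comp (φ := fun z => Real.exp (-K * z)) hD d0 ?_
    refine (((hasDerivAt_id (p 0)).const_mul (-K)).exp).congr_deriv ?_
    simp only [id_eq, E]
    ring
  have h1 : ∀ μ, pd 𝒟 μ (nearCutoff K k r) p =
      deriv Real.smoothTransition (k * (E * r p) - 1) * k *
        (-K * E * (if μ = 0 then 1 else 0) * r p + E * pd 𝒟 μ r p) := by
    intro μ
    rw [← hexp, ← pd_mul hD (by fun_prop) hr]
    refine pd_comp (φ := fun z => Real.smoothTransition (k * z - 1)) hD
      (by fun_prop) ?_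
    have h := ((Real.smoothTransition.contDiff (n := 1)).differentiable one_ne_zero
      (k * (E * r p) - 1)).hasDerivAt
    have h' : HasDerivAt (fun z => k * z - 1) k (E * r p) := by
      simpa using ((hasDerivAt_id (E * r p)).const_mul k).sub_const 1
    exact h.comp (E * r p) h'
  have h2 : ∑ μ, v μ * pd 𝒟 μ (nearCutoff K k r) p =
      deriv Real.smoothTransition (k * (E * r p) - 1) * k * E *
        (∑ μ, v μ * pd 𝒟 μ r p - K * r p * v 0) := by
    simp only [h1, Fin.sum_univ_succ (n := 3)]
    simp
    simp only [Fin.sum_univ_three]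
    ring
  rw [h2]
  obtain ⟨hb0, hb1, hb2⟩ := hB (k * (E * r p) - 1)
  set c := deriv Real.smoothTransition (k * (E * r p) - 1)
  have h3 : c * k * E * (∑ μ, v μ * pd 𝒟 μ r p - K * r p * v 0) ≤ c * (k * (E * r p)) * f := by
    have := mul_le_mul_of_nonneg_left (sub_le_iff_le_add'.2 hv)
      (mul_nonneg (mul_nonneg hb0 hk.le) hE.le)
    linarith
  refine h3.trans ?_
  split_ifs with h
  · have h4 : c * (k * (E * r p)) ≤ B * 2 := by
      have : 0 ≤ k * (E * r p) := by positivity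
      exact mul_le_mul hb1 h this (hb0.trans hb1)
    nlinarith
  · rw [hb2 (by linarith)]
    simp

end

/-! ### Energy inequality for a field with small flux through the free boundary -/

section

variable {T : ℝ} {r : Spacetime → ℝ} {V : Fin 4 → Spacetime → ℝ} {f : Spacetime → ℝ} {c : ℝ → ℝ}
  {Λ K L t : ℝ}

/-- The field `V` multiplied by both cutoffs. -/
noncomputable def cutField (Λ L K k : ℝ) (r : Spacetime → ℝ) (V : Fin 4 → Spacetime → ℝ)
    (μ : Fin 4) (p : Spacetime) : ℝ :=
  nearCutoff K k r p * farCutoff Λ L p * V μ p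

/-- The part of the slab where the near cutoff with parameter `k` is not yet constant. -/
def shell (T K k : ℝ) (r : Spacetime → ℝ) : Set Spacetime :=
  {p | p ∈ slab T ∧ k * (Real.exp (-K * p 0) * r p) ≤ 2}

lemma isClosed_shell (hr : ContinuousOn r (slab T)) (k : ℝ) : IsClosed (shell T K k r) := by
  have h : ContinuousOn (fun p => k * (Real.exp (-K * p 0) * r p)) (slab T) := by
    have : Continuous fun p : Spacetime => Real.exp (-K * p 0) := by fun_prop
    exact continuousOn_const.mul (this.continuousOn.mul hr)
  exact h.preimage_isClosed_of_isClosed (isClosed_slab T) isClosed_Iic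

lemma contDiffOn_nearCutoff (hrC : ContDiffOn ℝ 1 r (movingDomain T r)) (k : ℝ) :
    ContDiffOn ℝ 1 (nearCutoff K k r) (movingDomain T r) := by
  have h : ContDiff ℝ 1 fun p : Spacetime => Real.exp (-K * p 0) :=
    (contDiff_const.mul (contDiff_coord 0)).exp
  exact Real.smoothTransition.contDiff.comp_contDiffOn
    ((contDiffOn_const.mul (h.contDiffOn.mul hrC)).sub contDiffOn_const)

lemma contDiffOn_cutField (hrC : ContDiffOn ℝ 1 r (movingDomain T r))
    (hV : ∀ μ, ContDiffOn ℝ 1 (V μ) (movingDomain T r)) (k : ℝ) (μ : Fin 4) :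
    ContDiffOn ℝ 1 (cutField Λ L K k r V μ) (movingDomain T r) :=
  ((contDiffOn_nearCutoff hrC k).mul (contDiff_farCutoff Λ L).contDiffOn).mul (hV μ)

lemma cutField_support (hΛ : 0 ≤ Λ) (hK : 0 ≤ K) (hL : 0 < L) {k : ℝ} (hk : 0 < k) (μ : Fin 4) :
    ∀ p ∈ movingDomain T r, cutField Λ L K k r V μ p ≠ 0 →
      p ∈ core T r (1 / k) (2 * L + 1) := by
  intro p hp h
  have h1 : nearCutoff K k r p ≠ 0 := fun h0 => h (by simp [cutField, h0])
  have h2 : farCutoff Λ L p ≠ 0 := fun h0 => h (by simp [cutField, h0])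
  exact ⟨hp.1, lt_of_nearCutoff_ne_zero hK hk hp.1.1 hp.2 h1,
    abs_le_of_farCutoff_ne_zero hΛ hL hp.1.1 h2⟩

lemma div_cutField_le {B : ℝ} (hT : 0 < T) (hr : ContinuousOn r (slab T))
    (hrC : ContDiffOn ℝ 1 r (movingDomain T r))
    (hV : ∀ μ, ContDiffOn ℝ 1 (V μ) (movingDomain T r)) (hf0 : ∀ p ∈ movingDomain T r, 0 ≤ f p)
    (hL : 0 < L)
    (hspeed : ∀ p ∈ movingDomain T r, ∑ i : Fin 3, |V i.succ p| ≤ Λ * V 0 p)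
    (hbdry : ∀ p ∈ movingDomain T r,
      ∑ μ, V μ p * pd (movingDomain T r) μ r p ≤ K * r p * V 0 p + r p * f p)
    (hdiv : ∀ p ∈ movingDomain T r, ∑ μ, pd (movingDomain T r) μ (V μ) p ≤ c (p 0) * V 0 p)
    (hB : ∀ z, 0 ≤ deriv Real.smoothTransition z ∧
      deriv Real.smoothTransition z ≤ B ∧ (1 < z → deriv Real.smoothTransition z = 0))
    {k : ℝ} (hk : 0 < k) (p : Spacetime) :
    div T r (cutField Λ L K k r V) p ≤
      c (p 0) * (movingDomain T r).indicator (cutField Λ L K k r V 0) p +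
        2 * B * (shell T K k r).indicator
          ((movingDomain T r).indicator fun p => farCutoff Λ L p * f p) p := by
  by_cases hp : p ∈ movingDomain T r
  · have hD := uniqueDiffOn_movingDomain hT hr p hp
    have dn := (contDiffOn_nearCutoff (K := K) hrC k).differentiableOn one_ne_zero p hp
    have df := ((contDiff_farCutoff Λ L).contDiffOn (s := movingDomain T r)).differentiableOn
      one_ne_zero p hp
    have dV := fun μ => (hV μ).differentiableOn one_ne_zero p hp
    rw [div, indicator_of_mem hp, indicator_of_mem hp]
    set 𝒟 := movingDomain T r
    set χ := nearCutoff K k r p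
    set φ := farCutoff Λ L p
    have h1 : ∑ μ, pd 𝒟 μ (cutField Λ L K k r V μ) p =
        φ * ∑ μ, V μ p * pd 𝒟 μ (nearCutoff K k r) p +
          χ * ∑ μ, V μ p * pd 𝒟 μ (farCutoff Λ L) p + χ * φ * ∑ μ, pd 𝒟 μ (V μ) p := by
      simp only [Finset.mul_sum, ← Finset.sum_add_distrib]
      refine Finset.sum_congr rfl fun μ _ => ?_
      have dnf : DifferentiableWithinAt ℝ (fun q => nearCutoff K k r q * farCutoff Λ L q) 𝒟 p :=
        dn.mul df
      unfold cutField
      rw [pd_mul hD dnf (dV μ), pd_mul hD dn df]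
      ring
    have h2 := sum_mul_pd_farCutoff_nonpos hD hL (v := fun μ => V μ p) (hspeed p hp)
    have h3 := sum_mul_pd_nearCutoff_le hD hk hB (hrC.differentiableOn one_ne_zero p hp) hp.2
      (hf0 p hp) (v := fun μ => V μ p) (hbdry p hp)
    have hχ : 0 ≤ χ := nearCutoff_nonneg _ _ _ _
    have hφ : 0 ≤ φ := farCutoff_nonneg _ _ _
    have h4 := mul_le_mul_of_nonneg_left (hdiv p hp) (mul_nonneg hχ hφ)
    have h5 := mul_nonpos_of_nonneg_of_nonpos hχ h2
    have h6 := mul_le_mul_of_nonneg_left h3 hφ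
    have h7 : φ * (if k * (Real.exp (-K * p 0) * r p) ≤ 2 then 2 * B * f p else 0) =
        2 * B * (shell T K k r).indicator (𝒟.indicator fun p => farCutoff Λ L p * f p) p := by
      split_ifs with h
      · rw [indicator_of_mem (show p ∈ shell T K k r from ⟨hp.1, h⟩), indicator_of_mem hp]
        ring
      · rw [indicator_of_notMem (show p ∉ shell T K k r from fun h' => h h'.2)]
        ring
    rw [h1, ← h7]
    have h8 : c (p 0) * cutField Λ L K k r V 0 p = χ * φ * (c (p 0) * V 0 p) := by
      simp only [cutField, χ, φ]
      ring
    rw [h8]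
    linarith
  · rw [div, indicator_of_notMem hp, indicator_of_notMem hp]
    have : (shell T K k r).indicator
        ((movingDomain T r).indicator fun p => farCutoff Λ L p * f p) p = 0 := by
      by_cases hs : p ∈ shell T K k r
      · rw [indicator_of_mem hs, indicator_of_notMem hp]
      · rw [indicator_of_notMem hs]
    rw [this]
    simp

lemma tendsto_integral_shell (hr : ContinuousOn r (slab T)) {h : Spacetime → ℝ}
    (hint : Integrable ((movingDomain T r).indicator h)) :
    Filter.Tendsto (fun n : ℕ => ∫ p, (shell T K (n + 1) r).indicator
      ((movingDomain T r).indicator h) p) Filter.atTop (nhds 0) := by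
  have h0 : (0 : ℝ) = ∫ p : Spacetime, (0 : ℝ) := by simp
  rw [h0]
  refine tendsto_integral_of_dominated_convergence
    (fun p => ‖(movingDomain T r).indicator h p‖) ?_ hint.norm ?_ ?_
  · exact fun n => hint.aestronglyMeasurable.indicator (isClosed_shell hr _).measurableSet
  · exact fun n => Filter.Eventually.of_forall fun p => norm_indicator_le_norm_self _ _
  · refine Filter.Eventually.of_forall fun p => ?_
    by_cases hp : p ∈ movingDomain T r
    · refine tendsto_const_nhds.congr' ?_
      have hpos : 0 < Real.exp (-K * p 0) * r p := mul_pos (Real.exp_pos _) hp.2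
      obtain ⟨N, hN⟩ := exists_nat_gt (2 / (Real.exp (-K * p 0) * r p))
      filter_upwards [Filter.eventually_ge_atTop N] with n hn
      refine (indicator_of_notMem (fun hs => ?_) _).symm
      have h1 := hs.2
      rw [div_lt_iff₀ hpos] at hN
      have h2 : (N : ℝ) ≤ n := by exact_mod_cast hn
      nlinarith
    · refine tendsto_const_nhds.congr fun n => ?_
      by_cases hs : p ∈ shell T K (n + 1) r
      · rw [indicator_of_mem hs, indicator_of_notMem hp]
      · rw [indicator_of_notMem hs]

/-- The energy inequality with both cutoffs in place. -/
lemma integral_cutField_le {B : ℝ} (hT : 0 < T) (hr : ContinuousOn r (slab T))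
    (hrC : ContDiffOn ℝ 1 r (movingDomain T r))
    (hV : ∀ μ, ContDiffOn ℝ 1 (V μ) (movingDomain T r)) (hf0 : ∀ p ∈ movingDomain T r, 0 ≤ f p)
    (hΛ : 0 ≤ Λ) (hK : 0 ≤ K) (hL : 0 < L)
    (hspeed : ∀ p ∈ movingDomain T r, ∑ i : Fin 3, |V i.succ p| ≤ Λ * V 0 p)
    (hbdry : ∀ p ∈ movingDomain T r,
      ∑ μ, V μ p * pd (movingDomain T r) μ r p ≤ K * r p * V 0 p + r p * f p)
    (hdiv : ∀ p ∈ movingDomain T r, ∑ μ, pd (movingDomain T r) μ (V μ) p ≤ c (p 0) * V 0 p)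
    (hB0 : 0 ≤ B) (hB : ∀ z, 0 ≤ deriv Real.smoothTransition z ∧
      deriv Real.smoothTransition z ≤ B ∧ (1 < z → deriv Real.smoothTransition z = 0))
    (ht : t ∈ Icc 0 T) (hc0 : ∀ τ ∈ Icc 0 t, 0 ≤ c τ) (hc : IntervalIntegrable c volume 0 t)
    (hfint : Integrable ((movingDomain T r).indicator fun p => farCutoff Λ L p * f p))
    {k : ℝ} (hk : 0 < k) :
    ∫ x, (movingDomain T r).indicator (cutField Λ L K k r V 0) (pt t x) ≤
      Real.exp (∫ τ in (0 : ℝ)..t, c τ) *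
        ((∫ x, (movingDomain T r).indicator (cutField Λ L K k r V 0) (pt 0 x)) +
          2 * B * ∫ p, (shell T K k r).indicator
            ((movingDomain T r).indicator fun p => farCutoff Λ L p * f p) p) := by
  have hWc := contDiffOn_cutField (Λ := Λ) (L := L) (K := K) hrC hV k
  have hWs := cutField_support (T := T) (r := r) (V := V) hΛ hK hL hk
  have hδ : 0 < 1 / k := by positivity
  obtain ⟨hdI, hdx⟩ := integrable_div hT hr hδ hWc hWs
  set h : Spacetime → ℝ := fun p => 2 * B * (shell T K k r).indicator
    ((movingDomain T r).indicator fun p => farCutoff Λ L p * f p) p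
  have hhI : Integrable h :=
    (hfint.indicator (isClosed_shell hr k).measurableSet).const_mul (2 * B)
  have hh0 : ∀ p, 0 ≤ h p := fun p => by
    refine mul_nonneg (by positivity) (indicator_nonneg (fun q _ => ?_) p)
    exact indicator_nonneg (fun q hq => mul_nonneg (farCutoff_nonneg _ _ _) (hf0 q hq)) q
  have hhP : Integrable (fun q : ℝ × Space => h (pt q.1 q.2)) (volume.prod volume) :=
    (measurePreserving_pt.integrable_comp_emb measurableEmbedding_pt).2 hhI
  have hdP : Integrable (fun q : ℝ × Space => div T r (cutField Λ L K k r V) (pt q.1 q.2))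
      (volume.prod volume) :=
    (measurePreserving_pt.integrable_comp_emb measurableEmbedding_pt).2 hdI
  have hWx := integrable_indicator_slice hr hδ (hWc 0).continuousOn (hWs 0)
  have hηI : Integrable fun τ => ∫ x, h (pt τ x) := hhP.integral_prod_left
  have hη0 : ∀ τ, 0 ≤ ∫ x, h (pt τ x) := fun τ => integral_nonneg fun x => hh0 _
  have hg := gronwall_of_integral (c := c)
    (y := fun τ => ∫ x, (movingDomain T r).indicator (cutField Λ L K k r V 0) (pt τ x))
    (d := fun τ => ∫ x, div T r (cutField Λ L K k r V) (pt τ x))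
    (η := fun τ => ∫ x, h (pt τ x)) ht.1
    (fun τ hτ => integral_slice_sub_integral_slice hT hr hδ hWc hWs le_rfl hτ.1
      (hτ.2.trans ht.2))
    hdP.integral_prod_left.intervalIntegrable hc hηI.intervalIntegrable hc0
    (fun τ _ => hη0 τ)
    (by
      filter_upwards [hhP.prod_right_ae] with τ hτ _
      rw [← integral_const_mul, ← integral_add ((hWx τ).const_mul _) hτ]
      exact integral_mono (hdx τ) (((hWx τ).const_mul _).add hτ) fun x =>
        div_cutField_le hT hr hrC hV hf0 hL hspeed hbdry hdiv hB hk (pt τ x))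
  refine hg.trans (mul_le_mul_of_nonneg_left (add_le_add le_rfl ?_) (Real.exp_pos _).le)
  rw [← integral_const_mul, ← measurePreserving_pt.integral_comp measurableEmbedding_pt,
    integral_prod _ hhP, intervalIntegral.integral_of_le ht.1]
  exact setIntegral_le_integral hηI (Filter.Eventually.of_forall hη0)

/-- A nonnegative density `V⁰` whose current `V` has speed at most `Λ`, divergence at most `c V⁰`,
and flux through the level sets of `r` controlled by `K r V⁰` up to the locally integrable
function `f`, satisfies a localized Gronwall inequality on the slices of the moving domain. -/
theorem lintegral_farCutoff_mul_le (hT : 0 < T) (hr : ContinuousOn r (slab T))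
    (hrC : ContDiffOn ℝ 1 r (movingDomain T r))
    (hV : ∀ μ, ContDiffOn ℝ 1 (V μ) (movingDomain T r)) (hf0 : ∀ p ∈ movingDomain T r, 0 ≤ f p)
    (hV0 : ∀ p ∈ movingDomain T r, 0 ≤ V 0 p) (hΛ : 0 ≤ Λ) (hK : 0 ≤ K) (hL : 0 < L)
    (hspeed : ∀ p ∈ movingDomain T r, ∑ i : Fin 3, |V i.succ p| ≤ Λ * V 0 p)
    (hbdry : ∀ p ∈ movingDomain T r,
      ∑ μ, V μ p * pd (movingDomain T r) μ r p ≤ K * r p * V 0 p + r p * f p)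
    (hdiv : ∀ p ∈ movingDomain T r, ∑ μ, pd (movingDomain T r) μ (V μ) p ≤ c (p 0) * V 0 p)
    (ht : t ∈ Icc 0 T) (hc0 : ∀ τ ∈ Icc 0 t, 0 ≤ c τ) (hc : IntervalIntegrable c volume 0 t)
    (hfint : Integrable ((movingDomain T r).indicator fun p => farCutoff Λ L p * f p)) :
    ∫⁻ x in fluidRegion r t, ENNReal.ofReal (farCutoff Λ L (pt t x) * V 0 (pt t x)) ≤
      ENNReal.ofReal (Real.exp (∫ τ in (0 : ℝ)..t, c τ)) *
        ∫⁻ x in fluidRegion r 0, ENNReal.ofReal (farCutoff Λ L (pt 0 x) * V 0 (pt 0 x)) := by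
  obtain ⟨B, hB0, hB⟩ := exists_bound_deriv_smoothTransition
  have h00 : (0 : ℝ) ∈ Icc 0 T := ⟨le_rfl, hT.le⟩
  set A := Real.exp (∫ τ in (0 : ℝ)..t, c τ)
  set I₀ := ∫⁻ x in fluidRegion r 0, ENNReal.ofReal (farCutoff Λ L (pt 0 x) * V 0 (pt 0 x))
  set e : ℕ → ℝ := fun n => ∫ p, (shell T K (n + 1) r).indicator
      ((movingDomain T r).indicator fun p => farCutoff Λ L p * f p) p
  set W : ℕ → Spacetime → ℝ := fun n => (movingDomain T r).indicator
    (cutField Λ L K (n + 1) r V 0)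
  have hW0 : ∀ n p, 0 ≤ W n p := fun n p => indicator_nonneg (fun q hq => mul_nonneg
    (mul_nonneg (nearCutoff_nonneg _ _ _ _) (farCutoff_nonneg _ _ _)) (hV0 q hq)) p
  have hWI : ∀ n τ, Integrable fun x => W n (pt τ x) := fun n τ =>
    integrable_indicator_slice hr (by positivity)
      (contDiffOn_cutField hrC hV _ 0).continuousOn
      (cutField_support hΛ hK hL (by positivity) 0) τ
  have hstep : ∀ n : ℕ, ∫⁻ x in fluidRegion r t, ENNReal.ofReal (W n (pt t x)) ≤
      ENNReal.ofReal A * (I₀ + ENNReal.ofReal (2 * B * e n)) := by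
    intro n
    have h1 := integral_cutField_le hT hr hrC hV hf0 hΛ hK hL hspeed hbdry hdiv hB0 hB ht
      hc0 hc hfint (k := n + 1) (by positivity)
    calc ∫⁻ x in fluidRegion r t, ENNReal.ofReal (W n (pt t x))
        ≤ ∫⁻ x, ENNReal.ofReal (W n (pt t x)) := setLIntegral_le_lintegral _ _
      _ = ENNReal.ofReal (∫ x, W n (pt t x)) :=
          (ofReal_integral_eq_lintegral_ofReal (hWI n t)
            (Filter.Eventually.of_forall fun x => hW0 n _)).symm
      _ ≤ ENNReal.ofReal (A * ((∫ x, W n (pt 0 x)) + 2 * B * e n)) :=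
          ENNReal.ofReal_le_ofReal h1
      _ ≤ ENNReal.ofReal A * (ENNReal.ofReal (∫ x, W n (pt 0 x)) + ENNReal.ofReal (2 * B * e n)) := by
          rw [ENNReal.ofReal_mul (Real.exp_pos _).le]
          gcongr
          exact ENNReal.ofReal_add_le
      _ ≤ _ := by
          gcongr
          simp only [I₀]
          rw [ofReal_integral_eq_lintegral_ofReal (hWI n 0)
            (Filter.Eventually.of_forall fun x => hW0 n _),
            ← lintegral_indicator (isOpen_fluidRegion hr h00).measurableSet]
          refine lintegral_mono fun x => ?_
          simp only [W]
          by_cases hx : x ∈ fluidRegion r 0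
          · have hp := (pt_mem_movingDomain h00).2 hx
            rw [indicator_of_mem hx, indicator_of_mem hp]
            refine ENNReal.ofReal_le_ofReal ?_
            refine mul_le_mul_of_nonneg_right ?_ (hV0 _ hp)
            exact mul_le_of_le_one_left (farCutoff_nonneg _ _ _) (nearCutoff_le_one _ _ _ _)
          · have hp := fun h => hx ((pt_mem_movingDomain (r := r) h00).1 h)
            rw [indicator_of_notMem hx, indicator_of_notMem hp]
            simp
  have hlim : Filter.Tendsto (fun n => ENNReal.ofReal A * (I₀ + ENNReal.ofReal (2 * B * e n)))
      Filter.atTop (nhds (ENNReal.ofReal A * I₀)) := by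
    have h1 : Filter.Tendsto (fun n => ENNReal.ofReal (2 * B * e n)) Filter.atTop (nhds 0) := by
      have h2 := (tendsto_integral_shell (K := K) hr hfint).const_mul (2 * B)
      rw [mul_zero] at h2
      simpa using ENNReal.tendsto_ofReal h2
    have h2 := (tendsto_const_nhds (x := I₀)).add h1
    rw [add_zero] at h2
    exact ENNReal.Tendsto.const_mul h2 (Or.inr ENNReal.ofReal_ne_top)
  calc ∫⁻ x in fluidRegion r t, ENNReal.ofReal (farCutoff Λ L (pt t x) * V 0 (pt t x))
      = ∫⁻ x in fluidRegion r t,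
          Filter.liminf (fun n => ENNReal.ofReal (W n (pt t x))) Filter.atTop := by
        refine setLIntegral_congr_fun (isOpen_fluidRegion hr ht).measurableSet fun x hx => ?_
        have hp := (pt_mem_movingDomain ht).2 hx
        symm
        refine Filter.Tendsto.liminf_eq (tendsto_const_nhds.congr' ?_)
        have hpos : 0 < Real.exp (-K * t) * r (pt t x) := mul_pos (Real.exp_pos _) hx
        obtain ⟨N, hN⟩ := exists_nat_gt (2 / (Real.exp (-K * t) * r (pt t x)))
        filter_upwards [Filter.eventually_ge_atTop N] with n hn
        rw [div_lt_iff₀ hpos] at hN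
        have h2 : (N : ℝ) ≤ n := by exact_mod_cast hn
        have h3 : nearCutoff K (n + 1) r (pt t x) = 1 := by
          refine Real.smoothTransition.one_of_one_le ?_
          rw [pt_zero]
          nlinarith
        simp only [W]
        rw [indicator_of_mem hp, cutField, h3, one_mul]
    _ ≤ Filter.liminf (fun n => ∫⁻ x in fluidRegion r t, ENNReal.ofReal (W n (pt t x)))
          Filter.atTop :=
        lintegral_liminf_le' fun n => (hWI n t).aestronglyMeasurable.aemeasurable.ennreal_ofReal.restrict
    _ ≤ Filter.liminf (fun n => ENNReal.ofReal A * (I₀ + ENNReal.ofReal (2 * B * e n)))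
          Filter.atTop := Filter.liminf_le_liminf (Filter.Eventually.of_forall hstep)
    _ = _ := hlim.liminf_eq

end

/-! ### Suprema over the slices as functions of time -/

section

variable {W : Type*} [NormedAddCommGroup W]

lemma linf_nonneg (Ω : Set Space) (f : Space → W) : 0 ≤ linf Ω f := ENNReal.toReal_nonneg

lemma linf_le {Ω : Set Space} (hΩ : IsOpen Ω) {f : Space → W} {B : ℝ} (hB0 : 0 ≤ B)
    (hB : ∀ x ∈ Ω, ‖f x‖ ≤ B) : linf Ω f ≤ B := by
  unfold linf
  refine ENNReal.toReal_le_of_le_ofReal hB0 ?_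
  rw [eLpNorm_exponent_top]
  refine eLpNormEssSup_le_of_ae_bound ?_
  rw [ae_restrict_iff' hΩ.measurableSet]
  exact Filter.Eventually.of_forall hB

/-- On an open set the `L^∞` norm of a bounded continuous function bounds it at every point. -/
lemma norm_le_linf {Ω : Set Space} (hΩ : IsOpen Ω) {f : Space → W} (hf : ContinuousOn f Ω)
    {B : ℝ} (hB : ∀ x ∈ Ω, ‖f x‖ ≤ B) {x : Space} (hx : x ∈ Ω) : ‖f x‖ ≤ linf Ω f := by
  have htop : eLpNorm f ⊤ (volume.restrict Ω) ≠ ⊤ := by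
    rw [eLpNorm_exponent_top]
    refine (eLpNormEssSup_lt_top_of_ae_bound (C := B) ?_).ne
    rw [ae_restrict_iff' hΩ.measurableSet]
    exact Filter.Eventually.of_forall hB
  have hae : ∀ᵐ y ∂volume.restrict Ω, ‖f y‖ ≤ linf Ω f := by
    have h := ae_le_eLpNormEssSup (f := f) (μ := volume.restrict Ω)
    filter_upwards [h] with y hy
    rw [← eLpNorm_exponent_top] at hy
    have := ENNReal.toReal_mono htop hy
    simpa [linf] using this
  by_contra hlt
  push Not at hlt
  have hopen : IsOpen (Ω ∩ (fun y => ‖f y‖) ⁻¹' Ioi (linf Ω f)) :=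
    hf.norm.isOpen_inter_preimage hΩ isOpen_Ioi
  have hpos : 0 < volume (Ω ∩ (fun y => ‖f y‖) ⁻¹' Ioi (linf Ω f)) :=
    hopen.measure_pos _ ⟨x, hx, hlt⟩
  rw [ae_restrict_iff' hΩ.measurableSet, ae_iff] at hae
  refine hpos.ne' (measure_mono_null ?_ hae)
  rintro y ⟨hy, hy'⟩ h
  exact absurd (h hy) (not_le.2 hy')

/-- For `f` bounded and continuous on the moving domain, the supremum of `‖f‖` over the slice at
time `τ` is a lower semicontinuous, hence measurable, function of `τ ∈ [0,T]`. -/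
lemma measurable_indicator_linf {T : ℝ} {r : Spacetime → ℝ} (hr : ContinuousOn r (slab T))
    {f : Spacetime → W} (hf : ContinuousOn f (movingDomain T r)) {B : ℝ}
    (hB : ∀ p ∈ movingDomain T r, ‖f p‖ ≤ B) :
    Measurable ((Icc 0 T).indicator fun τ => linf (fluidRegion r τ) fun x => f (pt τ x)) := by
  refine measurable_of_Ioi fun c => ?_
  by_cases hc : c < 0
  · convert MeasurableSet.univ
    refine eq_univ_of_forall fun τ => ?_
    exact hc.trans_le (indicator_nonneg (fun _ _ => linf_nonneg _ _) τ)
  · push Not at hc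
    obtain ⟨O, hO, h⟩ := exists_isOpen_movingDomain hr
    obtain ⟨O', hO', h'⟩ := continuousOn_iff'.1 hf.norm (Ioi c) isOpen_Ioi
    have hset : ((Icc 0 T).indicator fun τ => linf (fluidRegion r τ) fun x => f (pt τ x)) ⁻¹'
        Ioi c = Icc 0 T ∩ ⋃ x : Space, (fun τ => pt τ x) ⁻¹' (O' ∩ O) := by
      ext τ
      by_cases hτ : τ ∈ Icc 0 T
      · have hmem : ∀ x, x ∈ fluidRegion r τ ↔ pt τ x ∈ O := by
          intro x
          rw [← pt_mem_movingDomain hτ, h]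
          exact ⟨fun h => h.2, fun h => ⟨hτ, h⟩⟩
        have hiff : ∀ x, (pt τ x ∈ O' ∧ pt τ x ∈ O) ↔
            x ∈ fluidRegion r τ ∧ c < ‖f (pt τ x)‖ := by
          intro x
          have h1 := Set.ext_iff.1 h' (pt τ x)
          simp only [mem_inter_iff, mem_preimage, mem_Ioi, pt_mem_movingDomain hτ, hmem x] at h1
          rw [hmem]
          tauto
        simp only [mem_preimage, indicator_of_mem hτ, mem_Ioi, mem_inter_iff, hτ, true_and,
          mem_iUnion, hiff]
        have hΩ := isOpen_fluidRegion hr hτ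
        have hfc : ContinuousOn (fun x => f (pt τ x)) (fluidRegion r τ) :=
          hf.comp (continuous_pt_right τ).continuousOn
            fun x hx => (pt_mem_movingDomain hτ).2 hx
        constructor
        · intro hlt
          by_contra hne
          push Not at hne
          exact absurd (linf_le hΩ hc hne) (not_le.2 hlt)
        · rintro ⟨x, hx, hlt⟩
          exact hlt.trans_le (norm_le_linf hΩ hfc
            (fun x hx => hB _ ((pt_mem_movingDomain hτ).2 hx)) hx)
      · simp only [mem_preimage, indicator_of_notMem hτ, mem_Ioi, mem_inter_iff, hτ, false_and,
          iff_false, not_lt]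
        exact hc
    rw [hset]
    refine measurableSet_Icc.inter (IsOpen.measurableSet ?_)
    exact isOpen_iUnion fun x => (hO'.inter hO).preimage (continuous_pt_left x)

end

/-! ### Local integrability of powers of a function with simple zeros -/

lemma lintegral_rpow_Ioc_lt_top {a : ℝ} (ha : -1 < a) (H : ℝ) :
    ∫⁻ w in Ioc 0 H, ENNReal.ofReal (w ^ a) < ⊤ := by
  rcases le_total H 0 with hH | hH
  · simp [Ioc_eq_empty (not_lt.2 hH)]
  · have h : IntervalIntegrable (fun w : ℝ => w ^ a) volume 0 H :=
      intervalIntegral.intervalIntegrable_rpow' ha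
    rw [intervalIntegrable_iff_integrableOn_Ioc_of_le hH] at h
    exact h.lintegral_lt_top

/-- Change of variables `w = h z`: on an interval where `|h'| ≥ c`, the integral of `h ^ a` over
`{0 < h ≤ H}` is at most `1 / c` times that of `w ^ a` over `(0, H]`. -/
lemma lintegral_rpow_comp_le {h h' : ℝ → ℝ} (hd : ∀ z, HasDerivAt h (h' z) z) {α β c H a : ℝ}
    (hc : 0 < c) (hc' : ∀ z ∈ Ioo α β, c ≤ |h' z|) (hH : ∀ z ∈ Ioo α β, h z ≤ H) :
    ∫⁻ z in Ioo α β ∩ {z | 0 < h z}, ENNReal.ofReal (h z ^ a) ≤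
      ENNReal.ofReal (1 / c) * ∫⁻ w in Ioc 0 H, ENNReal.ofReal (w ^ a) := by
  have hcont : Continuous h := continuous_iff_continuousAt.2 fun z => (hd z).continuousAt
  set s := Ioo α β ∩ {z | 0 < h z}
  have hs : MeasurableSet s := (isOpen_Ioo.inter (isOpen_lt continuous_const hcont)).measurableSet
  have hinj' : ∀ x ∈ Ioo α β, ∀ y ∈ Ioo α β, x < y → h x ≠ h y := by
    intro x hx y hy hxy heq
    obtain ⟨z, hz, hz0⟩ := exists_hasDerivAt_eq_zero hxy hcont.continuousOn heq
      fun z _ => hd z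
    have := hc' z ⟨hx.1.trans hz.1, hz.2.trans hy.2⟩
    rw [hz0, abs_zero] at this
    linarith
  have hinj : InjOn h s := by
    intro x hx y hy heq
    rcases lt_trichotomy x y with hlt | hEq | hlt
    · exact absurd heq (hinj' x hx.1 y hy.1 hlt)
    · exact hEq
    · exact absurd heq.symm (hinj' y hy.1 x hx.1 hlt)
  have hcv := lintegral_image_eq_lintegral_abs_deriv_mul hs
    (fun z _ => (hd z).hasDerivWithinAt) hinj fun w => ENNReal.ofReal (w ^ a)
  have himg : h '' s ⊆ Ioc 0 H := by
    rintro w ⟨z, hz, rfl⟩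
    exact ⟨hz.2, hH z hz.1⟩
  have h1 := (hcv.symm.le).trans (lintegral_mono_set himg)
  calc ∫⁻ z in s, ENNReal.ofReal (h z ^ a)
      ≤ ∫⁻ z in s, ENNReal.ofReal (1 / c) *
          (ENNReal.ofReal |h' z| * ENNReal.ofReal (h z ^ a)) := by
        refine setLIntegral_mono' hs fun z hz => ?_
        rw [← mul_assoc, ← ENNReal.ofReal_mul (by positivity)]
        refine le_mul_of_one_le_left zero_le ?_
        rw [ENNReal.one_le_ofReal, one_div_mul_eq_div, one_le_div hc]
        exact hc' z hz.1
    _ = ENNReal.ofReal (1 / c) *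
          ∫⁻ z in s, ENNReal.ofReal |h' z| * ENNReal.ofReal (h z ^ a) :=
        lintegral_const_mul' _ _ ENNReal.ofReal_ne_top
    _ ≤ _ := by gcongr

section

variable {R : Space → ℝ} {a : ℝ}

lemma hasDerivAt_insertNth (hR : ContDiff ℝ 1 R) (i : Fin 3) (y : Fin 2 → ℝ) (z : ℝ) :
    HasDerivAt (fun z => R (i.insertNth z y : Space))
      (fderiv ℝ R (i.insertNth z y : Space) (Pi.single i 1)) z := by
  have h1 : HasDerivAt (fun z => (i.insertNth z y : Space)) (Pi.single i 1) z := by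
    have h := hasDerivAt_update (i.insertNth (0 : ℝ) y : Space) i z
    have e : Function.update (i.insertNth (0 : ℝ) y : Space) i =
        fun z => (i.insertNth z y : Space) := by
      funext z
      simp
    rwa [e] at h
  exact ((hR.differentiable one_ne_zero) _).hasFDerivAt.comp_hasDerivAt z h1

lemma measurable_rpow_comp (hR : ContDiff ℝ 1 R) :
    Measurable fun x => ENNReal.ofReal (R x ^ a) :=
  (hR.continuous.measurable.pow_const a).ennreal_ofReal

/-- Near a point where `R` has a nonvanishing partial derivative, `R ^ a` is integrable over
`{R > 0}` for every `a > -1`. -/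
lemma exists_nhds_lintegral_rpow_lt_top (hR : ContDiff ℝ 1 R) (ha : -1 < a) {x₀ : Space}
    {i : Fin 3} (hi : fderiv ℝ R x₀ (Pi.single i 1) ≠ 0) :
    ∃ U ∈ nhds x₀, ∫⁻ x in U ∩ {x | 0 < R x}, ENNReal.ofReal (R x ^ a) < ⊤ := by
  have hdc : Continuous fun x => |fderiv ℝ R x (Pi.single i 1)| :=
    ((hR.continuous_fderiv one_ne_zero).clm_apply continuous_const).abs
  set c := |fderiv ℝ R x₀ (Pi.single i 1)| / 2
  have hc : 0 < c := by positivity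
  have hclt : c < |fderiv ℝ R x₀ (Pi.single i 1)| := half_lt_self (by positivity)
  have hev : ∀ᶠ x in nhds x₀, c < |fderiv ℝ R x (Pi.single i 1)| ∧ R x < R x₀ + 1 :=
    (hdc.continuousAt.eventually (lt_mem_nhds hclt)).and
      (hR.continuous.continuousAt.eventually (gt_mem_nhds (by linarith)))
  obtain ⟨ρ, hρ, hball⟩ := Metric.eventually_nhds_iff_ball.1 hev
  refine ⟨Metric.ball x₀ ρ, Metric.ball_mem_nhds x₀ hρ, ?_⟩
  have hopen : IsOpen (Metric.ball x₀ ρ ∩ {x | 0 < R x}) :=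
    Metric.isOpen_ball.inter (isOpen_lt continuous_const hR.continuous)
  set e := MeasurableEquiv.piFinSuccAbove (fun _ : Fin 3 => ℝ) i
  have hmp := (volume_preserving_piFinSuccAbove (fun _ : Fin 3 => ℝ) i).symm
  set F : Space → ENNReal :=
    (Metric.ball x₀ ρ ∩ {x | 0 < R x}).indicator fun x => ENNReal.ofReal (R x ^ a)
  have hF : Measurable F := (measurable_rpow_comp hR).indicator hopen.measurableSet
  set y₀ : Fin 2 → ℝ := fun j => x₀ (i.succAbove j)
  have hmem : ∀ (z : ℝ) (y : Fin 2 → ℝ), (i.insertNth z y : Space) ∈ Metric.ball x₀ ρ ↔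
      z ∈ Ioo (x₀ i - ρ) (x₀ i + ρ) ∧ y ∈ Metric.ball y₀ ρ := by
    intro z y
    rw [Metric.mem_ball, Metric.mem_ball, dist_pi_lt_iff hρ, dist_pi_lt_iff hρ,
      Fin.forall_iff_succAbove i]
    simp only [Fin.insertNth_apply_same, Fin.insertNth_apply_succAbove, y₀]
    rw [Real.dist_eq, abs_lt, mem_Ioo]
    constructor
    · rintro ⟨⟨h1, h2⟩, h3⟩
      exact ⟨⟨by linarith, by linarith⟩, h3⟩
    · rintro ⟨⟨h1, h2⟩, h3⟩
      exact ⟨⟨by linarith, by linarith⟩, h3⟩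
  set C := ENNReal.ofReal (1 / c) * ∫⁻ w in Ioc 0 (R x₀ + 1), ENNReal.ofReal (w ^ a)
  have hC : C < ⊤ := ENNReal.mul_lt_top ENNReal.ofReal_lt_top (lintegral_rpow_Ioc_lt_top ha _)
  have hinner : ∀ y : Fin 2 → ℝ, ∫⁻ z, F (i.insertNth z y) ≤
      (Metric.ball y₀ ρ).indicator (fun _ => C) y := by
    intro y
    by_cases hy : y ∈ Metric.ball y₀ ρ
    · rw [indicator_of_mem hy]
      have hdy := hasDerivAt_insertNth hR i y
      have hle := lintegral_rpow_comp_le (a := a) (α := x₀ i - ρ) (β := x₀ i + ρ)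
        (H := R x₀ + 1) hdy hc
        (fun z hz => (hball _ ((hmem z y).2 ⟨hz, hy⟩)).1.le)
        (fun z hz => (hball _ ((hmem z y).2 ⟨hz, hy⟩)).2.le)
      refine le_trans (le_of_eq ?_) hle
      have hcy : Continuous fun z => R (i.insertNth z y : Space) :=
        continuous_iff_continuousAt.2 fun z => (hdy z).continuousAt
      rw [← lintegral_indicator
        (isOpen_Ioo.inter (isOpen_lt continuous_const hcy)).measurableSet]
      refine lintegral_congr fun z => ?_
      simp only [F, indicator, mem_inter_iff, hmem, hy, and_true]
      rfl
    · rw [indicator_of_notMem hy, nonpos_iff_eq_zero]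
      refine (lintegral_congr fun z => ?_).trans lintegral_zero
      exact indicator_of_notMem (fun h => hy ((hmem z y).1 h.1).2) _
  calc ∫⁻ x in Metric.ball x₀ ρ ∩ {x | 0 < R x}, ENNReal.ofReal (R x ^ a)
      = ∫⁻ x, F x := (lintegral_indicator hopen.measurableSet _).symm
    _ = ∫⁻ q : ℝ × (Fin 2 → ℝ), F (i.insertNth q.1 q.2) := by
        rw [← hmp.lintegral_comp hF]
        rfl
    _ = ∫⁻ y : Fin 2 → ℝ, ∫⁻ z, F (i.insertNth z y) := by
        refine lintegral_prod_symm _ ?_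
        exact (hF.comp e.symm.measurable).aemeasurable
    _ ≤ ∫⁻ y, (Metric.ball y₀ ρ).indicator (fun _ => C) y := lintegral_mono hinner
    _ = C * volume (Metric.ball y₀ ρ) := by
        rw [lintegral_indicator Metric.isOpen_ball.measurableSet, setLIntegral_const]
    _ < ⊤ := ENNReal.mul_lt_top hC measure_ball_lt_top

/-- If `R > 0` on the open set `Ω` and its gradient does not vanish on the boundary of `Ω`, then
`R ^ a` is integrable over bounded parts of `Ω` for every `a > -1`. -/
lemma lintegral_rpow_lt_top (hR : ContDiff ℝ 1 R) (ha : -1 < a) {Ω : Set Space} (hΩ : IsOpen Ω)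
    (hpos : ∀ x ∈ Ω, 0 < R x)
    (hbd : ∀ x ∈ frontier Ω, ∃ i : Fin 3, fderiv ℝ R x (Pi.single i 1) ≠ 0) {K : Set Space}
    (hK : IsCompact K) : ∫⁻ x in Ω ∩ K, ENNReal.ofReal (R x ^ a) < ⊤ := by
  set ν := (volume.restrict Ω).withDensity fun x => ENNReal.ofReal (R x ^ a)
  have hν : ∀ s, MeasurableSet s → ν s = ∫⁻ x in s ∩ Ω, ENNReal.ofReal (R x ^ a) := by
    intro s hs
    rw [withDensity_apply _ hs, Measure.restrict_restrict hs]
  have hfin : ν K < ⊤ := by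
    refine hK.measure_lt_top_of_nhdsWithin fun x _ => ?_
    suffices h : ∃ U ∈ nhds x, ν U < ⊤ by
      obtain ⟨U, hU, h⟩ := h
      exact ⟨U, nhdsWithin_le_nhds hU, h⟩
    by_cases hx : x ∈ Ω
    · have hcont : ContinuousAt (fun x => R x ^ a) x :=
        hR.continuous.continuousAt.rpow_const (Or.inl (hpos x hx).ne')
      have hev : ∀ᶠ w in nhds x, R w ^ a < R x ^ a + 1 :=
        hcont.eventually (gt_mem_nhds (by linarith))
      obtain ⟨ρ, hρ, hball⟩ := Metric.eventually_nhds_iff_ball.1 hev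
      refine ⟨Metric.ball x ρ, Metric.ball_mem_nhds x hρ, ?_⟩
      rw [hν _ Metric.isOpen_ball.measurableSet]
      calc ∫⁻ w in Metric.ball x ρ ∩ Ω, ENNReal.ofReal (R w ^ a)
          ≤ ∫⁻ w in Metric.ball x ρ ∩ Ω, ENNReal.ofReal (R x ^ a + 1) := by
            refine setLIntegral_mono' (Metric.isOpen_ball.inter hΩ).measurableSet fun w hw => ?_
            exact ENNReal.ofReal_le_ofReal (hball w hw.1).le
        _ = ENNReal.ofReal (R x ^ a + 1) * volume (Metric.ball x ρ ∩ Ω) := setLIntegral_const _ _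
        _ < ⊤ := ENNReal.mul_lt_top ENNReal.ofReal_lt_top
            ((measure_mono inter_subset_left).trans_lt measure_ball_lt_top)
    · by_cases hx' : x ∈ closure Ω
      · obtain ⟨i, hi⟩ := hbd x ⟨hx', fun h => hx (interior_subset h)⟩
        obtain ⟨U, hU, hlt⟩ := exists_nhds_lintegral_rpow_lt_top hR ha hi
        obtain ⟨U', hU', hO, hxU⟩ := mem_nhds_iff.1 hU
        refine ⟨U', hO.mem_nhds hxU, ?_⟩
        rw [hν _ hO.measurableSet]
        refine (lintegral_mono_set ?_).trans_lt hlt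
        exact fun w hw => ⟨hU' hw.1, hpos w hw.2⟩
      · refine ⟨(closure Ω)ᶜ, isClosed_closure.isOpen_compl.mem_nhds hx', ?_⟩
        rw [hν _ isClosed_closure.isOpen_compl.measurableSet]
        have : (closure Ω)ᶜ ∩ Ω = ∅ := by
          ext w
          simp only [mem_inter_iff, mem_compl_iff, mem_empty_iff_false, iff_false, not_and]
          exact fun h hw => h (subset_closure hw)
        simp [this]
  rwa [hν K hK.measurableSet, inter_comm] at hfin

end

/-! ### Pointwise bounds for the background -/

lemma abs_sum_mul_le {n : ℕ} {x y : Fin n → ℝ} {X Y : ℝ} (hx : ∀ i, |x i| ≤ X)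
    (hy : ∀ i, |y i| ≤ Y) : |∑ i, x i * y i| ≤ n * (X * Y) := by
  refine (Finset.abs_sum_le_sum_abs _ _).trans ?_
  have h : ∀ i ∈ Finset.univ, |x i * y i| ≤ X * Y := fun i _ => by
    rw [abs_mul]
    exact mul_le_mul (hx i) (hy i) (abs_nonneg _) ((abs_nonneg _).trans (hx i))
  simpa using Finset.sum_le_card_nsmul _ _ _ h

lemma abs_proj_le {v : Fin 4 → ℝ} {m : ℝ} (hm : 1 ≤ m) (hv : ∀ α, |v α| ≤ m) (α β : Fin 4) :
    |proj v α β| ≤ 2 * m ^ 2 := by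
  have h1 : |g α β| ≤ 1 := by
    unfold g
    split_ifs <;> simp
  have h2 : |v α * v β| ≤ m * m := by
    rw [abs_mul]
    exact mul_le_mul (hv α) (hv β) (abs_nonneg _) (by linarith)
  unfold proj
  have h3 := abs_add_le (g α β) (v α * v β)
  nlinarith

/-- The equations determine the time derivatives of the background from its spatial derivatives:
the `2 × 2` system for `∂_t r` and `∂_t u⁰` has determinant `(u⁰)² - c² ((u⁰)² - 1)`, where
`c² = (γ - 1) r / (Γ + r)` is the squared sound speed, assumed to be at most `1/4`. -/
lemma abs_derivative_le {b r G m : ℝ} {u ds dr : Fin 4 → ℝ} {du : Fin 4 → Fin 4 → ℝ}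
    (hm : 1 ≤ m) (hb0 : 0 < b) (hb : b ≤ m) (hr0 : 0 < r) (hr1 : r ≤ 1) (hG : 0 < G)
    (hh : 1 / (G + r) ≤ m) (hbr : 4 * (b * r) ≤ G) (hu0 : 1 ≤ u 0) (hu : ∀ α, |u α| ≤ m)
    (hds : ∀ i : Fin 3, |ds i.succ| ≤ m) (hdr : ∀ i : Fin 3, |dr i.succ| ≤ m)
    (hdu : ∀ (i : Fin 3) α, |du i.succ α| ≤ m)
    (eq_s : ∑ μ, u μ * ds μ = 0) (eq_r : ∑ μ, u μ * dr μ + b * r * ∑ μ, du μ μ = 0)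
    (eq_u : ∀ α, ∑ μ, u μ * du μ α + 1 / (G + r) * ∑ μ, proj u α μ * dr μ = 0) :
    (∀ μ, |ds μ| ≤ 200 * m ^ 8) ∧ (∀ μ, |dr μ| ≤ 200 * m ^ 8) ∧
      ∀ μ α, |du μ α| ≤ 200 * m ^ 8 := by
  have hm0 : 0 ≤ m := by linarith
  have pw : ∀ {i j : ℕ}, i ≤ j → m ^ i ≤ m ^ j := fun h => pow_le_pow_right₀ hm h
  have p1 : m ≤ m ^ 8 := by simpa using pw (show 1 ≤ 8 by norm_num)
  have p0 : 0 ≤ m ^ 8 := by positivity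
  have hui : ∀ i : Fin 3, |u i.succ| ≤ m := fun i => hu _
  set h := 1 / (G + r)
  have hh0 : 0 < h := by positivity
  have hGr : h * (G + r) = 1 := by simp only [h]; field_simp
  -- the spatial parts of the equations
  have a1 := abs_sum_mul_le hui hds
  have a2 := abs_sum_mul_le hui hdr
  have a3 := fun α => abs_sum_mul_le hui (fun i => hdu i α)
  have a4 : |∑ i : Fin 3, du i.succ i.succ| ≤ 3 * m := by
    have := abs_sum_mul_le (x := fun _ : Fin 3 => (1 : ℝ)) (X := 1) (by simp)
      (fun i : Fin 3 => hdu i i.succ)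
    simpa using this
  push_cast at a1 a2 a3
  simp only [← sq] at a1 a2 a3
  have hbr1 : b * r ≤ m := (mul_le_of_le_one_right hb0.le hr1).trans hb
  have hbr0 : 0 < b * r := by positivity
  rw [Fin.sum_univ_succ] at eq_s
  rw [Fin.sum_univ_succ, Fin.sum_univ_succ (n := 3)] at eq_r
  have eq_u0 := eq_u 0
  rw [Fin.sum_univ_succ, Fin.sum_univ_succ (n := 3)] at eq_u0
  have hproj0 : ∑ i : Fin 3, proj u 0 i.succ * dr i.succ =
      u 0 * ∑ i : Fin 3, u i.succ * dr i.succ := by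
    rw [Finset.mul_sum]
    refine Finset.sum_congr rfl fun i _ => ?_
    have : (0 : Fin 4) ≠ i.succ := (Fin.succ_ne_zero i).symm
    simp [proj, g, this]
    ring
  have hproj00 : proj u 0 0 = u 0 ^ 2 - 1 := by simp [proj, g]; ring
  rw [hproj0, hproj00] at eq_u0
  set A := ∑ i : Fin 3, u i.succ * dr i.succ
  set E := ∑ i : Fin 3, du i.succ i.succ
  set F := ∑ i : Fin 3, u i.succ * du i.succ 0
  have hu00 : |u 0| ≤ m := hu 0
  have hu0m : u 0 ≤ m := (le_abs_self _).trans hu00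
  have bF1 : |A + b * r * E| ≤ 6 * m ^ 2 := by
    have : |b * r * E| ≤ m * (3 * m) := by
      rw [abs_mul, abs_of_pos hbr0]
      exact mul_le_mul hbr1 a4 (abs_nonneg _) hm0
    have := abs_add_le A (b * r * E)
    linarith [sq m]
  have bF2 : |F + h * (u 0 * A)| ≤ 6 * m ^ 4 := by
    have h1 : |h * (u 0 * A)| ≤ m * (m * (3 * m ^ 2)) := by
      rw [abs_mul, abs_mul, abs_of_pos hh0]
      exact mul_le_mul hh (mul_le_mul hu00 a2 (abs_nonneg _) hm0) (by positivity) hm0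
    have h2 := abs_add_le F (h * (u 0 * A))
    have h3 := a3 0
    have h4 := pw (show 2 ≤ 4 by norm_num)
    have h5 : m * (m * (3 * m ^ 2)) = 3 * m ^ 4 := by ring
    linarith
  -- elimination of `∂_t u⁰`
  have hdet : dr 0 * (u 0 ^ 2 - b * r * h * (u 0 ^ 2 - 1)) =
      b * r * (F + h * (u 0 * A)) - u 0 * (A + b * r * E) := by
    linear_combination u 0 * eq_r - b * r * eq_u0
  have hc : b * r * h ≤ 1 / 4 := by
    have : h * (4 * (b * r)) ≤ h * (G + r) := by gcongr; linarith
    linarith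
  have hdet1 : 3 / 4 ≤ u 0 ^ 2 - b * r * h * (u 0 ^ 2 - 1) := by
    have h1 : 1 ≤ u 0 ^ 2 := one_le_pow₀ hu0
    have h2 := mul_le_mul_of_nonneg_right hc (sub_nonneg.2 h1)
    linarith
  have bX : |dr 0| ≤ 24 * m ^ 5 := by
    have h1 : |b * r * (F + h * (u 0 * A)) - u 0 * (A + b * r * E)| ≤
        m * (6 * m ^ 4) + m * (6 * m ^ 2) := by
      refine (abs_sub _ _).trans (add_le_add ?_ ?_)
      · rw [abs_mul, abs_of_pos hbr0]
        exact mul_le_mul hbr1 bF2 (abs_nonneg _) hm0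
      · rw [abs_mul]
        exact mul_le_mul hu00 bF1 (abs_nonneg _) hm0
    rw [← hdet, abs_mul, abs_of_pos (by linarith : 0 < u 0 ^ 2 - b * r * h * (u 0 ^ 2 - 1))] at h1
    have h2 : |dr 0| * (3 / 4) ≤ |dr 0| * (u 0 ^ 2 - b * r * h * (u 0 ^ 2 - 1)) :=
      mul_le_mul_of_nonneg_left hdet1 (abs_nonneg _)
    have h3 := pw (show 3 ≤ 5 by norm_num)
    have h4 : m * (6 * m ^ 4) + m * (6 * m ^ 2) = 6 * m ^ 5 + 6 * m ^ 3 := by ring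
    have h5 : 0 ≤ m ^ 5 := by positivity
    linarith
  have bdr : ∀ μ, |dr μ| ≤ 24 * m ^ 5 := by
    intro μ
    refine Fin.cases bX (fun i => ?_) μ
    have := hdr i
    have h1 := pw (show 1 ≤ 5 by norm_num)
    simp only [pow_one] at h1
    linarith
  have time : ∀ {x y : ℝ}, u 0 * x + y = 0 → |x| ≤ |y| := by
    intro x y hxy
    have h1 : u 0 * x = -y := by linarith
    have h2 : u 0 * |x| = |y| := by
      rw [← abs_neg y, ← h1, abs_mul, abs_of_nonneg (by linarith : (0 : ℝ) ≤ u 0)]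
    rw [← h2]
    exact le_mul_of_one_le_left (abs_nonneg x) hu0
  refine ⟨fun μ => ?_, fun μ => ?_, fun μ α => ?_⟩
  · refine Fin.cases ?_ (fun i => ?_) μ
    · refine (time eq_s).trans (a1.trans ?_)
      have := pw (show 2 ≤ 8 by norm_num)
      linarith
    · have := hds i
      linarith
  · refine (bdr μ).trans ?_
    have := pw (show 5 ≤ 8 by norm_num)
    linarith
  · refine Fin.cases ?_ (fun i => ?_) μ
    · have h1 := eq_u α
      rw [Fin.sum_univ_succ, add_assoc] at h1
      refine (time h1).trans ?_
      have h2 := abs_sum_mul_le (abs_proj_le hm hu α) bdr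
      push_cast at h2
      have h3 : |h * ∑ μ, proj u α μ * dr μ| ≤ m * (4 * (2 * m ^ 2 * (24 * m ^ 5))) := by
        rw [abs_mul, abs_of_pos hh0]
        exact mul_le_mul hh h2 (abs_nonneg _) hm0
      have h4 := abs_add_le (∑ i : Fin 3, u i.succ * du i.succ α)
        (h * ∑ μ, proj u α μ * dr μ)
      have h5 := pw (show 2 ≤ 8 by norm_num)
      have h6 : m * (4 * (2 * m ^ 2 * (24 * m ^ 5))) = 192 * m ^ 8 := by ring
      have h7 := a3 α
      linarith
    · have := hdu i α
      linarith

/-! ### The linearized velocity -/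

/-- The Minkowski square of a vector. On vectors orthogonal to the velocity it agrees with
`normSqG`. -/
def minkowskiSq (w : Fin 4 → ℝ) : ℝ := -w 0 ^ 2 + w 1 ^ 2 + w 2 ^ 2 + w 3 ^ 2

lemma unit_iff (u : Fin 4 → ℝ) :
    ∑ α, ∑ β, g α β * u α * u β = -u 0 ^ 2 + u 1 ^ 2 + u 2 ^ 2 + u 3 ^ 2 := by
  simp [g, Fin.sum_univ_four]
  ring

lemma orth_iff (u w : Fin 4 → ℝ) :
    ∑ α, lower w α * u α = -(w 0 * u 0) + w 1 * u 1 + w 2 * u 2 + w 3 * u 3 := by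
  simp [lower, g, Fin.sum_univ_four]

lemma normSqG_eq {u w : Fin 4 → ℝ} (h : ∑ α, lower w α * u α = 0) :
    normSqG u w = minkowskiSq w := by
  rw [orth_iff] at h
  have : normSqG u w = minkowskiSq w +
      2 * (-(w 0 * u 0) + w 1 * u 1 + w 2 * u 2 + w 3 * u 3) ^ 2 := by
    simp [normSqG, minkowskiSq, lower, g, Fin.sum_univ_four]
    ring
  rw [this, h]
  ring

lemma one_le_time_component {u : Fin 4 → ℝ} (hu0 : 0 < u 0)
    (unit : -u 0 ^ 2 + u 1 ^ 2 + u 2 ^ 2 + u 3 ^ 2 = -1) : 1 ≤ u 0 := by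
  nlinarith [sq_nonneg (u 1), sq_nonneg (u 2), sq_nonneg (u 3)]

/-- A vector orthogonal to the velocity is spacelike, and its components are controlled by its
Minkowski length. -/
lemma sq_le_minkowskiSq {u w : Fin 4 → ℝ}
    (unit : -u 0 ^ 2 + u 1 ^ 2 + u 2 ^ 2 + u 3 ^ 2 = -1)
    (orth : -(w 0 * u 0) + w 1 * u 1 + w 2 * u 2 + w 3 * u 3 = 0) (α : Fin 4) :
    w α ^ 2 ≤ u 0 ^ 2 * minkowskiSq w := by
  have cs : (w 1 * u 1 + w 2 * u 2 + w 3 * u 3) ^ 2 ≤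
      (w 1 ^ 2 + w 2 ^ 2 + w 3 ^ 2) * (u 1 ^ 2 + u 2 ^ 2 + u 3 ^ 2) := by
    nlinarith [sq_nonneg (w 1 * u 2 - w 2 * u 1), sq_nonneg (w 1 * u 3 - w 3 * u 1),
      sq_nonneg (w 2 * u 3 - w 3 * u 2)]
  have h1 : w 1 * u 1 + w 2 * u 2 + w 3 * u 3 = w 0 * u 0 := by linarith
  have h2 : u 1 ^ 2 + u 2 ^ 2 + u 3 ^ 2 = u 0 ^ 2 - 1 := by linarith
  rw [h1, h2] at cs
  have key : w 1 ^ 2 + w 2 ^ 2 + w 3 ^ 2 ≤ u 0 ^ 2 * minkowskiSq w := by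
    unfold minkowskiSq
    nlinarith
  have h0 : w 0 ^ 2 ≤ u 0 ^ 2 * minkowskiSq w := by
    have : w 0 ^ 2 ≤ w 1 ^ 2 + w 2 ^ 2 + w 3 ^ 2 := by
      have h3 : 1 ≤ u 0 ^ 2 := by
        nlinarith [sq_nonneg (u 1), sq_nonneg (u 2), sq_nonneg (u 3)]
      by_contra hlt
      push Not at hlt
      nlinarith
    linarith
  have := sq_nonneg (w 1)
  have := sq_nonneg (w 2)
  have := sq_nonneg (w 3)
  fin_cases α
  · exact h0
  · change w 1 ^ 2 ≤ _; linarith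
  · change w 2 ^ 2 ≤ _; linarith
  · change w 3 ^ 2 ≤ _; linarith

/-! ### The energy current -/

lemma Gam_pos {γ : ℝ} (hγ : 1 < γ) (x : ℝ) : 0 < Gam γ x := by
  unfold Gam
  have : 0 < γ - 1 := by linarith
  have : 0 < γ := by linarith
  positivity

lemma hasDerivAt_Gam {γ : ℝ} (hγ : 1 < γ) (x : ℝ) :
    HasDerivAt (Gam γ) (-((γ - 1) / γ) * Gam γ x) x := by
  have h0 : γ ≠ 0 := by linarith
  have e : Gam γ = fun x => (γ - 1) ^ ((γ - 1) / γ) / γ * Real.exp (-((γ - 1) / γ) * x) := by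
    funext x
    rw [Gam, neg_mul, Real.exp_neg, ← div_div, div_eq_mul_inv _ (Real.exp _)]
  rw [e]
  refine ((((hasDerivAt_id x).const_mul (-((γ - 1) / γ))).exp).const_mul _).congr_deriv ?_
  simp only [id_eq]
  ring

lemma contDiff_Gam {γ : ℝ} (hγ : 1 < γ) : ContDiff ℝ 1 (Gam γ) := by
  have h0 : γ ≠ 0 := by linarith
  unfold Gam
  refine contDiff_const.div ?_ fun x => mul_ne_zero h0 (Real.exp_pos _).ne'
  exact contDiff_const.mul (contDiff_const.mul contDiff_id).exp

lemma abs_deriv_Gam_le {γ : ℝ} (hγ : 1 < γ) (x : ℝ) : |deriv (Gam γ) x| ≤ Gam γ x := by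
  rw [(hasDerivAt_Gam hγ x).deriv, abs_mul, abs_neg, abs_of_pos (Gam_pos hγ x)]
  have h1 : |(γ - 1) / γ| ≤ 1 := by
    rw [abs_of_nonneg (div_nonneg (by linarith) (by linarith)), div_le_one (by linarith)]
    linarith
  exact mul_le_of_le_one_left (Gam_pos hγ x).le h1

/-- The weight `r ^ ((2 - γ) / (γ - 1))` of the energy. -/
noncomputable def weight (γ : ℝ) (r : Spacetime → ℝ) (p : Spacetime) : ℝ :=
  r p ^ ((2 - γ) / (γ - 1))

/-- `energyDensity` divided by the weight, with the Minkowski square of the linearized velocity in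
place of `normSqG`. -/
noncomputable def energyForm (γ : ℝ) (s r s' r' : Spacetime → ℝ) (u' : Spacetime → Fin 4 → ℝ)
    (p : Spacetime) : ℝ :=
  1 / (γ - 1) * r' p ^ 2 + (Gam γ (s p) + r p) * r p * minkowskiSq (u' p) + r p * s' p ^ 2

/-- The energy current divided by the weight. -/
noncomputable def reducedCurrent (γ : ℝ) (s r : Spacetime → ℝ) (u : Spacetime → Fin 4 → ℝ)
    (s' r' : Spacetime → ℝ) (u' : Spacetime → Fin 4 → ℝ) (μ : Fin 4) (p : Spacetime) : ℝ :=
  1 / 2 * (u p μ * energyForm γ s r s' r' u' p) + r p * r' p * u' p μ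

/-- The energy current `V^μ = u^μ e + r^{1/(γ-1)} r' u'^μ`, where `e` is one half of
`energyDensity`. The second term is the flux that makes the divergence of `V` free of derivatives of the linearized
solution. -/
noncomputable def energyCurrent (γ : ℝ) (s r : Spacetime → ℝ) (u : Spacetime → Fin 4 → ℝ)
    (s' r' : Spacetime → ℝ) (u' : Spacetime → Fin 4 → ℝ) (μ : Fin 4) (p : Spacetime) : ℝ :=
  weight γ r p * reducedCurrent γ s r u s' r' u' μ p

lemma weight_pos {γ : ℝ} {r : Spacetime → ℝ} {p : Spacetime} (hp : 0 < r p) : 0 < weight γ r p :=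
  Real.rpow_pos_of_pos hp _

/-- Bounds on the background at a point, all in terms of the single number `m`. Those on the first
derivatives are the ones that `abs_derivative_le` gives when the spatial derivatives are at most
`m`. -/
structure BackgroundBounds (γ T m : ℝ) (s r : Spacetime → ℝ) (u : Spacetime → Fin 4 → ℝ)
    (p : Spacetime) : Prop where
  one_le : 1 ≤ m
  gamma_le : γ - 1 ≤ m
  r_le : r p ≤ 1
  inv_le : 1 / (Gam γ (s p) + r p) ≤ m
  sound : 4 * ((γ - 1) * r p) ≤ Gam γ (s p)
  u_le : ∀ α, |u p α| ≤ m
  ds_le : ∀ μ, |pd (movingDomain T r) μ s p| ≤ 200 * m ^ 8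
  dr_le : ∀ μ, |pd (movingDomain T r) μ r p| ≤ 200 * m ^ 8
  du_le : ∀ μ α, |pd (movingDomain T r) μ (fun q => u q α) p| ≤ 200 * m ^ 8

lemma BackgroundBounds.mono {γ T m m' : ℝ} {s r : Spacetime → ℝ} {u : Spacetime → Fin 4 → ℝ}
    {p : Spacetime} (h : BackgroundBounds γ T m s r u p) (hm : m ≤ m') :
    BackgroundBounds γ T m' s r u p := by
  have h1 := h.one_le
  have h2 : 200 * m ^ 8 ≤ 200 * m' ^ 8 := by gcongr
  exact ⟨h1.trans hm, h.gamma_le.trans hm, h.r_le, h.inv_le.trans hm, h.sound,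
    fun α => (h.u_le α).trans hm, fun μ => (h.ds_le μ).trans h2, fun μ => (h.dr_le μ).trans h2,
    fun μ α => (h.du_le μ α).trans h2⟩

/-! #### Algebra at a point -/

/-- The linearized momentum equation contracted with the linearized velocity `w`. -/
lemma contract_momentum {h k : ℝ} {u w dr dr' : Fin 4 → ℝ} {du dw : Fin 4 → Fin 4 → ℝ}
    (orth : -(w 0 * u 0) + w 1 * u 1 + w 2 * u 2 + w 3 * u 3 = 0)
    (eq_u : ∀ α, ∑ μ, u μ * dw μ α + h * ∑ μ, proj u α μ * dr' μ =
      -∑ μ, w μ * du μ α - h * ∑ μ, (w α * u μ + u α * w μ) * dr μ +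
        k * ∑ μ, proj u α μ * dr μ) :
    -(w 0 * ∑ μ, u μ * dw μ 0) + w 1 * ∑ μ, u μ * dw μ 1 + w 2 * ∑ μ, u μ * dw μ 2 +
        w 3 * ∑ μ, u μ * dw μ 3 =
      -(h * ∑ μ, w μ * dr' μ) -
        (-(w 0 * ∑ μ, w μ * du μ 0) + w 1 * ∑ μ, w μ * du μ 1 + w 2 * ∑ μ, w μ * du μ 2 +
          w 3 * ∑ μ, w μ * du μ 3) -
        h * minkowskiSq w * ∑ μ, u μ * dr μ + k * ∑ μ, w μ * dr μ := by
  have e0 := eq_u 0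
  have e1 := eq_u 1
  have e2 := eq_u 2
  have e3 := eq_u 3
  simp only [Fin.sum_univ_four, proj, g] at e0 e1 e2 e3
  simp at e0 e1 e2 e3
  simp only [Fin.sum_univ_four, minkowskiSq]
  linear_combination -w 0 * e0 + w 1 * e1 + w 2 * e2 + w 3 * e3 +
    (-h * (u 0 * dr' 0 + u 1 * dr' 1 + u 2 * dr' 2 + u 3 * dr' 3) -
      h * (w 0 * dr 0 + w 1 * dr 1 + w 2 * dr 2 + w 3 * dr 3) +
      k * (u 0 * dr 0 + u 1 * dr 1 + u 2 * dr 2 + u 3 * dr 3)) * orth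

/-- The divergence of the energy current in terms of the sums occurring in the equations: all
first derivatives of the linearized solution cancel. Here `b = γ - 1`, `h = 1 / (Γ + r)`, `Q` is
the square of the linearized velocity, `E` the energy form, `dv` and `dv'` are the divergences of
the two velocities, capital `D` stands for `D_t`, and `ud`, `ud'`, `us` for contractions of the
linearized velocity with the gradients of `r`, `r'`, `s`. -/
lemma divergence_identity {b r G G' h Q E s' r' dv dv' Dr Dr' Ds Ds' DQ ud ud' us Z : ℝ}
    (hb : b ≠ 0) (hr : r ≠ 0) (hh : h * (G + r) = 1)
    (hE : E = 1 / b * r' ^ 2 + (G + r) * r * Q + r * s' ^ 2)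
    (eq_s : Ds = 0) (eq_r : Dr + b * r * dv = 0)
    (eq_s' : Ds' = -us) (eq_r' : Dr' + ud + b * r * dv' = -b * r' * dv)
    (eq_Q : DQ = 2 * (-(h * ud') - Z - h * Q * Dr + (G' * h ^ 2 * s' + h ^ 2 * r') * ud)) :
    (1 - b) / b / r * (1 / 2 * (Dr * E) + r * r' * ud) +
      (1 / 2 * (dv * E + (1 / b * (2 * r' * Dr') + ((G' * Ds + Dr) * r + (G + r) * Dr) * Q +
        (G + r) * r * DQ + Dr * s' ^ 2 + r * (2 * s' * Ds'))) +
        ud * r' + r * ud' + r * r' * dv') =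
      -(1 / 2) * dv * r' ^ 2 + 1 / 2 * (b * r) * dv * (r * Q) - (G + r) * r * Z +
        r * (h * (G' * s' + r')) * ud - r * s' * us := by
  have hDr : Dr = -(b * r * dv) := by linarith
  have hDr' : Dr' = -ud - b * r * dv' - b * r' * dv := by linarith
  subst hE eq_s eq_s' eq_Q hDr hDr'
  have hGr : G + r ≠ 0 := fun h0 => by rw [h0, mul_zero] at hh; exact one_ne_zero hh.symm
  have hh' : h = 1 / (G + r) := by field_simp; exact hh
  rw [hh']
  field_simp
  ring

lemma cross_term_le {b r G r' q : ℝ} (hb : 0 < b) (hr : 0 < r) (hbr : 4 * (b * r) ≤ G) :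
    4 * (r * |r'| * q) ≤ 1 / b * r' ^ 2 + (G + r) * r * q ^ 2 := by
  have h1 : 0 ≤ 1 / b * (|r'| - 2 * (b * r * q)) ^ 2 := by positivity
  have h2 : 1 / b * (|r'| - 2 * (b * r * q)) ^ 2 =
      1 / b * r' ^ 2 - 4 * (r * |r'| * q) + 4 * (b * r) * (r * q ^ 2) := by
    rw [← sq_abs r']
    field_simp
    ring
  have h3 : 4 * (b * r) * (r * q ^ 2) ≤ (G + r) * (r * q ^ 2) := by
    gcongr
    linarith
  linarith

/-- The lower order terms in the divergence of the energy current are bounded by the energy. -/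
lemma lower_order_le {b r G G' h q s' r' dv ud us Z m P : ℝ} (hm : 1 ≤ m) (hP : 0 ≤ P)
    (hb0 : 0 < b) (hb : b ≤ m) (hr0 : 0 < r) (hr1 : r ≤ 1) (hG : 0 < G) (hG' : |G'| ≤ G)
    (hh0 : 0 < h) (hh : h * (G + r) = 1) (hhm : h ≤ m) (hbr : 4 * (b * r) ≤ G)
    (hdv : |dv| ≤ 4 * P) (hud : |ud| ≤ 4 * (m * q * P)) (hus : |us| ≤ 4 * (m * q * P))
    (hZ : |Z| ≤ 16 * (m ^ 2 * q ^ 2 * P)) :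
    -(1 / 2) * dv * r' ^ 2 + 1 / 2 * (b * r) * dv * (r * q ^ 2) - (G + r) * r * Z +
        r * (h * (G' * s' + r')) * ud - r * s' * us ≤
      23 * (m ^ 3 * P) * (1 / b * r' ^ 2 + (G + r) * r * q ^ 2 + r * s' ^ 2) := by
  have hm0 : 0 < m := by linarith
  set A₁ := 1 / b * r' ^ 2
  set A₂ := (G + r) * r * q ^ 2
  set A₃ := r * s' ^ 2
  have hA₁ : 0 ≤ A₁ := by positivity
  have hA₂ : 0 ≤ A₂ := by positivity
  have hA₃ : 0 ≤ A₃ := by positivity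
  have e1 : r' ^ 2 ≤ m * A₁ := by
    have : r' ^ 2 = b * A₁ := by simp only [A₁]; field_simp
    rw [this]
    gcongr
  have e2 : r * q ^ 2 ≤ m * A₂ := by
    have : r * q ^ 2 = h * A₂ := by
      simp only [A₂]
      linear_combination (-(r * q ^ 2)) * hh
    rw [this]
    gcongr
  have hrq : 0 ≤ r * q ^ 2 := by positivity
  have hr'2 : 0 ≤ r' ^ 2 := sq_nonneg _
  -- products of the linearized unknowns
  have c1 : r * |s'| * (m * q * P) ≤ m * P / 2 * (A₃ + m * A₂) := by
    have : |s'| * q ≤ (s' ^ 2 + q ^ 2) / 2 := by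
      nlinarith [sq_nonneg (|s'| - q), sq_abs s']
    calc r * |s'| * (m * q * P) = m * P * r * (|s'| * q) := by ring
      _ ≤ m * P * r * ((s' ^ 2 + q ^ 2) / 2) := by gcongr
      _ = m * P / 2 * (A₃ + r * q ^ 2) := by simp only [A₃]; ring
      _ ≤ _ := by gcongr
  have c2 : r * |r'| * (m * q * P) ≤ m * P / 2 * (m * A₁ + m * A₂) := by
    have : |r'| * q ≤ (r' ^ 2 + q ^ 2) / 2 := by
      nlinarith [sq_nonneg (|r'| - q), sq_abs r']
    have h1 : r * r' ^ 2 ≤ r' ^ 2 := mul_le_of_le_one_left hr'2 hr1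
    calc r * |r'| * (m * q * P) = m * P * r * (|r'| * q) := by ring
      _ ≤ m * P * r * ((r' ^ 2 + q ^ 2) / 2) := by gcongr
      _ = m * P / 2 * (r * r' ^ 2 + r * q ^ 2) := by ring
      _ ≤ _ := mul_le_mul_of_nonneg_left (add_le_add (h1.trans e1) e2) (by positivity)
  have t1 : -(1 / 2) * dv * r' ^ 2 ≤ 2 * (m * P) * A₁ := by
    calc -(1 / 2) * dv * r' ^ 2 ≤ 1 / 2 * |dv| * r' ^ 2 := by
          have := neg_abs_le dv
          nlinarith
      _ ≤ 1 / 2 * (4 * P) * (m * A₁) := by gcongr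
      _ = _ := by ring
  have t2 : 1 / 2 * (b * r) * dv * (r * q ^ 2) ≤ 1 / 2 * P * A₂ := by
    calc 1 / 2 * (b * r) * dv * (r * q ^ 2) ≤ 1 / 2 * ((G + r) / 4) * (4 * P) * (r * q ^ 2) := by
          refine mul_le_mul_of_nonneg_right ?_ hrq
          refine (mul_le_mul_of_nonneg_left ((le_abs_self dv).trans hdv) (by positivity)).trans ?_
          gcongr
          linarith
      _ = _ := by simp only [A₂]; ring
  have t3 : -((G + r) * r * Z) ≤ 16 * (m ^ 2 * P) * A₂ := by
    calc -((G + r) * r * Z) ≤ (G + r) * r * (16 * (m ^ 2 * q ^ 2 * P)) := by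
          have h1 := (abs_le.1 hZ).1
          have : 0 ≤ (G + r) * r := by positivity
          nlinarith
      _ = _ := by simp only [A₂]; ring
  have t4 : r * (h * (G' * s')) * ud ≤ 2 * (m * P) * (A₃ + m * A₂) := by
    have h1 : |h * G'| ≤ 1 := by
      rw [abs_mul, abs_of_pos hh0, ← hh]
      gcongr
      linarith
    calc r * (h * (G' * s')) * ud ≤ |r * (h * (G' * s')) * ud| := le_abs_self _
      _ = |h * G'| * (r * |s'| * |ud|) := by
          simp only [abs_mul, abs_of_pos hr0]
          ring
      _ ≤ 1 * (r * |s'| * (4 * (m * q * P))) := by gcongr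
      _ = 4 * (r * |s'| * (m * q * P)) := by ring
      _ ≤ 4 * (m * P / 2 * (A₃ + m * A₂)) := by gcongr
      _ = _ := by ring
  have t5 : r * (h * r') * ud ≤ 2 * (m ^ 2 * P) * (m * A₁ + m * A₂) := by
    calc r * (h * r') * ud ≤ |r * (h * r') * ud| := le_abs_self _
      _ = h * (r * |r'| * |ud|) := by
          simp only [abs_mul, abs_of_pos hr0, abs_of_pos hh0]
          ring
      _ ≤ m * (r * |r'| * (4 * (m * q * P))) := by gcongr
      _ = 4 * m * (r * |r'| * (m * q * P)) := by ring
      _ ≤ 4 * m * (m * P / 2 * (m * A₁ + m * A₂)) := by gcongr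
      _ = _ := by ring
  have t6 : -(r * s' * us) ≤ 2 * (m * P) * (A₃ + m * A₂) := by
    calc -(r * s' * us) ≤ |r * s' * us| := neg_le_abs _
      _ = r * |s'| * |us| := by simp only [abs_mul, abs_of_pos hr0]
      _ ≤ r * |s'| * (4 * (m * q * P)) := by gcongr
      _ = 4 * (r * |s'| * (m * q * P)) := by ring
      _ ≤ 4 * (m * P / 2 * (A₃ + m * A₂)) := by gcongr
      _ = _ := by ring
  have k1 : P ≤ m ^ 3 * P := le_mul_of_one_le_left hP (one_le_pow₀ hm)
  have k2 : m * P ≤ m ^ 3 * P := by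
    have : m ≤ m ^ 3 := le_self_pow₀ hm (by norm_num)
    gcongr
  have k3 : m ^ 2 * P ≤ m ^ 3 * P := by
    have : m ^ 2 ≤ m ^ 3 := pow_le_pow_right₀ hm (by norm_num)
    gcongr
  have s1 : (2 * (m * P) + 2 * (m ^ 3 * P)) * A₁ ≤ 23 * (m ^ 3 * P) * A₁ := by
    have : 0 ≤ m ^ 3 * P := by positivity
    gcongr
    linarith
  have s2 : (1 / 2 * P + 20 * (m ^ 2 * P) + 2 * (m ^ 3 * P)) * A₂ ≤ 23 * (m ^ 3 * P) * A₂ := by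
    gcongr
    linarith
  have s3 : 4 * (m * P) * A₃ ≤ 23 * (m ^ 3 * P) * A₃ := by
    have : 0 ≤ m ^ 3 * P := by positivity
    gcongr
    linarith
  linarith

/-! #### Differential inequalities for the currents -/

section

variable {γ T m : ℝ} {s r : Spacetime → ℝ} {u : Spacetime → Fin 4 → ℝ} {s' r' : Spacetime → ℝ}
  {u' : Spacetime → Fin 4 → ℝ} {p : Spacetime}

lemma IsEulerSolution.unit' (hE : IsEulerSolution γ T s r u) (hp : p ∈ movingDomain T r) :
    -u p 0 ^ 2 + u p 1 ^ 2 + u p 2 ^ 2 + u p 3 ^ 2 = -1 :=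
  (unit_iff (u p)).symm.trans (hE.unit p hp)

lemma IsEulerSolution.one_le (hE : IsEulerSolution γ T s r u) (hp : p ∈ movingDomain T r) :
    1 ≤ u p 0 :=
  one_le_time_component (hE.forward p hp) (hE.unit' hp)

lemma IsLinearizedSolution.orth' (hL : IsLinearizedSolution γ T s r u s' r' u')
    (hp : p ∈ movingDomain T r) :
    -(u' p 0 * u p 0) + u' p 1 * u p 1 + u' p 2 * u p 2 + u' p 3 * u p 3 = 0 :=
  (orth_iff (u p) (u' p)).symm.trans (hL.orth p hp)

lemma minkowskiSq_nonneg (hE : IsEulerSolution γ T s r u)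
    (hL : IsLinearizedSolution γ T s r u s' r' u') (hp : p ∈ movingDomain T r) :
    0 ≤ minkowskiSq (u' p) := by
  have h1 := sq_le_minkowskiSq (hE.unit' hp) (hL.orth' hp) 0
  have h2 := hE.one_le hp
  have h3 : 0 < u p 0 ^ 2 := by positivity
  exact nonneg_of_mul_nonneg_right ((sq_nonneg _).trans h1) h3

lemma abs_le_mul_sqrt (hE : IsEulerSolution γ T s r u)
    (hL : IsLinearizedSolution γ T s r u s' r' u') (hp : p ∈ movingDomain T r) (α : Fin 4) :
    |u' p α| ≤ u p 0 * √(minkowskiSq (u' p)) := by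
  have h2 := hE.one_le hp
  refine abs_le_of_sq_le_sq ?_ (by positivity)
  rw [mul_pow, Real.sq_sqrt (minkowskiSq_nonneg hE hL hp)]
  exact sq_le_minkowskiSq (hE.unit' hp) (hL.orth' hp) α

lemma energyForm_nonneg (hγ : 1 < γ) (hE : IsEulerSolution γ T s r u)
    (hL : IsLinearizedSolution γ T s r u s' r' u') (hp : p ∈ movingDomain T r) :
    0 ≤ energyForm γ s r s' r' u' p := by
  have h1 := minkowskiSq_nonneg hE hL hp
  have h2 : 0 < r p := hp.2
  have h3 := Gam_pos hγ (s p)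
  have h4 : 0 < γ - 1 := by linarith
  unfold energyForm
  positivity

/-- The flux term of the current is at most a quarter of the energy form, up to the factor `u⁰` by
which a component of `u'` may exceed the Minkowski length of `u'`. This is where the sound speed is required to be at most `1/2`. -/
lemma abs_flux_le (hγ : 1 < γ) (hE : IsEulerSolution γ T s r u)
    (hL : IsLinearizedSolution γ T s r u s' r' u') (hB : BackgroundBounds γ T m s r u p)
    (hp : p ∈ movingDomain T r) (α : Fin 4) :
    |r p * r' p * u' p α| ≤ 1 / 4 * (u p 0 * energyForm γ s r s' r' u' p) := by
  have hr : 0 < r p := hp.2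
  have h1 := cross_term_le (r' := r' p) (q := √(minkowskiSq (u' p)))
    (by linarith : 0 < γ - 1) hr hB.sound
  rw [Real.sq_sqrt (minkowskiSq_nonneg hE hL hp)] at h1
  have h2 : 0 ≤ r p * s' p ^ 2 := by positivity
  have h3 := hE.one_le hp
  calc |r p * r' p * u' p α| = r p * |r' p| * |u' p α| := by
        rw [abs_mul, abs_mul, abs_of_pos hr]
    _ ≤ r p * |r' p| * (u p 0 * √(minkowskiSq (u' p))) := by
        gcongr
        exact abs_le_mul_sqrt hE hL hp α
    _ = 1 / 4 * (u p 0 * (4 * (r p * |r' p| * √(minkowskiSq (u' p))))) := by ring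
    _ ≤ _ := by
        gcongr
        unfold energyForm
        linarith

lemma reducedCurrent_zero_bounds (hγ : 1 < γ) (hE : IsEulerSolution γ T s r u)
    (hL : IsLinearizedSolution γ T s r u s' r' u') (hB : BackgroundBounds γ T m s r u p)
    (hp : p ∈ movingDomain T r) :
    1 / 4 * energyForm γ s r s' r' u' p ≤ reducedCurrent γ s r u s' r' u' 0 p ∧
      reducedCurrent γ s r u s' r' u' 0 p ≤ 3 / 4 * (u p 0 * energyForm γ s r s' r' u' p) := by
  have h1 := abs_le.1 (abs_flux_le hγ hE hL hB hp 0)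
  have h2 := energyForm_nonneg hγ hE hL hp
  have h3 : energyForm γ s r s' r' u' p ≤ u p 0 * energyForm γ s r s' r' u' p :=
    le_mul_of_one_le_left h2 (hE.one_le hp)
  unfold reducedCurrent
  constructor <;> linarith [h1.1, h1.2]

lemma energyCurrent_zero_nonneg (hγ : 1 < γ) (hE : IsEulerSolution γ T s r u)
    (hL : IsLinearizedSolution γ T s r u s' r' u') (hB : BackgroundBounds γ T m s r u p)
    (hp : p ∈ movingDomain T r) : 0 ≤ energyCurrent γ s r u s' r' u' 0 p := by
  have h1 := (reducedCurrent_zero_bounds hγ hE hL hB hp).1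
  have h2 := energyForm_nonneg hγ hE hL hp
  exact mul_nonneg (weight_pos hp.2).le (by linarith)

/-- The energy current has finite speed. -/
lemma energyCurrent_speed (hγ : 1 < γ) (hE : IsEulerSolution γ T s r u)
    (hL : IsLinearizedSolution γ T s r u s' r' u') (hB : BackgroundBounds γ T m s r u p)
    (hp : p ∈ movingDomain T r) :
    ∑ i : Fin 3, |energyCurrent γ s r u s' r' u' i.succ p| ≤
      12 * m * energyCurrent γ s r u s' r' u' 0 p := by
  have hw := weight_pos (γ := γ) hp.2
  have h0 := energyForm_nonneg hγ hE hL hp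
  have hm := hB.one_le
  have h1 : ∀ i : Fin 3, |energyCurrent γ s r u s' r' u' i.succ p| ≤
      weight γ r p * (m * energyForm γ s r s' r' u' p) := by
    intro i
    unfold energyCurrent
    rw [abs_mul, abs_of_pos hw]
    gcongr
    unfold reducedCurrent
    have h2 := abs_flux_le hγ hE hL hB hp i.succ
    have h3 : |1 / 2 * (u p i.succ * energyForm γ s r s' r' u' p)| ≤
        1 / 2 * (m * energyForm γ s r s' r' u' p) := by
      rw [abs_mul, abs_mul, abs_of_nonneg h0, abs_of_pos (by norm_num : (0 : ℝ) < 1 / 2)]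
      gcongr
      exact hB.u_le _
    have h4 : u p 0 * energyForm γ s r s' r' u' p ≤ m * energyForm γ s r s' r' u' p := by
      gcongr
      exact (le_abs_self _).trans (hB.u_le 0)
    have h5 : 0 ≤ m * energyForm γ s r s' r' u' p := by positivity
    have h6 := abs_add_le (1 / 2 * (u p i.succ * energyForm γ s r s' r' u' p))
      (r p * r' p * u' p i.succ)
    linarith
  have h2 := (reducedCurrent_zero_bounds hγ hE hL hB hp).1
  calc ∑ i : Fin 3, |energyCurrent γ s r u s' r' u' i.succ p|
      ≤ ∑ _i : Fin 3, weight γ r p * (m * energyForm γ s r s' r' u' p) :=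
        Finset.sum_le_sum fun i _ => h1 i
    _ = 12 * m * (weight γ r p * (1 / 4 * energyForm γ s r s' r' u' p)) := by
        simp
        ring
    _ ≤ _ := by
        unfold energyCurrent
        gcongr

lemma abs_divergence_le (hB : BackgroundBounds γ T m s r u p) :
    |∑ μ, pd (movingDomain T r) μ (fun q => u q μ) p| ≤ 4 * (200 * m ^ 8) := by
  have := abs_sum_mul_le (x := fun _ : Fin 4 => (1 : ℝ)) (X := 1) (by simp)
    (fun μ : Fin 4 => hB.du_le μ μ)
  simpa using this

/-- The energy current crosses the level sets of `r` at a rate proportional to `r V⁰`, up to `r`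
times an error that involves the weight and is controlled by the linearized solution. -/
lemma energyCurrent_boundary (hγ : 1 < γ) (hE : IsEulerSolution γ T s r u)
    (hL : IsLinearizedSolution γ T s r u s' r' u') (hB : BackgroundBounds γ T m s r u p)
    (hp : p ∈ movingDomain T r) :
    ∑ μ, energyCurrent γ s r u s' r' u' μ p * pd (movingDomain T r) μ r p ≤
      8 * m * (200 * m ^ 8) * r p * energyCurrent γ s r u s' r' u' 0 p +
        r p * (weight γ r p * (|r' p| * |∑ μ, u' p μ * pd (movingDomain T r) μ r p|)) := by
  have hw := weight_pos (γ := γ) hp.2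
  have hr : 0 < r p := hp.2
  have hm := hB.one_le
  have h0 := energyForm_nonneg hγ hE hL hp
  have e1 : ∑ μ, energyCurrent γ s r u s' r' u' μ p * pd (movingDomain T r) μ r p =
      weight γ r p * (1 / 2 * (energyForm γ s r s' r' u' p * Dt (movingDomain T r) u r p) +
        r p * (r' p * ∑ μ, u' p μ * pd (movingDomain T r) μ r p)) := by
    simp only [energyCurrent, reducedCurrent, Dt, Finset.mul_sum, ← Finset.sum_add_distrib]
    exact Finset.sum_congr rfl fun μ _ => by ring
  have h1 : Dt (movingDomain T r) u r p ≤ m * r p * (4 * (200 * m ^ 8)) := by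
    have h2 : Dt (movingDomain T r) u r p =
      (γ - 1) * r p * -∑ μ, pd (movingDomain T r) μ (fun q => u q μ) p := by
      linarith [hE.eq_r p hp]
    rw [h2]
    have h3 := (neg_le_abs _).trans (abs_divergence_le hB)
    have h4 : 0 < γ - 1 := by linarith
    have h5 := hB.gamma_le
    calc (γ - 1) * r p * -∑ μ, pd (movingDomain T r) μ (fun q => u q μ) p
        ≤ (γ - 1) * r p * (4 * (200 * m ^ 8)) := by gcongr
      _ ≤ _ := by gcongr
  have h2 := (reducedCurrent_zero_bounds hγ hE hL hB hp).1
  have h3 : r' p * ∑ μ, u' p μ * pd (movingDomain T r) μ r p ≤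
      |r' p| * |∑ μ, u' p μ * pd (movingDomain T r) μ r p| := by
    rw [← abs_mul]
    exact le_abs_self _
  rw [e1]
  calc _ ≤ weight γ r p * (1 / 2 * (energyForm γ s r s' r' u' p *
          (m * r p * (4 * (200 * m ^ 8)))) +
          r p * (|r' p| * |∑ μ, u' p μ * pd (movingDomain T r) μ r p|)) := by gcongr
    _ = 8 * m * (200 * m ^ 8) * r p *
          (weight γ r p * (1 / 4 * energyForm γ s r s' r' u' p)) +
          r p * (weight γ r p *
            (|r' p| * |∑ μ, u' p μ * pd (movingDomain T r) μ r p|)) := by ring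
    _ ≤ _ := by
        unfold energyCurrent
        gcongr

lemma contDiffOn_weight (hE : IsEulerSolution γ T s r u) :
    ContDiffOn ℝ 1 (weight γ r) (movingDomain T r) :=
  hE.reg_r.contDiffOn.rpow_const_of_ne fun _ hp => hp.2.ne'

lemma pd_weight (hT : 0 < T) (hE : IsEulerSolution γ T s r u) (hp : p ∈ movingDomain T r)
    (μ : Fin 4) :
    pd (movingDomain T r) μ (weight γ r) p =
      (2 - γ) / (γ - 1) * (weight γ r p / r p) * pd (movingDomain T r) μ r p := by
  have h := Real.hasDerivAt_rpow_const (x := r p) (p := (2 - γ) / (γ - 1)) (Or.inl hp.2.ne')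
  rw [Real.rpow_sub_one hp.2.ne'] at h
  exact pd_comp (φ := fun z => z ^ ((2 - γ) / (γ - 1)))
    (uniqueDiffOn_movingDomain hT hE.cont_r p hp)
    (hE.reg_r.contDiffOn.differentiableOn one_ne_zero p hp) h

lemma contDiffOn_reducedCurrent (hγ : 1 < γ) (hE : IsEulerSolution γ T s r u)
    (hL : IsLinearizedSolution γ T s r u s' r' u') (μ : Fin 4) :
    ContDiffOn ℝ 1 (reducedCurrent γ s r u s' r' u' μ) (movingDomain T r) := by
  have c1 := hE.reg_r.contDiffOn
  have c2 := hL.reg_s.contDiffOn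
  have c3 := hL.reg_r.contDiffOn
  have c4 := fun α => (hL.reg_u α).contDiffOn
  have c5 := (hE.reg_u μ).contDiffOn
  have c6 : ContDiffOn ℝ 1 (fun p => Gam γ (s p)) (movingDomain T r) :=
    (contDiff_Gam hγ).comp_contDiffOn hE.reg_s.contDiffOn
  unfold reducedCurrent energyForm minkowskiSq
  have c40 := c4 0
  have c41 := c4 1
  have c42 := c4 2
  have c43 := c4 3
  have c4μ := c4 μ
  fun_prop

lemma contDiffOn_energyCurrent (hγ : 1 < γ) (hE : IsEulerSolution γ T s r u)
    (hL : IsLinearizedSolution γ T s r u s' r' u') (μ : Fin 4) :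
    ContDiffOn ℝ 1 (energyCurrent γ s r u s' r' u' μ) (movingDomain T r) :=
  (contDiffOn_weight hE).mul (contDiffOn_reducedCurrent hγ hE hL μ)

lemma pd_sq {𝒟 : Set Spacetime} {f : Spacetime → ℝ} (hD : UniqueDiffWithinAt ℝ 𝒟 p)
    (hf : DifferentiableWithinAt ℝ f 𝒟 p) (μ : Fin 4) :
    pd 𝒟 μ (fun q => f q ^ 2) p = 2 * f p * pd 𝒟 μ f p := by
  refine pd_comp (φ := fun z => z ^ 2) hD hf ?_
  simpa using hasDerivAt_pow 2 (f p)

lemma pd_minkowskiSq {𝒟 : Set Spacetime} (hD : UniqueDiffWithinAt ℝ 𝒟 p)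
    (hu : ∀ α, DifferentiableWithinAt ℝ (fun q => u q α) 𝒟 p) (μ : Fin 4) :
    pd 𝒟 μ (fun q => minkowskiSq (u q)) p =
      2 * (-(u p 0 * pd 𝒟 μ (fun q => u q 0) p) + u p 1 * pd 𝒟 μ (fun q => u q 1) p +
        u p 2 * pd 𝒟 μ (fun q => u q 2) p + u p 3 * pd 𝒟 μ (fun q => u q 3) p) := by
  have hsq := fun α => (hu α).pow 2
  have e : (fun q => minkowskiSq (u q)) =
      fun q => -1 * u q 0 ^ 2 + u q 1 ^ 2 + u q 2 ^ 2 + u q 3 ^ 2 := by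
    funext q
    simp only [minkowskiSq]
    ring
  have h0 := hu 0
  have h1 := hu 1
  have h2 := hu 2
  have h3 := hu 3
  rw [e, pd_add hD (by fun_prop) (by fun_prop), pd_add hD (by fun_prop) (by fun_prop),
    pd_add hD (by fun_prop) (by fun_prop), pd_const_mul hD (by fun_prop), pd_sq hD h0,
    pd_sq hD h1, pd_sq hD h2, pd_sq hD h3]
  ring

lemma pd_energyForm (hγ : 1 < γ) (hT : 0 < T) (hE : IsEulerSolution γ T s r u)
    (hL : IsLinearizedSolution γ T s r u s' r' u') (hp : p ∈ movingDomain T r) (μ : Fin 4) :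
    pd (movingDomain T r) μ (energyForm γ s r s' r' u') p =
      1 / (γ - 1) * (2 * r' p * pd (movingDomain T r) μ r' p) +
        ((deriv (Gam γ) (s p) * pd (movingDomain T r) μ s p + pd (movingDomain T r) μ r p) * r p +
          (Gam γ (s p) + r p) * pd (movingDomain T r) μ r p) * minkowskiSq (u' p) +
        (Gam γ (s p) + r p) * r p * pd (movingDomain T r) μ (fun q => minkowskiSq (u' q)) p +
        pd (movingDomain T r) μ r p * s' p ^ 2 +
        r p * (2 * s' p * pd (movingDomain T r) μ s' p) := by
  have hD := uniqueDiffOn_movingDomain hT hE.cont_r p hp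
  have c0 := hE.reg_s.contDiffOn.differentiableOn one_ne_zero p hp
  have c1 := hE.reg_r.contDiffOn.differentiableOn one_ne_zero p hp
  have c2 := hL.reg_s.contDiffOn.differentiableOn one_ne_zero p hp
  have c3 := hL.reg_r.contDiffOn.differentiableOn one_ne_zero p hp
  have c4 := fun α => (hL.reg_u α).contDiffOn.differentiableOn one_ne_zero p hp
  have c5 : DifferentiableWithinAt ℝ (fun p => Gam γ (s p)) (movingDomain T r) p :=
    ((contDiff_Gam hγ).comp_contDiffOn hE.reg_s.contDiffOn).differentiableOn one_ne_zero p hp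
  have c6 : DifferentiableWithinAt ℝ (fun q => minkowskiSq (u' q)) (movingDomain T r) p := by
    have c40 := c4 0
    have c41 := c4 1
    have c42 := c4 2
    have c43 := c4 3
    unfold minkowskiSq
    fun_prop
  have e := pd_comp (μ := μ) hD c0 (((contDiff_Gam hγ).differentiable one_ne_zero (s p)).hasDerivAt)
  unfold energyForm
  rw [pd_add hD (by fun_prop) (by fun_prop), pd_add hD (by fun_prop) (by fun_prop),
    pd_const_mul hD (by fun_prop), pd_sq hD c3, pd_mul hD (by fun_prop) c6,
    pd_mul hD (by fun_prop) c1, pd_add hD c5 c1, e, pd_mul hD c1 (by fun_prop), pd_sq hD c2]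
  ring

/-- The divergence of the energy current is at most a multiple of its time component, by a factor
that depends on the background only. -/
lemma energyCurrent_divergence (hγ : 1 < γ) (hT : 0 < T) (hE : IsEulerSolution γ T s r u)
    (hL : IsLinearizedSolution γ T s r u s' r' u') (hB : BackgroundBounds γ T m s r u p)
    (hp : p ∈ movingDomain T r) :
    ∑ μ, pd (movingDomain T r) μ (energyCurrent γ s r u s' r' u' μ) p ≤
      92 * (m ^ 3 * (200 * m ^ 8)) * energyCurrent γ s r u s' r' u' 0 p := by
  have hD := uniqueDiffOn_movingDomain hT hE.cont_r p hp
  have hr : 0 < r p := hp.2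
  have hb : 0 < γ - 1 := by linarith
  have hm := hB.one_le
  have hG := Gam_pos hγ (s p)
  have hw := weight_pos (γ := γ) hp.2
  have hQ := minkowskiSq_nonneg hE hL hp
  have c1 := hE.reg_r.contDiffOn.differentiableOn one_ne_zero p hp
  have c3 := hL.reg_r.contDiffOn.differentiableOn one_ne_zero p hp
  have c4 := fun α => (hL.reg_u α).contDiffOn.differentiableOn one_ne_zero p hp
  have cu := fun α => (hE.reg_u α).contDiffOn.differentiableOn one_ne_zero p hp
  have cw := (contDiffOn_weight hE).differentiableOn one_ne_zero p hp
  have cY := fun μ => (contDiffOn_reducedCurrent hγ hE hL μ).differentiableOn one_ne_zero p hp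
  have cE : DifferentiableWithinAt ℝ (energyForm γ s r s' r' u') (movingDomain T r) p := by
    have c0 : DifferentiableWithinAt ℝ (fun p => Gam γ (s p)) (movingDomain T r) p :=
      ((contDiff_Gam hγ).comp_contDiffOn hE.reg_s.contDiffOn).differentiableOn one_ne_zero p hp
    have c2 := hL.reg_s.contDiffOn.differentiableOn one_ne_zero p hp
    have c40 := c4 0
    have c41 := c4 1
    have c42 := c4 2
    have c43 := c4 3
    unfold energyForm minkowskiSq
    fun_prop
  have pdY : ∀ μ, pd (movingDomain T r) μ (reducedCurrent γ s r u s' r' u' μ) p =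
      1 / 2 * (pd (movingDomain T r) μ (fun q => u q μ) p * energyForm γ s r s' r' u' p +
        u p μ * pd (movingDomain T r) μ (energyForm γ s r s' r' u') p) +
      (u' p μ * pd (movingDomain T r) μ r p * r' p + r p * (u' p μ * pd (movingDomain T r) μ r' p) +
        r p * r' p * pd (movingDomain T r) μ (fun q => u' q μ) p) := by
    intro μ
    have cuμ := cu μ
    have c4μ := c4 μ
    unfold reducedCurrent
    rw [pd_add hD (by fun_prop) (by fun_prop), pd_const_mul hD (by fun_prop), pd_mul hD cuμ cE,
      pd_mul hD (by fun_prop) c4μ, pd_mul hD c1 c3]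
    ring
  -- the sums occurring in the equations
  set E := energyForm γ s r s' r' u' p with hEdef
  set Q := minkowskiSq (u' p)
  set dv := ∑ μ, pd (movingDomain T r) μ (fun q => u q μ) p
  set dv' := ∑ μ, pd (movingDomain T r) μ (fun q => u' q μ) p
  set ud := ∑ μ, u' p μ * pd (movingDomain T r) μ r p
  set ud' := ∑ μ, u' p μ * pd (movingDomain T r) μ r' p
  set us := ∑ μ, u' p μ * pd (movingDomain T r) μ s p
  set h := 1 / (Gam γ (s p) + r p)
  have hh : h * (Gam γ (s p) + r p) = 1 := by
    simp only [h]
    have : Gam γ (s p) + r p ≠ 0 := by positivity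
    field_simp
  have hsq : 1 / (Gam γ (s p) + r p) ^ 2 = h ^ 2 := by simp only [h, one_div, inv_pow]
  set DQ := ∑ μ, u p μ * pd (movingDomain T r) μ (fun q => minkowskiSq (u' q)) p with hDQ
  set Z := -(u' p 0 * ∑ μ, u' p μ * pd (movingDomain T r) μ (fun q => u q 0) p) +
    u' p 1 * ∑ μ, u' p μ * pd (movingDomain T r) μ (fun q => u q 1) p +
    u' p 2 * ∑ μ, u' p μ * pd (movingDomain T r) μ (fun q => u q 2) p +
    u' p 3 * ∑ μ, u' p μ * pd (movingDomain T r) μ (fun q => u q 3) p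
  have eq_Q : DQ = 2 * (-(h * ud') - Z - h * Q * Dt (movingDomain T r) u r p +
      (deriv (Gam γ) (s p) * h ^ 2 * s' p + h ^ 2 * r' p) * ud) := by
    have hc := contract_momentum (h := h)
      (k := deriv (Gam γ) (s p) * h ^ 2 * s' p + h ^ 2 * r' p) (hL.orth' hp)
      (dr' := fun μ => pd (movingDomain T r) μ r' p) (dr := fun μ => pd (movingDomain T r) μ r p)
      (du := fun μ α => pd (movingDomain T r) μ (fun q => u q α) p)
      (dw := fun μ α => pd (movingDomain T r) μ (fun q => u' q α) p) (fun α => by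
        refine (hL.eq_u p hp α).trans ?_
        rw [div_eq_mul_one_div (deriv (Gam γ) (s p)), hsq]
        ring)
    rw [hDQ]
    simp only [pd_minkowskiSq hD c4]
    simp only [Dt, ud', Z, Q, ud]
    rw [← hc]
    simp only [Fin.sum_univ_four]
    ring
  have hid := divergence_identity (G' := deriv (Gam γ) (s p)) hb.ne' hr.ne' hh (E := E) rfl
    (hE.eq_s p hp) (hE.eq_r p hp) (hL.eq_s p hp) (hL.eq_r p hp) eq_Q
  have hsum : ∑ μ, pd (movingDomain T r) μ (energyCurrent γ s r u s' r' u' μ) p = weight γ r p *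
      (-(1 / 2) * dv * r' p ^ 2 + 1 / 2 * ((γ - 1) * r p) * dv * (r p * Q) -
        (Gam γ (s p) + r p) * r p * Z +
        r p * (h * (deriv (Gam γ) (s p) * s' p + r' p)) * ud - r p * s' p * us) := by
    rw [← hid]
    have h1 : ∀ μ, pd (movingDomain T r) μ (energyCurrent γ s r u s' r' u' μ) p = weight γ r p *
        ((2 - γ) / (γ - 1) / r p * pd (movingDomain T r) μ r p * reducedCurrent γ s r u s' r' u' μ p +
          pd (movingDomain T r) μ (reducedCurrent γ s r u s' r' u' μ) p) := by
      intro μ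
      unfold energyCurrent
      rw [pd_mul hD cw (cY μ), pd_weight hT hE hp]
      ring
    simp only [h1, pdY, pd_energyForm hγ hT hE hL hp, reducedCurrent, ← Finset.mul_sum]
    rw [← hEdef]
    congr 1
    simp only [Dt, ud', hDQ, Fin.sum_univ_four]
    ring
  set q := √Q
  have hq0 : 0 ≤ q := Real.sqrt_nonneg _
  have hqQ : q ^ 2 = Q := Real.sq_sqrt hQ
  have hu'q : ∀ α, |u' p α| ≤ m * q := fun α =>
    (abs_le_mul_sqrt hE hL hp α).trans
      (mul_le_mul_of_nonneg_right ((le_abs_self _).trans (hB.u_le 0)) hq0)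
  set P := 200 * m ^ 8
  have hP : 0 ≤ P := by positivity
  have bud : |ud| ≤ 4 * (m * q * P) := by
    have := abs_sum_mul_le hu'q hB.dr_le
    exact_mod_cast this
  have bus : |us| ≤ 4 * (m * q * P) := by
    have := abs_sum_mul_le hu'q hB.ds_le
    exact_mod_cast this
  have bZ : |Z| ≤ 16 * (m ^ 2 * q ^ 2 * P) := by
    have h1 : ∀ α, |u' p α * ∑ μ, u' p μ * pd (movingDomain T r) μ (fun q => u q α) p| ≤
        m * q * (4 * (m * q * P)) := by
      intro α
      rw [abs_mul]
      have := abs_sum_mul_le hu'q fun μ => hB.du_le μ α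
      push_cast at this
      exact mul_le_mul (hu'q α) this (abs_nonneg _) (by positivity)
    have a0 := abs_le.1 (h1 0)
    have a1 := abs_le.1 (h1 1)
    have a2 := abs_le.1 (h1 2)
    have a3 := abs_le.1 (h1 3)
    have e : 16 * (m ^ 2 * q ^ 2 * P) = 4 * (m * q * (4 * (m * q * P))) := by ring
    rw [e]
    simp only [Z]
    rw [abs_le]
    constructor <;> linarith [a0.1, a0.2, a1.1, a1.2, a2.1, a2.2, a3.1, a3.2]
  have hlow := lower_order_le (s' := s' p) (r' := r' p) hm hP hb hB.gamma_le hr hB.r_le hG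
    (abs_deriv_Gam_le hγ (s p)) (by positivity) hh hB.inv_le hB.sound
    (abs_divergence_le hB) bud bus bZ
  rw [hqQ] at hlow
  have hEQ : 1 / (γ - 1) * r' p ^ 2 + (Gam γ (s p) + r p) * r p * Q + r p * s' p ^ 2 = E := rfl
  rw [hEQ] at hlow
  have h2 := (reducedCurrent_zero_bounds hγ hE hL hB hp).1
  rw [hsum]
  calc _ ≤ weight γ r p * (23 * (m ^ 3 * P) * E) := by gcongr
    _ = 92 * (m ^ 3 * P) * (weight γ r p * (1 / 4 * E)) := by ring
    _ ≤ _ := by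
        unfold energyCurrent
        gcongr

/-! ### The mass current -/

/-- The current `u^μ r^{(2-γ)/(γ-1)}`, whose slices measure the integrability of the weight. -/
noncomputable def massCurrent (γ : ℝ) (r : Spacetime → ℝ) (u : Spacetime → Fin 4 → ℝ)
    (μ : Fin 4) (p : Spacetime) : ℝ :=
  weight γ r p * u p μ

lemma contDiffOn_massCurrent (hE : IsEulerSolution γ T s r u) (μ : Fin 4) :
    ContDiffOn ℝ 1 (massCurrent γ r u μ) (movingDomain T r) :=
  (contDiffOn_weight hE).mul (hE.reg_u μ).contDiffOn

lemma weight_le_massCurrent (hE : IsEulerSolution γ T s r u) (hp : p ∈ movingDomain T r) :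
    weight γ r p ≤ massCurrent γ r u 0 p :=
  le_mul_of_one_le_right (weight_pos hp.2).le (hE.one_le hp)

/-- The constant `12 * m` is not optimal: it is the one of `energyCurrent_speed`, so that one cutoff
serves both currents. -/
lemma massCurrent_speed (hE : IsEulerSolution γ T s r u) (hB : BackgroundBounds γ T m s r u p)
    (hp : p ∈ movingDomain T r) :
    ∑ i : Fin 3, |massCurrent γ r u i.succ p| ≤ 12 * m * massCurrent γ r u 0 p := by
  have hw := weight_pos (γ := γ) hp.2
  have hm := hB.one_le
  have h1 := weight_le_massCurrent (γ := γ) hE hp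
  calc ∑ i : Fin 3, |massCurrent γ r u i.succ p| ≤ ∑ _i : Fin 3, weight γ r p * m := by
        refine Finset.sum_le_sum fun i _ => ?_
        rw [massCurrent, abs_mul, abs_of_pos hw]
        gcongr
        exact hB.u_le _
    _ = 3 * m * weight γ r p := by simp; ring
    _ ≤ 12 * m * weight γ r p := by gcongr; norm_num
    _ ≤ _ := by gcongr

/-- Unlike for the energy current, there is no error term. -/
lemma massCurrent_boundary (hγ : 1 < γ) (hE : IsEulerSolution γ T s r u)
    (hB : BackgroundBounds γ T m s r u p) (hp : p ∈ movingDomain T r) :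
    ∑ μ, massCurrent γ r u μ p * pd (movingDomain T r) μ r p ≤
      8 * m * (200 * m ^ 8) * r p * massCurrent γ r u 0 p + r p * 0 := by
  have hw := weight_pos (γ := γ) hp.2
  have hr : 0 < r p := hp.2
  have hm := hB.one_le
  have hb : 0 < γ - 1 := by linarith
  have e1 : ∑ μ, massCurrent γ r u μ p * pd (movingDomain T r) μ r p =
      weight γ r p * Dt (movingDomain T r) u r p := by
    simp only [massCurrent, Dt, Finset.mul_sum]
    exact Finset.sum_congr rfl fun μ _ => by ring
  have h2 : Dt (movingDomain T r) u r p =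
      (γ - 1) * r p * -∑ μ, pd (movingDomain T r) μ (fun q => u q μ) p := by
    linarith [hE.eq_r p hp]
  have h3 := (neg_le_abs _).trans (abs_divergence_le hB)
  have h4 := weight_le_massCurrent (γ := γ) hE hp
  have h5 := hB.gamma_le
  rw [e1, h2, mul_zero, add_zero]
  calc weight γ r p * ((γ - 1) * r p * -∑ μ, pd (movingDomain T r) μ (fun q => u q μ) p)
      ≤ weight γ r p * ((γ - 1) * r p * (4 * (200 * m ^ 8))) := by gcongr
    _ ≤ weight γ r p * (m * r p * (4 * (200 * m ^ 8))) := by gcongr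
    _ = 4 * m * (200 * m ^ 8) * r p * weight γ r p := by ring
    _ ≤ 8 * m * (200 * m ^ 8) * r p * weight γ r p := by gcongr; norm_num
    _ ≤ _ := by gcongr

lemma massCurrent_divergence (hγ : 1 < γ) (hT : 0 < T) (hE : IsEulerSolution γ T s r u)
    (hB : BackgroundBounds γ T m s r u p) (hp : p ∈ movingDomain T r) :
    ∑ μ, pd (movingDomain T r) μ (massCurrent γ r u μ) p ≤
      4 * m * (200 * m ^ 8) * massCurrent γ r u 0 p := by
  have hD := uniqueDiffOn_movingDomain hT hE.cont_r p hp
  have hw := weight_pos (γ := γ) hp.2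
  have hr : 0 < r p := hp.2
  have hm := hB.one_le
  have hb : 0 < γ - 1 := by linarith
  have cu := fun α => (hE.reg_u α).contDiffOn.differentiableOn one_ne_zero p hp
  have cw := (contDiffOn_weight hE).differentiableOn one_ne_zero p hp
  set 𝒟 := movingDomain T r
  have h1 : ∑ μ, pd 𝒟 μ (massCurrent γ r u μ) p =
      (2 - γ) / (γ - 1) * (weight γ r p / r p) * Dt 𝒟 u r p +
        weight γ r p * ∑ μ, pd 𝒟 μ (fun q => u q μ) p := by
    simp only [Dt, Finset.mul_sum, ← Finset.sum_add_distrib]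
    refine Finset.sum_congr rfl fun μ _ => ?_
    unfold massCurrent
    rw [pd_mul hD cw (cu μ), pd_weight hT hE hp]
    ring
  have h2 : Dt 𝒟 u r p = -((γ - 1) * r p * ∑ μ, pd 𝒟 μ (fun q => u q μ) p) := by
    linarith [hE.eq_r p hp]
  have h3 : ∑ μ, pd 𝒟 μ (massCurrent γ r u μ) p =
      weight γ r p * ((γ - 1) * ∑ μ, pd 𝒟 μ (fun q => u q μ) p) := by
    rw [h1, h2]
    field_simp
    ring
  have h4 := weight_le_massCurrent (γ := γ) hE hp
  have h5 := (le_abs_self _).trans (abs_divergence_le hB)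
  have h6 := hB.gamma_le
  rw [h3]
  calc weight γ r p * ((γ - 1) * ∑ μ, pd 𝒟 μ (fun q => u q μ) p)
      ≤ weight γ r p * ((γ - 1) * (4 * (200 * m ^ 8))) := by gcongr
    _ ≤ weight γ r p * (m * (4 * (200 * m ^ 8))) := by gcongr
    _ = 4 * m * (200 * m ^ 8) * weight γ r p := by ring
    _ ≤ _ := by gcongr

end

/-! ### Background norms -/

/-- A single quantity at least `1` that dominates `γ - 1`, the norms in `N`, and `1 / Γ(s)`, the
last because `|s|` is at most one of the entries of `N`. -/
noncomputable def dominant (γ : ℝ) (N : Fin 6 → ℝ) : ℝ :=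
  1 + (γ - 1) + ∑ i, |N i| + γ / (γ - 1) ^ ((γ - 1) / γ) * Real.exp (∑ i, |N i|)

/-- The growth rate of the energy, which is the factor in `energyCurrent_divergence`. -/
noncomputable def growthRate (γ : ℝ) (N : Fin 6 → ℝ) : ℝ :=
  92 * (dominant γ N ^ 3 * (200 * dominant γ N ^ 8))

lemma continuous_growthRate (γ : ℝ) : Continuous (growthRate γ) := by
  unfold growthRate dominant
  fun_prop

lemma Gam_const_pos {γ : ℝ} (hγ : 1 < γ) : 0 < γ / (γ - 1) ^ ((γ - 1) / γ) := by
  have : 0 < γ - 1 := by linarith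
  have : 0 < γ := by linarith
  positivity

lemma one_le_dominant {γ : ℝ} (hγ : 1 < γ) (N : Fin 6 → ℝ) : 1 ≤ dominant γ N := by
  have h1 := Gam_const_pos hγ
  have h2 : 0 ≤ ∑ i, |N i| := Finset.sum_nonneg fun i _ => abs_nonneg _
  have h3 : 0 ≤ γ / (γ - 1) ^ ((γ - 1) / γ) * Real.exp (∑ i, |N i|) := by positivity
  unfold dominant
  linarith

lemma growthRate_nonneg {γ : ℝ} (hγ : 1 < γ) (N : Fin 6 → ℝ) : 0 ≤ growthRate γ N := by
  have := one_le_dominant hγ N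
  unfold growthRate
  positivity

lemma dominant_mono {γ : ℝ} (hγ : 1 < γ) {N N' : Fin 6 → ℝ} (h : ∀ i, |N i| ≤ |N' i|) :
    dominant γ N ≤ dominant γ N' := by
  have h1 := Gam_const_pos hγ
  have h2 : ∑ i, |N i| ≤ ∑ i, |N' i| := Finset.sum_le_sum fun i _ => h i
  unfold dominant
  gcongr

lemma le_dominant {γ : ℝ} (hγ : 1 < γ) (N : Fin 6 → ℝ) (i : Fin 6) :
    N i ≤ dominant γ N := by
  have h1 := Gam_const_pos hγ
  have h2 : |N i| ≤ ∑ i, |N i| :=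
    Finset.single_le_sum (f := fun i => |N i|) (fun i _ => abs_nonneg _) (Finset.mem_univ i)
  have h3 := le_abs_self (N i)
  have h4 : 0 ≤ γ / (γ - 1) ^ ((γ - 1) / γ) * Real.exp (∑ i, |N i|) := by positivity
  unfold dominant
  linarith

lemma inv_Gam_le_dominant {γ : ℝ} (hγ : 1 < γ) {N : Fin 6 → ℝ} {i : Fin 6} {x : ℝ}
    (hx : |x| ≤ N i) : 1 / Gam γ x ≤ dominant γ N := by
  have h1 := Gam_const_pos hγ
  have h0 : 0 < γ := by linarith
  have h2 : |N i| ≤ ∑ i, |N i| :=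
    Finset.single_le_sum (f := fun i => |N i|) (fun i _ => abs_nonneg _) (Finset.mem_univ i)
  have h3 : (γ - 1) / γ * x ≤ ∑ i, |N i| := by
    have hk : (γ - 1) / γ ≤ 1 := by rw [div_le_one h0]; linarith
    have hk0 : 0 ≤ (γ - 1) / γ := div_nonneg (by linarith) h0.le
    have := le_abs_self x
    have := le_abs_self (N i)
    have := abs_nonneg x
    nlinarith
  have h4 : 1 / Gam γ x = γ / (γ - 1) ^ ((γ - 1) / γ) * Real.exp ((γ - 1) / γ * x) := by
    rw [Gam, one_div_div]
    ring
  have h5 : 0 ≤ ∑ i, |N i| := Finset.sum_nonneg fun i _ => abs_nonneg _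
  rw [h4]
  unfold dominant
  have h6 : γ / (γ - 1) ^ ((γ - 1) / γ) * Real.exp ((γ - 1) / γ * x) ≤
      γ / (γ - 1) ^ ((γ - 1) / γ) * Real.exp (∑ i, |N i|) := by gcongr
  linarith

lemma Gam_antitone {γ : ℝ} (hγ : 1 < γ) : Antitone (Gam γ) := by
  intro x y hxy
  unfold Gam
  have : 0 < γ - 1 := by linarith
  have : 0 < γ := by linarith
  gcongr

section

variable {γ T B : ℝ} {s r : Spacetime → ℝ} {u : Spacetime → Fin 4 → ℝ}

/-- The `L^∞` norms over the slices of a bounded continuous function are measurable in time, share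
its bound, and dominate its values. -/
lemma linf_slice_spec {V : Type*} [NormedAddCommGroup V] (hc : ContinuousOn r (slab T))
    {f : Spacetime → V} (hf : ContinuousOn f (movingDomain T r)) (hB : 0 ≤ B)
    (hb : ∀ p ∈ movingDomain T r, ‖f p‖ ≤ B) :
    Measurable ((Icc 0 T).indicator fun τ => linf (fluidRegion r τ) fun x => f (pt τ x)) ∧
      (∀ τ ∈ Icc 0 T, 0 ≤ linf (fluidRegion r τ) (fun x => f (pt τ x)) ∧
        linf (fluidRegion r τ) (fun x => f (pt τ x)) ≤ B) ∧
      ∀ τ ∈ Icc 0 T, ∀ x ∈ fluidRegion r τ,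
        ‖f (pt τ x)‖ ≤ linf (fluidRegion r τ) fun x => f (pt τ x) := by
  refine ⟨measurable_indicator_linf hc hf hb, fun τ hτ => ⟨linf_nonneg _ _, ?_⟩,
    fun τ hτ x hx => ?_⟩
  · exact linf_le (isOpen_fluidRegion hc hτ) hB fun x hx => hb _ ((pt_mem_movingDomain hτ).2 hx)
  · have mem : MapsTo (pt τ) (fluidRegion r τ) (movingDomain T r) := fun x hx =>
      (pt_mem_movingDomain hτ).2 hx
    exact norm_le_linf (f := fun x => f (pt τ x)) (isOpen_fluidRegion hc hτ)
      (hf.comp (continuous_pt_right τ).continuousOn mem) (fun x hx => hb _ (mem hx)) hx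

/-- The components of `backgroundNorms` are measurable in time, bounded, and dominate the background
at every point of the slice. -/
lemma backgroundNorms_spec (hT : 0 < T) (hE : IsEulerSolution γ T s r u) (hB : 0 ≤ B)
    (hs : ∀ p ∈ movingDomain T r, |s p| ≤ B) (hr : ∀ p ∈ movingDomain T r, |r p| ≤ B)
    (hu : ∀ p ∈ movingDomain T r, ∀ α, |u p α| ≤ B)
    (hd : ∀ p ∈ movingDomain T r, ∀ i : Fin 3,
      |pd (movingDomain T r) i.succ s p| ≤ B ∧ |pd (movingDomain T r) i.succ r p| ≤ B ∧
        ∀ α, |pd (movingDomain T r) i.succ (fun q => u q α) p| ≤ B) :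
    (∀ i, Measurable ((Icc 0 T).indicator fun τ => backgroundNorms T s r u τ i)) ∧
      (∀ τ ∈ Icc 0 T, ∀ i, 0 ≤ backgroundNorms T s r u τ i ∧ backgroundNorms T s r u τ i ≤ B) ∧
      ∀ τ ∈ Icc 0 T, ∀ x ∈ fluidRegion r τ,
        (∀ i : Fin 3, |pd (movingDomain T r) i.succ s (pt τ x)| ≤ backgroundNorms T s r u τ 0) ∧
        (∀ i : Fin 3, |pd (movingDomain T r) i.succ r (pt τ x)| ≤ backgroundNorms T s r u τ 1) ∧
        (∀ (i : Fin 3) α, |pd (movingDomain T r) i.succ (fun q => u q α) (pt τ x)| ≤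
          backgroundNorms T s r u τ 2) ∧
        |s (pt τ x)| ≤ backgroundNorms T s r u τ 3 ∧
        ∀ α, |u (pt τ x) α| ≤ backgroundNorms T s r u τ 5 := by
  have hD := uniqueDiffOn_movingDomain hT hE.cont_r
  have hc := hE.cont_r
  have cs := hE.reg_s.contDiffOn
  have cr := hE.reg_r.contDiffOn
  have cu := fun α => (hE.reg_u α).contDiffOn
  obtain ⟨m0, b0, n0⟩ := linf_slice_spec (f := fun p (i : Fin 3) => pd (movingDomain T r) i.succ s p)
    hc (continuousOn_pi.2 fun i => continuousOn_pd hD cs) hB fun p hp =>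
      (pi_norm_le_iff_of_nonneg hB).2 fun i => (hd p hp i).1
  obtain ⟨m1, b1, n1⟩ := linf_slice_spec (f := fun p (i : Fin 3) => pd (movingDomain T r) i.succ r p)
    hc (continuousOn_pi.2 fun i => continuousOn_pd hD cr) hB fun p hp =>
      (pi_norm_le_iff_of_nonneg hB).2 fun i => (hd p hp i).2.1
  obtain ⟨m2, b2, n2⟩ := linf_slice_spec
    (f := fun p (i : Fin 3) (α : Fin 4) => pd (movingDomain T r) i.succ (fun q => u q α) p)
    hc (continuousOn_pi.2 fun i => continuousOn_pi.2 fun α => continuousOn_pd hD (cu α)) hB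
    fun p hp => (pi_norm_le_iff_of_nonneg hB).2 fun i =>
      (pi_norm_le_iff_of_nonneg hB).2 fun α => (hd p hp i).2.2 α
  obtain ⟨m3, b3, n3⟩ := linf_slice_spec (f := s) hc cs.continuousOn hB hs
  obtain ⟨m4, b4, -⟩ := linf_slice_spec (f := r) hc cr.continuousOn hB hr
  obtain ⟨m5, b5, n5⟩ := linf_slice_spec (f := u) hc
    (continuousOn_pi.2 fun α => (cu α).continuousOn) hB
    fun p hp => (pi_norm_le_iff_of_nonneg hB).2 (hu p hp)
  refine ⟨?_, ?_, ?_⟩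
  · intro i
    match i with
    | 0 => exact m0
    | 1 => exact m1
    | 2 => exact m2
    | 3 => exact m3
    | 4 => exact m4
    | 5 => exact m5
  · intro τ hτ i
    match i with
    | 0 => exact b0 τ hτ
    | 1 => exact b1 τ hτ
    | 2 => exact b2 τ hτ
    | 3 => exact b3 τ hτ
    | 4 => exact b4 τ hτ
    | 5 => exact b5 τ hτ
  · intro τ hτ x hx
    refine ⟨fun i => (norm_le_pi_norm (fun i : Fin 3 => pd (movingDomain T r) i.succ s (pt τ x))
        i).trans (n0 τ hτ x hx),
      fun i => (norm_le_pi_norm (fun i : Fin 3 => pd (movingDomain T r) i.succ r (pt τ x))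
        i).trans (n1 τ hτ x hx), fun i α => ?_, n3 τ hτ x hx,
      fun α => (norm_le_pi_norm (u (pt τ x)) α).trans (n5 τ hτ x hx)⟩
    set w := fun (i : Fin 3) (α : Fin 4) =>
      pd (movingDomain T r) i.succ (fun q => u q α) (pt τ x)
    exact (norm_le_pi_norm (w i) α).trans ((norm_le_pi_norm w i).trans (n2 τ hτ x hx))

lemma backgroundBounds_of_norms (hγ : 1 < γ) (hE : IsEulerSolution γ T s r u) {N : Fin 6 → ℝ}
    {p : Spacetime} (hp : p ∈ movingDomain T r) (hr1 : r p ≤ 1)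
    (hsound : 4 * ((γ - 1) * r p) ≤ Gam γ (s p))
    (h0 : ∀ i : Fin 3, |pd (movingDomain T r) i.succ s p| ≤ N 0)
    (h1 : ∀ i : Fin 3, |pd (movingDomain T r) i.succ r p| ≤ N 1)
    (h2 : ∀ (i : Fin 3) α, |pd (movingDomain T r) i.succ (fun q => u q α) p| ≤ N 2)
    (h3 : |s p| ≤ N 3) (h5 : ∀ α, |u p α| ≤ N 5) :
    BackgroundBounds γ T (dominant γ N) s r u p := by
  have hm := one_le_dominant hγ N
  have hG := Gam_pos hγ (s p)
  have hr : 0 < r p := hp.2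
  have hN := le_dominant hγ N
  have hb : γ - 1 ≤ dominant γ N := by
    have g1 := Gam_const_pos hγ
    have g2 : 0 ≤ ∑ i, |N i| := Finset.sum_nonneg fun i _ => abs_nonneg _
    have g3 : 0 ≤ γ / (γ - 1) ^ ((γ - 1) / γ) * Real.exp (∑ i, |N i|) := by positivity
    unfold dominant
    linarith
  have hh : 1 / (Gam γ (s p) + r p) ≤ dominant γ N := by
    refine le_trans ?_ (inv_Gam_le_dominant hγ h3)
    gcongr
    linarith
  have hu := fun α => (h5 α).trans (hN 5)
  obtain ⟨k1, k2, k3⟩ := abs_derivative_le hm (by linarith : 0 < γ - 1) hb hr hr1 hG hh hsound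
    (hE.one_le hp) hu (fun i => (h0 i).trans (hN 0)) (fun i => (h1 i).trans (hN 1))
    (du := fun μ α => pd (movingDomain T r) μ (fun q => u q α) p)
    (fun i α => (h2 i α).trans (hN 2)) (hE.eq_s p hp) (hE.eq_r p hp) (hE.eq_u p hp)
  exact ⟨hm, hb, hr1, hh, hsound, hu, k1, k2, k3⟩

/-! ### Integrability of the weight -/

lemma fderiv_comp_pt_zero {R : Spacetime → ℝ} (hR : ContDiff ℝ 1 R) (x : Space) (i : Fin 3) :
    fderiv ℝ (fun x => R (pt 0 x)) x (Pi.single i 1) =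
      fderiv ℝ R (pt 0 x) (Pi.single i.succ 1) := by
  set A : Space →L[ℝ] Spacetime := ContinuousLinearMap.pi
    (Fin.cons 0 fun j => ContinuousLinearMap.proj j)
  have hA : ∀ y, A y = pt 0 y := by
    intro y
    funext μ
    refine Fin.cases ?_ (fun j => ?_) μ <;> simp [A]
  have h1 : HasFDerivAt (fun x => R (A x)) ((fderiv ℝ R (A x)).comp A) x :=
    ((hR.differentiable one_ne_zero) (A x)).hasFDerivAt.comp x A.hasFDerivAt
  simp only [hA] at h1
  rw [h1.fderiv, ContinuousLinearMap.comp_apply, hA]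
  congr 1
  funext μ
  refine Fin.cases ?_ (fun j => ?_) μ
  · simp
  · simp [Pi.single_apply]

/-- At the initial time the weight is integrable over bounded sets, because `r` vanishes simply and
the exponent exceeds `-1`. -/
lemma lintegral_massCurrent_zero_lt_top (hγ : 1 < γ) (hT : 0 < T) (hE : IsEulerSolution γ T s r u)
    (hvs : VanishesSimply T r) {M Λ L : ℝ} (hM : ∀ p ∈ movingDomain T r, ∀ α, |u p α| ≤ M)
    (hΛ : 0 ≤ Λ) (hL : 0 < L) :
    ∫⁻ x in fluidRegion r 0,
      ENNReal.ofReal (farCutoff Λ L (pt 0 x) * massCurrent γ r u 0 (pt 0 x)) < ⊤ := by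
  have h00 : (0 : ℝ) ∈ Icc 0 T := ⟨le_rfl, hT.le⟩
  obtain ⟨R, hR, hRr, hbd⟩ := hvs
  have hΩ := isOpen_fluidRegion hE.cont_r h00
  have hmem : ∀ x ∈ fluidRegion r 0, pt 0 x ∈ movingDomain T r := fun x hx =>
    (pt_mem_movingDomain h00).2 hx
  have hRpt : ContDiff ℝ 1 fun x => R (pt 0 x) := by
    refine hR.comp (contDiff_pi.2 fun μ => ?_)
    refine Fin.cases ?_ (fun j => ?_) μ
    · exact contDiff_const
    · exact contDiff_apply ℝ ℝ j
  set K : Set Space := Icc (fun _ => -(2 * L + 1)) (fun _ => 2 * L + 1)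
  have ha : -1 < (2 - γ) / (γ - 1) := by
    rw [lt_div_iff₀ (by linarith)]
    linarith
  have hfin := lintegral_rpow_lt_top hRpt ha hΩ
    (fun x hx => by rw [← hRr (hmem x hx)]; exact hx)
    (fun x hx => by
      obtain ⟨i, hi⟩ := hbd 0 h00 x hx
      exact ⟨i, by rwa [fderiv_comp_pt_zero hR]⟩) (K := K) isCompact_Icc
  refine lt_of_le_of_lt ?_ (ENNReal.mul_lt_top (ENNReal.ofReal_lt_top (r := M)) hfin)
  rw [← lintegral_const_mul' _ _ ENNReal.ofReal_ne_top, ← lintegral_indicator hΩ.measurableSet,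
    ← lintegral_indicator (hΩ.measurableSet.inter measurableSet_Icc)]
  refine lintegral_mono fun x => ?_
  by_cases hx : x ∈ fluidRegion r 0
  · rw [indicator_of_mem hx]
    by_cases hφ : farCutoff Λ L (pt 0 x) = 0
    · rw [hφ]
      simp
    · have hK : x ∈ K := by
        have := abs_le_of_farCutoff_ne_zero hΛ hL (p := pt 0 x) le_rfl hφ
        exact ⟨fun i => (abs_le.1 (this i)).1, fun i => (abs_le.1 (this i)).2⟩
      rw [indicator_of_mem (show x ∈ fluidRegion r 0 ∩ K from ⟨hx, hK⟩), ← hRr (hmem x hx)]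
      have hw : 0 < weight γ r (pt 0 x) := weight_pos (hmem x hx).2
      have hu := (le_abs_self _).trans (hM _ (hmem x hx) 0)
      have hu0 := hE.forward _ (hmem x hx)
      rw [← ENNReal.ofReal_mul (hu0.le.trans hu)]
      refine ENNReal.ofReal_le_ofReal ?_
      calc farCutoff Λ L (pt 0 x) * massCurrent γ r u 0 (pt 0 x)
          ≤ 1 * massCurrent γ r u 0 (pt 0 x) :=
            mul_le_mul_of_nonneg_right (farCutoff_le_one _ _ _) (mul_pos hw hu0).le
        _ = u (pt 0 x) 0 * weight γ r (pt 0 x) := by rw [one_mul, massCurrent, mul_comm]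
        _ ≤ M * weight γ r (pt 0 x) := by gcongr
  · rw [indicator_of_notMem hx]
    exact zero_le

/-- The weight is integrable over bounded parts of the moving domain. -/
lemma exists_bound_lintegral_massCurrent (hγ : 1 < γ) (hT : 0 < T)
    (hE : IsEulerSolution γ T s r u) (hvs : VanishesSimply T r) {m L : ℝ} (hm : 1 ≤ m)
    (hB : ∀ p ∈ movingDomain T r, BackgroundBounds γ T m s r u p) (hL : 0 < L) :
    ∃ A : ENNReal, A < ⊤ ∧ ∀ τ ∈ Icc 0 T, ∫⁻ x in fluidRegion r τ,
      ENNReal.ofReal (farCutoff (12 * m) L (pt τ x) * massCurrent γ r u 0 (pt τ x)) ≤ A := by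
  set c := 4 * m * (200 * m ^ 8)
  have hc : 0 ≤ c := by positivity
  have hM := lintegral_massCurrent_zero_lt_top hγ hT hE hvs (fun p hp => (hB p hp).u_le)
    (by positivity : 0 ≤ 12 * m) hL
  refine ⟨_, ENNReal.mul_lt_top (ENNReal.ofReal_lt_top (r := Real.exp (T * c))) hM,
    fun τ hτ => ?_⟩
  refine (lintegral_farCutoff_mul_le (V := massCurrent γ r u) (f := fun _ => 0) (c := fun _ => c)
    hT hE.cont_r
    hE.reg_r.contDiffOn (contDiffOn_massCurrent hE) (fun _ _ => le_rfl)
    (fun p hp => (weight_pos hp.2).le.trans (weight_le_massCurrent hE hp)) (by positivity)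
    (by positivity : 0 ≤ 8 * m * (200 * m ^ 8)) hL
    (fun p hp => massCurrent_speed hE (hB p hp) hp)
    (fun p hp => massCurrent_boundary hγ hE (hB p hp) hp)
    (fun p hp => massCurrent_divergence hγ hT hE (hB p hp) hp) hτ (fun _ _ => hc)
    intervalIntegrable_const (by simp)).trans ?_
  gcongr
  rw [intervalIntegral.integral_const, smul_eq_mul, sub_zero]
  gcongr
  exact hτ.2

/-- The error term in `energyCurrent_boundary` is integrable after multiplication by the cutoff at
infinity. -/
lemma integrable_boundary_flux (hγ : 1 < γ) (hT : 0 < T)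
    (hE : IsEulerSolution γ T s r u) (hvs : VanishesSimply T r) {m L : ℝ} (hm : 1 ≤ m)
    (hB : ∀ p ∈ movingDomain T r, BackgroundBounds γ T m s r u p) (hL : 0 < L)
    {s' r' : Spacetime → ℝ} {u' : Spacetime → Fin 4 → ℝ}
    (hLin : IsLinearizedSolution γ T s r u s' r' u') :
    Integrable ((movingDomain T r).indicator fun p => farCutoff (12 * m) L p *
      (weight γ r p * (|r' p| * |∑ μ, u' p μ * pd (movingDomain T r) μ r p|))) := by
  have hD := uniqueDiffOn_movingDomain hT hE.cont_r
  have hDm := measurableSet_movingDomain hE.cont_r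
  obtain ⟨A, hA, hAle⟩ := exists_bound_lintegral_massCurrent hγ hT hE hvs hm hB hL
  set f : Spacetime → ℝ := fun p => farCutoff (12 * m) L p *
      (weight γ r p * (|r' p| * |∑ μ, u' p μ * pd (movingDomain T r) μ r p|))
  have hfc : ContinuousOn f (movingDomain T r) := by
    have h1 := (contDiffOn_weight hE).continuousOn
    have h2 := hLin.reg_r.contDiffOn.continuousOn
    have h3 : ContinuousOn (fun p => ∑ μ, u' p μ * pd (movingDomain T r) μ r p)
        (movingDomain T r) := continuousOn_finsetSum _ fun μ _ =>
      (hLin.reg_u μ).contDiffOn.continuousOn.mul (continuousOn_pd hD hE.reg_r.contDiffOn)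
    exact (contDiff_farCutoff _ _).continuous.continuousOn.mul (h1.mul (h2.abs.mul h3.abs))
  have hf0 : ∀ p, 0 ≤ (movingDomain T r).indicator f p := fun p =>
    indicator_nonneg (fun q hq => mul_nonneg (farCutoff_nonneg _ _ _)
      (mul_nonneg (weight_pos hq.2).le (by positivity))) p
  have hmeas : AEStronglyMeasurable ((movingDomain T r).indicator f) volume :=
    (aestronglyMeasurable_indicator_iff hDm).2 (hfc.aestronglyMeasurable hDm)
  -- bounds for the linearized solution on the support of the cutoff
  have hbox := isCompact_slabBox T (2 * L + 1)
  obtain ⟨B₁, hB₁⟩ := hLin.reg_r.exists_bound hbox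
  choose B₂ hB₂ using fun μ => (hLin.reg_u μ).exists_bound hbox
  obtain ⟨B, hBB⟩ : ∃ B : ℝ, ∀ p ∈ movingDomain T r ∩ slabBox T (2 * L + 1),
      |r' p| * |∑ μ, u' p μ * pd (movingDomain T r) μ r p| ≤ B := by
    refine ⟨|B₁| * ∑ μ, |B₂ μ| * (200 * m ^ 8), fun p hp => ?_⟩
    refine mul_le_mul ((hB₁ p hp).trans (le_abs_self _)) ?_ (abs_nonneg _) (abs_nonneg _)
    refine (Finset.abs_sum_le_sum_abs _ _).trans (Finset.sum_le_sum fun μ _ => ?_)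
    rw [abs_mul]
    exact mul_le_mul ((hB₂ μ p hp).trans (le_abs_self _)) ((hB p hp.1).dr_le μ) (abs_nonneg _)
      (abs_nonneg _)
  refine ⟨hmeas, ?_⟩
  rw [hasFiniteIntegral_iff_ofReal (Filter.Eventually.of_forall hf0),
    ← measurePreserving_pt.lintegral_comp_emb measurableEmbedding_pt]
  have hmeas' : AEMeasurable (fun q : ℝ × Space =>
      ENNReal.ofReal ((movingDomain T r).indicator f (pt q.1 q.2))) (volume.prod volume) :=
    (hmeas.comp_measurePreserving measurePreserving_pt).aemeasurable.ennreal_ofReal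
  rw [lintegral_prod _ hmeas']
  calc ∫⁻ τ, ∫⁻ x, ENNReal.ofReal ((movingDomain T r).indicator f (pt τ x))
      ≤ ∫⁻ τ, (Icc 0 T).indicator (fun _ => ENNReal.ofReal B * A) τ := by
        refine lintegral_mono fun τ => ?_
        by_cases hτ : τ ∈ Icc 0 T
        · rw [indicator_of_mem hτ]
          refine le_trans ?_ (mul_le_mul_right (hAle τ hτ) _)
          rw [← lintegral_const_mul' _ _ ENNReal.ofReal_ne_top,
            ← lintegral_indicator (isOpen_fluidRegion hE.cont_r hτ).measurableSet]
          refine lintegral_mono fun x => ?_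
          by_cases hx : x ∈ fluidRegion r τ
          · have hp := (pt_mem_movingDomain hτ).2 hx
            rw [indicator_of_mem hx, indicator_of_mem hp]
            by_cases hφ : farCutoff (12 * m) L (pt τ x) = 0
            · simp [f, hφ]
            · have hbx : pt τ x ∈ slabBox T (2 * L + 1) := ⟨hp.1,
                abs_le_of_farCutoff_ne_zero (by positivity) hL hτ.1 hφ⟩
              have hle := hBB _ ⟨hp, hbx⟩
              have hB0 : 0 ≤ B := le_trans (by positivity) hle
              rw [← ENNReal.ofReal_mul hB0]
              refine ENNReal.ofReal_le_ofReal ?_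
              have hw := weight_pos (γ := γ) hp.2
              have hφ0 := farCutoff_nonneg (12 * m) L (pt τ x)
              calc f (pt τ x) ≤ farCutoff (12 * m) L (pt τ x) *
                    (massCurrent γ r u 0 (pt τ x) * B) := by
                    simp only [f]
                    gcongr
                    · exact hw.le.trans (weight_le_massCurrent hE hp)
                    · exact weight_le_massCurrent hE hp
                _ = _ := by ring
          · have hp := fun h => hx ((pt_mem_movingDomain (r := r) hτ).1 h)
            rw [indicator_of_notMem hp]
            simp
        · rw [indicator_of_notMem hτ]
          refine le_of_eq ((lintegral_congr fun x => ?_).trans lintegral_zero)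
          have hp : pt τ x ∉ movingDomain T r := fun h => hτ h.1
          rw [indicator_of_notMem hp]
          simp
    _ = ENNReal.ofReal B * A * volume (Icc 0 T) := by
        rw [lintegral_indicator measurableSet_Icc, setLIntegral_const]
    _ < ⊤ := ENNReal.mul_lt_top (ENNReal.mul_lt_top ENNReal.ofReal_lt_top hA)
        measure_Icc_lt_top

/-! ### The energy inequality -/

/-- Gronwall's inequality for the time component of the energy current. -/
lemma lintegral_energyCurrent_le (hγ : 1 < γ) (hT : 0 < T)
    (hE : IsEulerSolution γ T s r u) (hvs : VanishesSimply T r) {m : ℝ} (hm : 1 ≤ m)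
    (hB : ∀ p ∈ movingDomain T r, BackgroundBounds γ T m s r u p)
    {s' r' : Spacetime → ℝ} {u' : Spacetime → Fin 4 → ℝ}
    (hLin : IsLinearizedSolution γ T s r u s' r' u') {c : ℝ → ℝ} {t : ℝ} (ht : t ∈ Icc 0 T)
    (hc0 : ∀ τ ∈ Icc 0 t, 0 ≤ c τ) (hc : IntervalIntegrable c volume 0 t)
    (hdiv : ∀ p ∈ movingDomain T r,
      ∑ μ, pd (movingDomain T r) μ (energyCurrent γ s r u s' r' u' μ) p ≤
        c (p 0) * energyCurrent γ s r u s' r' u' 0 p) :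
    ∫⁻ x in fluidRegion r t, ENNReal.ofReal (energyCurrent γ s r u s' r' u' 0 (pt t x)) ≤
      ENNReal.ofReal (Real.exp (∫ τ in (0 : ℝ)..t, c τ)) *
        ∫⁻ x in fluidRegion r 0, ENNReal.ofReal (energyCurrent γ s r u s' r' u' 0 (pt 0 x)) := by
  have h00 : (0 : ℝ) ∈ Icc 0 T := ⟨le_rfl, hT.le⟩
  set V := energyCurrent γ s r u s' r' u'
  have hV := contDiffOn_energyCurrent hγ hE hLin
  have hV0 : ∀ p ∈ movingDomain T r, 0 ≤ V 0 p := fun p hp =>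
    energyCurrent_zero_nonneg hγ hE hLin (hB p hp) hp
  have hΩ := isOpen_fluidRegion hE.cont_r ht
  have hstep : ∀ n : ℕ, ∫⁻ x in fluidRegion r t,
      ENNReal.ofReal (farCutoff (12 * m) (n + 1) (pt t x) * V 0 (pt t x)) ≤
      ENNReal.ofReal (Real.exp (∫ τ in (0 : ℝ)..t, c τ)) *
        ∫⁻ x in fluidRegion r 0, ENNReal.ofReal (V 0 (pt 0 x)) := by
    intro n
    have hL : (0 : ℝ) < n + 1 := by positivity
    refine (lintegral_farCutoff_mul_le (V := V) hT hE.cont_r hE.reg_r.contDiffOn hV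
      (fun p hp => mul_nonneg (weight_pos hp.2).le (by positivity)) hV0 (by positivity)
      (by positivity : 0 ≤ 8 * m * (200 * m ^ 8)) hL
      (fun p hp => energyCurrent_speed hγ hE hLin (hB p hp) hp)
      (fun p hp => energyCurrent_boundary hγ hE hLin (hB p hp) hp) hdiv ht hc0 hc
      (integrable_boundary_flux hγ hT hE hvs hm hB hL hLin)).trans ?_
    refine mul_le_mul_right (setLIntegral_mono' (isOpen_fluidRegion hE.cont_r h00).measurableSet
      fun x hx => ENNReal.ofReal_le_ofReal ?_) _
    exact mul_le_of_le_one_left (hV0 _ ((pt_mem_movingDomain h00).2 hx)) (farCutoff_le_one _ _ _)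
  calc ∫⁻ x in fluidRegion r t, ENNReal.ofReal (V 0 (pt t x))
      = ∫⁻ x in fluidRegion r t, Filter.liminf (fun n : ℕ =>
          ENNReal.ofReal (farCutoff (12 * m) (n + 1) (pt t x) * V 0 (pt t x))) Filter.atTop := by
        refine setLIntegral_congr_fun hΩ.measurableSet fun x hx => ?_
        symm
        refine Filter.Tendsto.liminf_eq (tendsto_const_nhds.congr' ?_)
        obtain ⟨N, hN⟩ := exists_nat_gt (growingRadius (12 * m) 1 (pt t x))
        filter_upwards [Filter.eventually_ge_atTop N] with n hn
        have h2 : (N : ℝ) ≤ n := by exact_mod_cast hn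
        have h3 : growingRadius (12 * m) (n + 1) (pt t x) ≤ 1 := by
          have e : growingRadius (12 * m) (n + 1) (pt t x) =
              growingRadius (12 * m) 1 (pt t x) / (n + 1) := by
            unfold growingRadius
            ring
          rw [e, div_le_one (by positivity)]
          linarith
        have h4 : farCutoff (12 * m) (n + 1) (pt t x) = 1 :=
          Real.smoothTransition.one_of_one_le (by linarith)
        rw [h4, one_mul]
    _ ≤ Filter.liminf (fun n : ℕ => ∫⁻ x in fluidRegion r t,
          ENNReal.ofReal (farCutoff (12 * m) (n + 1) (pt t x) * V 0 (pt t x))) Filter.atTop := by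
        refine lintegral_liminf_le' fun n => ?_
        have hcont : ContinuousOn (fun x => farCutoff (12 * m) (n + 1) (pt t x) * V 0 (pt t x))
            (fluidRegion r t) := by
          refine ContinuousOn.comp (g := fun p => farCutoff (12 * m) (n + 1) p * V 0 p)
            (t := movingDomain T r) ?_ (continuous_pt_right t).continuousOn
            fun x hx => (pt_mem_movingDomain ht).2 hx
          exact (contDiff_farCutoff _ _).continuous.continuousOn.mul (hV 0).continuousOn
        exact (hcont.aemeasurable hΩ.measurableSet).ennreal_ofReal
    _ ≤ Filter.liminf (fun _ : ℕ => ENNReal.ofReal (Real.exp (∫ τ in (0 : ℝ)..t, c τ)) *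
          ∫⁻ x in fluidRegion r 0, ENNReal.ofReal (V 0 (pt 0 x))) Filter.atTop :=
        Filter.liminf_le_liminf (Filter.Eventually.of_forall hstep)
    _ = _ := Filter.liminf_const _

lemma half_energyDensity_eq {s' r' : Spacetime → ℝ} {u' : Spacetime → Fin 4 → ℝ}
    (hLin : IsLinearizedSolution γ T s r u s' r' u') {p : Spacetime}
    (hp : p ∈ movingDomain T r) :
    1 / 2 * energyDensity γ s r u s' r' u' p =
      1 / 2 * (weight γ r p * energyForm γ s r s' r' u' p) := by
  rw [energyDensity, normSqG_eq (hLin.orth p hp)]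
  rfl

/-- The energy is comparable to the slice integral of the time component of its current. -/
lemma energy_comparison (hγ : 1 < γ) (hE : IsEulerSolution γ T s r u) {m M : ℝ}
    (hB : ∀ p ∈ movingDomain T r, BackgroundBounds γ T m s r u p)
    (hM : ∀ p ∈ movingDomain T r, u p 0 ≤ M) (hM0 : 0 ≤ M)
    {s' r' : Spacetime → ℝ} {u' : Spacetime → Fin 4 → ℝ}
    (hLin : IsLinearizedSolution γ T s r u s' r' u') {t : ℝ} (ht : t ∈ Icc 0 T) :
    energy γ s r u s' r' u' t ≤ ENNReal.ofReal 2 *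
        ∫⁻ x in fluidRegion r t, ENNReal.ofReal (energyCurrent γ s r u s' r' u' 0 (pt t x)) ∧
      ∫⁻ x in fluidRegion r t, ENNReal.ofReal (energyCurrent γ s r u s' r' u' 0 (pt t x)) ≤
        ENNReal.ofReal (3 / 2 * M) * energy γ s r u s' r' u' t := by
  have hΩ := (isOpen_fluidRegion hE.cont_r ht).measurableSet
  unfold energy
  rw [← lintegral_const_mul' _ _ ENNReal.ofReal_ne_top,
    ← lintegral_const_mul' _ _ ENNReal.ofReal_ne_top]
  constructor
  · refine setLIntegral_mono' hΩ fun x hx => ?_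
    have hp := (pt_mem_movingDomain ht).2 hx
    have hw := weight_pos (γ := γ) hp.2
    rw [half_energyDensity_eq hLin hp, ← ENNReal.ofReal_mul zero_le_two]
    refine ENNReal.ofReal_le_ofReal ?_
    have h1 := mul_le_mul_of_nonneg_left (reducedCurrent_zero_bounds hγ hE hLin (hB _ hp) hp).1 hw.le
    unfold energyCurrent
    linarith
  · refine setLIntegral_mono' hΩ fun x hx => ?_
    have hp := (pt_mem_movingDomain ht).2 hx
    have hw := weight_pos (γ := γ) hp.2
    rw [half_energyDensity_eq hLin hp, ← ENNReal.ofReal_mul (by positivity)]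
    refine ENNReal.ofReal_le_ofReal ?_
    have h1 := mul_le_mul_of_nonneg_left (reducedCurrent_zero_bounds hγ hE hLin (hB _ hp) hp).2 hw.le
    have h2 := energyForm_nonneg hγ hE hLin hp
    have h3 := mul_le_mul_of_nonneg_right (hM _ hp) (mul_nonneg hw.le h2)
    unfold energyCurrent
    linarith

end

end VacuumEuler

theorem propositionP (γ : ℝ) (hγ : 1 < γ) :
    ∃ C : (Fin 6 → ℝ) → ℝ, Continuous C ∧
      ∀ S : ℝ, ∃ ε : ℝ, 0 < ε ∧ ε < 1 / 2 ∧
        ∀ M : ℝ, ∃ D : ℝ, 0 < D ∧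
          ∀ (T : ℝ) (s r : Spacetime → ℝ) (u : Spacetime → Fin 4 → ℝ), 0 < T →
            IsEulerSolution γ T s r u →
            (∀ p ∈ movingDomain T r, |s p| ≤ S) →
            (∀ p ∈ movingDomain T r, r p ≤ ε) →
            (∀ p ∈ movingDomain T r, ∀ α, |u p α| ≤ M) →
            HasBoundedDerivatives T s r u →
            VanishesSimply T r →
            ∀ (s' r' : Spacetime → ℝ) (u' : Spacetime → Fin 4 → ℝ),
              IsLinearizedSolution γ T s r u s' r' u' →
              ∀ t ∈ Set.Icc 0 T,
                IntervalIntegrable (fun τ => C (backgroundNorms T s r u τ))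
                  MeasureTheory.volume 0 t ∧
                energy γ s r u s' r' u' t ≤
                  ENNReal.ofReal
                    (D * Real.exp (∫ τ in (0 : ℝ)..t, C (backgroundNorms T s r u τ))) *
                  energy γ s r u s' r' u' 0 := by
  have hb : 0 < γ - 1 := by linarith
  refine ⟨growthRate γ, continuous_growthRate γ, fun S => ?_⟩
  -- `ε` makes the sound speed at most `1 / 2`
  refine ⟨min (1 / 4) (Gam γ |S| / (4 * (γ - 1))), ?_, ?_, fun M => ?_⟩
  · exact lt_min (by norm_num) (div_pos (Gam_pos hγ _) (by linarith))
  · exact (min_le_left _ _).trans_lt (by norm_num)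
  -- `3 |M|` comes from the comparison of the energy with `V⁰`, where `u⁰ ≤ |M|`; adding `1` keeps
  -- the constant positive for `M = 0`
  refine ⟨3 * |M| + 1, by positivity, ?_⟩
  intro T s r u hT hE hs hr hu hder hvs s' r' u' hLin t ht
  obtain ⟨K, hK⟩ := hder
  have h00 : (0 : ℝ) ∈ Icc 0 T := ⟨le_rfl, hT.le⟩
  have hr1 : ∀ p ∈ movingDomain T r, r p ≤ 1 := fun p hp =>
    (hr p hp).trans ((min_le_left _ _).trans (by norm_num))
  have hsound : ∀ p ∈ movingDomain T r, 4 * ((γ - 1) * r p) ≤ Gam γ (s p) := by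
    intro p hp
    have h1 := (hr p hp).trans (min_le_right _ _)
    rw [le_div_iff₀ (by linarith)] at h1
    have h2 : Gam γ |S| ≤ Gam γ (s p) :=
      Gam_antitone hγ (((le_abs_self _).trans (hs p hp)).trans (le_abs_self S))
    linarith
  set B := |S| + |M| + |K| + 1
  have hS := abs_nonneg S
  have hM := abs_nonneg M
  have hK0 := abs_nonneg K
  have hB : 0 ≤ B := by positivity
  have hSB : S ≤ B := by have := le_abs_self S; simp only [B]; linarith
  have hMB : M ≤ B := by have := le_abs_self M; simp only [B]; linarith
  have hKB : K ≤ B := by have := le_abs_self K; simp only [B]; linarith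
  obtain ⟨hmeas, hbd, hpt⟩ := backgroundNorms_spec hT hE hB
    (fun p hp => (hs p hp).trans hSB)
    (fun p hp => by
      rw [abs_of_pos hp.2]
      exact (hr1 p hp).trans (by simp only [B]; linarith))
    (fun p hp α => (hu p hp α).trans hMB)
    (fun p hp i => ⟨(hK p hp i).1.trans hKB, (hK p hp i).2.1.trans hKB,
      fun α => ((hK p hp i).2.2 α).trans hKB⟩)
  set N := backgroundNorms T s r u
  have hloc : ∀ p ∈ movingDomain T r, BackgroundBounds γ T (dominant γ (N (p 0))) s r u p := by
    intro p hp
    have hx := (pt_mem_movingDomain (T := T) (r := r) (x := fun i => p i.succ) hp.1).1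
      (by rwa [pt_eta])
    obtain ⟨k0, k1, k2, k3, k5⟩ := hpt (p 0) hp.1 _ hx
    rw [pt_eta] at k3
    simp only [pt_eta] at k0 k1 k2 k5
    exact backgroundBounds_of_norms hγ hE hp (hr1 p hp) (hsound p hp) k0 k1 k2 k3 k5
  have hdom : ∀ τ ∈ Icc 0 T, dominant γ (N τ) ≤ dominant γ fun _ => B := by
    intro τ hτ
    refine dominant_mono hγ fun i => ?_
    rw [abs_of_nonneg (hbd τ hτ i).1, abs_of_nonneg hB]
    exact (hbd τ hτ i).2
  have hglob : ∀ p ∈ movingDomain T r,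
      BackgroundBounds γ T (dominant γ fun _ => B) s r u p := fun p hp =>
    (hloc p hp).mono (hdom _ hp.1)
  have hint : IntervalIntegrable (fun τ => growthRate γ (N τ)) volume 0 t := by
    rw [intervalIntegrable_iff_integrableOn_Ioc_of_le ht.1]
    have hsub : Ioc 0 t ⊆ Icc 0 T := fun τ hτ => ⟨hτ.1.le, hτ.2.trans ht.2⟩
    have hm : Measurable fun τ => growthRate γ fun i => (Icc 0 T).indicator (fun τ => N τ i) τ :=
      (continuous_growthRate γ).measurable.comp (measurable_pi_iff.2 hmeas)
    refine Integrable.of_bound (C := growthRate γ fun _ => B) ?_ ?_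
    · refine (hm.aestronglyMeasurable (μ := volume.restrict (Ioc 0 t))).congr ?_
      filter_upwards [ae_restrict_mem measurableSet_Ioc] with τ hτ
      simp only [indicator_of_mem (hsub hτ)]
    · rw [ae_restrict_iff' measurableSet_Ioc]
      refine Filter.Eventually.of_forall fun τ hτ => ?_
      rw [Real.norm_eq_abs, abs_of_nonneg (growthRate_nonneg hγ _)]
      have h1 := hdom τ (hsub hτ)
      have h2 := one_le_dominant hγ (N τ)
      have h3 : 0 ≤ dominant γ (N τ) := by linarith
      have h4 : 0 ≤ dominant γ fun _ => B := by linarith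
      unfold growthRate
      gcongr
  refine ⟨hint, ?_⟩
  have hgr := lintegral_energyCurrent_le hγ hT hE hvs (one_le_dominant hγ _) hglob hLin ht
    (c := fun τ => growthRate γ (N τ)) (fun τ _ => growthRate_nonneg hγ _) hint
    (fun p hp => energyCurrent_divergence hγ hT hE hLin (hloc p hp) hp)
  have huM : ∀ p ∈ movingDomain T r, u p 0 ≤ |M| := fun p hp =>
    (le_abs_self _).trans ((hu p hp 0).trans (le_abs_self M))
  have hupper := (energy_comparison hγ hE hglob huM hM hLin ht).1
  have hlower := (energy_comparison hγ hE hglob huM hM hLin h00).2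
  set A := Real.exp (∫ τ in (0 : ℝ)..t, growthRate γ (N τ))
  have hA : 0 < A := Real.exp_pos _
  calc energy γ s r u s' r' u' t
      ≤ ENNReal.ofReal 2 * (ENNReal.ofReal A *
          (ENNReal.ofReal (3 / 2 * |M|) * energy γ s r u s' r' u' 0)) := by
        refine hupper.trans ?_
        gcongr
        refine hgr.trans ?_
        gcongr
    _ = ENNReal.ofReal (2 * A * (3 / 2 * |M|)) * energy γ s r u s' r' u' 0 := by
        rw [ENNReal.ofReal_mul (p := 2 * A) (by positivity),
          ENNReal.ofReal_mul (p := 2) zero_le_two]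
        ring
    _ ≤ ENNReal.ofReal ((3 * |M| + 1) * A) * energy γ s r u s' r' u' 0 := by
        refine mul_le_mul_left (ENNReal.ofReal_le_ofReal ?_) _
        linarith
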